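/- Let $L>0$ and $0<r<1$. Let $(a_n)_{n\ge 0}$ be independent standard complex normal random variables (with density $\frac1\pi e^{-|z|^2}$ on $\mathbb C$), and let $$f_L(z)=\sum_{n=0}^\infty a_n\binom{L+n-1}{n}^{1/2}z^n,\qquad \binom{L+n-1}{n}=\frac{\Gamma(L+n)}{\Gamma(n+1)\,\Gamma(L)},\qquad |z|<1.$$ Let $n_L(r)$ denote the number of zeros of $f_L$ in the disc $D(0,r)=\{z:|z|<r\}$, counted with multiplicity. Almost surely the series converges for every $|z|<1$ and $n_L(r)$ is finite; moreover $n_L(r)$ is a square-integrable random variable, and $$\operatorname{Var}[n_L(r)]=\frac{L^2r^4}{2\pi(1-r^2)^2}\,I_L(r),$$ where $$I_L(r)=\int_{-\pi}^{\pi}\frac{(1-r^2)^{2L}}{|1-r^2e^{i\theta}|^{2L}-(1-r^2)^{2L}}\cdot\frac{2(1-\cos\theta)}{|1-r^2e^{i\theta}|^{2}}\,d\theta,$$ the integrand being positive for $\theta\in[-\pi,\pi]\setminus\{0\}$ and integrable on $[-\pi,\pi]$. -/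

import Mathlib

open MeasureTheory ProbabilityTheory
open scoped ENNReal

namespace HyperbolicGAF

noncomputable section

/-- The standard complex normal distribution `N_ℂ(0, 1)`: the measure on `ℂ` with density
`exp (-|z|²) / π` with respect to Lebesgue measure. -/
def stdComplexNormal : Measure ℂ :=
  volume.withDensity fun z => ENNReal.ofReal (Real.exp (-‖z‖ ^ 2) / Real.pi)

/-- The generalised binomial coefficient `Γ(L + n) / (Γ(n + 1) Γ(L))`. -/
def binomCoeff (L : ℝ) (n : ℕ) : ℝ :=
  Real.Gamma (L + n) / (Real.Gamma (n + 1) * Real.Gamma L)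

/-- The `n`-th term of the power series of intensity `L` with coefficients `c`, at `z`. -/
def gafTerm (L : ℝ) (c : ℕ → ℂ) (z : ℂ) (n : ℕ) : ℂ :=
  c n * (Real.sqrt (binomCoeff L n) : ℂ) * z ^ n

/-- `f_L(z) = ∑ₙ cₙ binom(L + n - 1, n)^{1/2} zⁿ`. -/
def gaf (L : ℝ) (c : ℕ → ℂ) (z : ℂ) : ℂ :=
  ∑' n : ℕ, gafTerm L c z n

/-- The counting measure on the zeros in the open unit disc of a function that is holomorphic
there, each zero being counted with its multiplicity (the order of vanishing, which is `0` at
the points that are not zeros). -/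
def zeroMeasure (f : ℂ → ℂ) : Measure ℂ :=
  Measure.sum fun z : Metric.ball (0 : ℂ) 1 =>
    ((analyticOrderAt f (z : ℂ) : ℕ∞) : ℝ≥0∞) • Measure.dirac (z : ℂ)

/-- `n_L(r)`: the number of zeros of `f_L` in the disc `D(0, r)`. -/
def zeroCount (L : ℝ) (c : ℕ → ℂ) (r : ℝ) : ℝ≥0∞ :=
  zeroMeasure (gaf L c) (Metric.ball 0 r)

/-- The integrand of `I_L(r)`. -/
def integrandI (L r θ : ℝ) : ℝ :=
  (1 - r ^ 2) ^ (2 * L) /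
      (‖1 - (r : ℂ) ^ 2 * Complex.exp (θ * Complex.I)‖ ^ (2 * L) - (1 - r ^ 2) ^ (2 * L)) *
    (2 * (1 - Real.cos θ) / ‖1 - (r : ℂ) ^ 2 * Complex.exp (θ * Complex.I)‖ ^ 2)

/-- The integral `I_L(r)`. -/
def integralI (L r : ℝ) : ℝ :=
  ∫ θ in (-Real.pi)..Real.pi, integrandI L r θ

end

end HyperbolicGAF

/-! Write `r = exp t`, and let `M(s)` be the mean of `log |f_L|` over the circle of radius `exp s`.
By Jensen's formula, `M(s)` is `log |f_L(0)|` plus the sum of `(s - log |u|)⁺` over the zeros `u`.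
Hence `M` is convex and piecewise linear in `s`, and its left derivative is the number `n(s)` of
zeros in the open disc. Moments of `n` are therefore derivatives of moments of `M`: `E n(t)` is the
derivative of `E M(t)`, and for `s < t`, `E n(s) n(t)` is the mixed derivative of `E M(s) M(t)`.
Keeping `s ≠ t` keeps the two circles apart, so that everything differentiated is smooth.

The pair `(f_L(z), f_L(w))` is complex Gaussian with covariance `(1 - z conj w)^(-L)`, by the
binomial series. For two standard complex normals whose correlation has squared modulus `x`, the
mixed moment of the logarithms of their moduli is `logCorr x / 4`, with `logCorr' x = -log (1 - x) /
x` (`hasDerivAt_logCorr`): a dilogarithm up to a constant.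

Let `g(s, t, θ)` be the logarithm of the squared correlation at two points of the circles. Then `∂s
∂t logCorr (e^g) = e^g / (1 - e^g) · g_s g_t - log (1 - e^g) · g_st`. Since `log |1 - exp (u +
iθ)|²` is harmonic in `(u, θ)`, `g_st = -g_θθ`. Integration by parts in `θ` turns the logarithmic
term into `e^g / (1 - e^g) · g_θ²`, which gives `covKernel` (`hasDerivAt_corrMeanDeriv`).

As `s` increases to `t`, `1 - e^g` vanishes at `θ = 0` to the order of the squared distance of the
two points, and so does `g_s g_t + g_θ²`. The kernel thus stays bounded (`abs_covKernel_le`),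
dominated convergence applies, and the diagonal value is a multiple of the integrand of `I_L(r)`
(`covKernel_self`).

Each exchange of limit and expectation rests on `integrable_and_integral_eq_of_tendsto`: backward
difference quotients of `M` lie between `0` and `n` and converge to `n`, so Fatou's lemma gives
integrability and then dominated convergence gives the value. Square integrability of `n` comes out
of the argument in this way. Convergence of the series and `f_L(0) ≠ 0`, which hold almost surely,
are made to hold everywhere by changing the coefficients on a null set (`exists_isTame`). -/

namespace HyperbolicGAF

/-! ### The complex normal law in polar coordinates, and its characteristic function. -/

open Set Filter Topology

noncomputable section

/-- The exponential distribution of rate `1`. -/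
def expLaw : Measure ℝ :=
  (volume.restrict (Ioi 0)).withDensity fun x => ENNReal.ofReal (Real.exp (-x))

/-- The uniform distribution on `(-π, π]`. -/
def angleLaw : Measure ℝ :=
  ENNReal.ofReal (2 * Real.pi)⁻¹ • volume.restrict (Ioc (-Real.pi) Real.pi)

lemma lintegral_expLaw {f : ℝ → ℝ≥0∞} (hf : Measurable f) :
    ∫⁻ x, f x ∂expLaw = ∫⁻ x in Ioi 0, ENNReal.ofReal (Real.exp (-x)) * f x := by
  rw [expLaw, lintegral_withDensity_eq_lintegral_mul _ (by fun_prop) hf]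
  rfl

lemma integral_expLaw (f : ℝ → ℝ) :
    ∫ x, f x ∂expLaw = ∫ x in Ioi 0, Real.exp (-x) * f x := by
  rw [expLaw, integral_withDensity_eq_integral_toReal_smul (by fun_prop) (by simp)]
  simp [ENNReal.toReal_ofReal, Real.exp_nonneg]

lemma integrable_expLaw_iff {f : ℝ → ℝ} :
    Integrable f expLaw ↔ IntegrableOn (fun x => Real.exp (-x) * f x) (Ioi 0) := by
  rw [expLaw, integrable_withDensity_iff_integrable_smul' (by fun_prop) (by simp)]
  simp [ENNReal.toReal_ofReal, Real.exp_nonneg, IntegrableOn]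

instance : IsProbabilityMeasure expLaw := by
  constructor
  have h := lintegral_expLaw (f := fun _ => 1) measurable_const
  simp only [lintegral_const, one_mul, mul_one] at h
  rw [h, ← ofReal_integral_eq_lintegral_ofReal]
  · rw [integral_exp_neg_Ioi]; simp
  · exact integrableOn_exp_neg_Ioi 0
  · exact ae_of_all _ fun x => Real.exp_nonneg _

instance : IsProbabilityMeasure angleLaw := by
  constructor
  simp only [angleLaw, Measure.smul_apply, smul_eq_mul, Measure.restrict_apply MeasurableSet.univ,
    univ_inter, Real.volume_Ioc]
  rw [← ENNReal.ofReal_mul (by positivity)]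
  have := Real.pi_pos
  rw [show (2 * Real.pi)⁻¹ * (Real.pi - -Real.pi) = 1 by field_simp; ring]
  simp

lemma ae_expLaw_pos : ∀ᵐ x ∂expLaw, 0 < x := by
  have : expLaw ≪ volume.restrict (Ioi 0) := withDensity_absolutelyContinuous _ _
  exact this.ae_le (ae_restrict_mem measurableSet_Ioi)

lemma integral_angleLaw (f : ℝ → ℝ) :
    ∫ x, f x ∂angleLaw = (2 * Real.pi)⁻¹ * ∫ x in (-Real.pi)..Real.pi, f x := by
  have := Real.pi_pos
  rw [angleLaw, integral_smul_measure, intervalIntegral.integral_of_le (by linarith),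
    ENNReal.toReal_ofReal (by positivity), smul_eq_mul]

/-- Periodicity moves the interval `(-π, π]` to the interval `[0, 2π]` used by `Real.circleAverage`.
-/
lemma integral_angleLaw_circleMap (F : ℂ → ℝ) (R : ℝ) :
    ∫ x, F (circleMap 0 R x) ∂angleLaw = Real.circleAverage F 0 R := by
  rw [integral_angleLaw, Real.circleAverage_def, smul_eq_mul]
  congr 1
  have hp : Function.Periodic (fun θ => F (circleMap 0 R θ)) (2 * Real.pi) :=
    fun x => by simp [periodic_circleMap 0 R x]
  have := hp.intervalIntegral_add_eq (-Real.pi) 0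
  rw [zero_add, show -Real.pi + 2 * Real.pi = Real.pi by ring] at this
  exact this

lemma measurable_polar : Measurable fun p : ℝ × ℝ => circleMap 0 (Real.sqrt p.1) p.2 := by
  unfold circleMap; fun_prop

/-- A standard complex normal variable has a uniform phase and an independent, exponentially
distributed squared modulus. -/
theorem stdComplexNormal_eq_map_polar :
    stdComplexNormal =
      (expLaw.prod angleLaw).map fun p => circleMap 0 (Real.sqrt p.1) p.2 := by
  have hpi := Real.pi_pos
  refine Measure.ext_of_lintegral _ fun F hF => ?_
  rw [lintegral_map hF measurable_polar, lintegral_prod (fun p : ℝ × ℝ => F (circleMap 0 (√p.1) p.2))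
      (hF.comp measurable_polar).aemeasurable]
  rw [lintegral_expLaw (f := fun x => ∫⁻ y, F (circleMap 0 (Real.sqrt x) y) ∂angleLaw)
    (Measurable.lintegral_prod_right' (hF.comp measurable_polar))]
  -- The substitution `x = r²` turns `e^(-x) dx / (2π)` into `e^(-r²) r dr / π`, the radial part of
  -- the density in polar coordinates.
  have himg : (fun x : ℝ => x ^ 2) '' Ioi 0 = Ioi 0 := by
    ext x; constructor
    · rintro ⟨y, hy, rfl⟩; exact pow_pos (mem_Ioi.1 hy) 2
    · intro hx; exact ⟨Real.sqrt x, Real.sqrt_pos.2 hx, Real.sq_sqrt (le_of_lt hx)⟩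
  conv_rhs => rw [← himg]
  rw [lintegral_image_eq_lintegral_abs_deriv_mul measurableSet_Ioi (f' := fun x => 2 * x)
    (fun x _ => by simpa using (hasDerivAt_pow 2 x).hasDerivWithinAt)
    (fun x hx y hy h => (pow_left_inj₀ (le_of_lt hx) (le_of_lt hy) two_ne_zero).1 h)]
  rw [stdComplexNormal, lintegral_withDensity_eq_lintegral_mul _ (by fun_prop) hF,
    ← Complex.lintegral_comp_polarCoord_symm]
  rw [show polarCoord.target = Ioi (0 : ℝ) ×ˢ Ioo (-Real.pi) Real.pi from rfl,
    Measure.volume_eq_prod, ← Measure.prod_restrict, lintegral_prod]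
  · refine setLIntegral_congr_fun measurableSet_Ioi fun r hr => ?_
    have hr' : (0 : ℝ) < r := hr
    simp only [Pi.mul_apply, smul_eq_mul, Complex.norm_polarCoord_symm, sq_abs]
    rw [Real.sqrt_sq hr'.le, angleLaw, lintegral_smul_measure, smul_eq_mul,
      Measure.restrict_congr_set (Ioo_ae_eq_Ioc (μ := volume) (a := -Real.pi) (b := Real.pi))]
    have hmeas : Measurable fun y => F (circleMap 0 r y) :=
      hF.comp (continuous_circleMap 0 r).measurable
    rw [← lintegral_const_mul _ hmeas, ← lintegral_const_mul _ (hmeas.const_mul _),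
      ← lintegral_const_mul _ ((hmeas.const_mul _).const_mul _)]
    refine lintegral_congr fun θ => ?_
    have : Complex.polarCoord.symm (r, θ) = circleMap 0 r θ := by
      simp [circleMap, Complex.exp_mul_I]
    rw [this]
    simp only [← mul_assoc]
    rw [← ENNReal.ofReal_mul hr'.le, ← ENNReal.ofReal_mul (by positivity),
      ← ENNReal.ofReal_mul (by positivity), abs_of_pos (by positivity)]
    congr 2
    field_simp
  · apply Measurable.aemeasurable
    apply Measurable.mul (by fun_prop)
    have h1 : Measurable fun p : ℝ × ℝ => Complex.polarCoord.symm p := by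
      simp only [Complex.polarCoord_symm_apply]; fun_prop
    apply Measurable.comp (g := _ * F) _ h1
    exact Measurable.mul (by fun_prop) hF

instance : IsProbabilityMeasure stdComplexNormal := by
  rw [stdComplexNormal_eq_map_polar]
  exact Measure.isProbabilityMeasure_map measurable_polar.aemeasurable

open ComplexConjugate in
/-- The characteristic function of the standard complex normal distribution. -/
theorem integral_cexp_stdComplexNormal (u : ℂ) :
    ∫ z, Complex.exp (((u * z).re : ℝ) * Complex.I) ∂stdComplexNormal
      = Complex.exp (-‖u‖ ^ 2 / 4) := by
  rw [stdComplexNormal, integral_withDensity_eq_integral_toReal_smul (by fun_prop) (by simp)]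
  have h := GaussianFourier.integral_cexp_neg_mul_sq_norm_add (V := ℂ) (b := 1) (by simp)
    Complex.I (conj u)
  simp only [Complex.finrank_real_complex, div_one, Nat.cast_ofNat] at h
  rw [show ((2 : ℂ) / 2) = 1 by norm_num, Complex.cpow_one] at h
  have hpi : (Real.pi : ℂ) ≠ 0 := by exact_mod_cast Real.pi_ne_zero
  have : ∀ z : ℂ, (ENNReal.ofReal (Real.exp (-‖z‖ ^ 2) / Real.pi)).toReal •
      Complex.exp (((u * z).re : ℝ) * Complex.I)
      = (Real.pi : ℂ)⁻¹ * Complex.exp (-1 * (‖z‖ : ℂ) ^ 2 + Complex.I * (inner ℝ (conj u) z : ℝ)) := by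
    intro z
    rw [ENNReal.toReal_ofReal (by positivity), Complex.real_smul, Complex.exp_add]
    have : inner ℝ (conj u) z = (u * z).re := by
      rw [Complex.inner]; simp; ring
    rw [this]
    push_cast
    rw [neg_one_mul, mul_comm Complex.I]
    field_simp
  simp_rw [this]
  rw [integral_const_mul, h, Complex.I_sq]
  rw [← mul_assoc, inv_mul_cancel₀ hpi]
  simp

end

end HyperbolicGAF

/-! ### Logarithmic moments of the exponential law. -/

namespace HyperbolicGAF

open Set Filter Topology

noncomputable section

/-- The exponent `1/4` is small enough for both uses: squaring gives powers down to `-1/2`, and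
multiplying by `x ^ (-1/2)` gives powers down to `-3/4`, all integrable at `0`. -/
lemma abs_log_le_rpow {x : ℝ} (hx : 0 < x) :
    |Real.log x| ≤ 4 * (x ^ (1 / 4 : ℝ) + x ^ (-(1 / 4) : ℝ)) := by
  have h1 := Real.log_le_rpow_div hx.le (show (0 : ℝ) < 1 / 4 by norm_num)
  have h2 := Real.log_le_rpow_div (inv_pos.2 hx).le (show (0 : ℝ) < 1 / 4 by norm_num)
  rw [Real.log_inv, Real.inv_rpow hx.le, ← Real.rpow_neg hx.le] at h2
  have h3 := Real.rpow_pos_of_pos hx (1 / 4)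
  have h4 := Real.rpow_pos_of_pos hx (-(1 / 4))
  rw [abs_le]; constructor <;> linarith

lemma integrableOn_exp_neg_mul_rpow {s : ℝ} (hs : -1 < s) :
    IntegrableOn (fun x : ℝ => Real.exp (-x) * x ^ s) (Ioi 0) := by
  simpa using Real.GammaIntegral_convergent (s := s + 1) (by linarith)

lemma integrableOn_exp_neg_mul_log_sq :
    IntegrableOn (fun x : ℝ => Real.exp (-x) * Real.log x ^ 2) (Ioi 0) := by
  have h := (((integrableOn_exp_neg_mul_rpow (s := 1 / 2) (by norm_num)).add
    ((integrableOn_exp_neg_mul_rpow (s := 0) (by norm_num)).const_mul 2)).add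
    (integrableOn_exp_neg_mul_rpow (s := -(1 / 2)) (by norm_num))).const_mul 16
  refine Integrable.mono' h (by fun_prop) ?_
  filter_upwards [ae_restrict_mem measurableSet_Ioi] with x hx
  have hx : 0 < x := hx
  have h1 := abs_log_le_rpow hx
  rw [Real.norm_of_nonneg (by positivity)]
  have h2 : Real.log x ^ 2 ≤ 16 * (x ^ (1 / 2 : ℝ) + 2 * x ^ (0 : ℝ) + x ^ (-(1 / 2) : ℝ)) := by
    calc Real.log x ^ 2 = |Real.log x| ^ 2 := (sq_abs _).symm
      _ ≤ (4 * (x ^ (1 / 4 : ℝ) + x ^ (-(1 / 4) : ℝ))) ^ 2 := by gcongr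
      _ = 16 * (x ^ (1 / 4 : ℝ) * x ^ (1 / 4 : ℝ) + 2 * (x ^ (1 / 4 : ℝ) * x ^ (-(1 / 4) : ℝ))
            + x ^ (-(1 / 4) : ℝ) * x ^ (-(1 / 4) : ℝ)) := by ring
      _ = _ := by simp only [← Real.rpow_add hx]; norm_num
  calc Real.exp (-x) * Real.log x ^ 2 ≤ Real.exp (-x) * _ :=
        mul_le_mul_of_nonneg_left h2 (Real.exp_nonneg _)
    _ = _ := by simp only [Pi.add_apply]; ring

lemma integrableOn_exp_neg_mul_log_mul_rpow :
    IntegrableOn (fun x : ℝ => Real.exp (-x) * (Real.log x * x ^ (-(1 / 2) : ℝ))) (Ioi 0) := by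
  have h := ((integrableOn_exp_neg_mul_rpow (s := -(1 / 4)) (by norm_num)).add
    (integrableOn_exp_neg_mul_rpow (s := -(3 / 4)) (by norm_num))).const_mul 4
  refine Integrable.mono' h (by fun_prop) ?_
  filter_upwards [ae_restrict_mem measurableSet_Ioi] with x hx
  have hx : 0 < x := hx
  have h1 := abs_log_le_rpow hx
  have h5 := Real.rpow_pos_of_pos hx (-(1 / 2))
  rw [norm_mul, norm_mul, Real.norm_of_nonneg (Real.exp_nonneg _), Real.norm_of_nonneg h5.le,
    Real.norm_eq_abs]
  have h2 : |Real.log x| * x ^ (-(1 / 2) : ℝ) ≤ 4 * (x ^ (-(1 / 4) : ℝ) + x ^ (-(3 / 4) : ℝ)) := by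
    calc |Real.log x| * x ^ (-(1 / 2) : ℝ)
        ≤ (4 * (x ^ (1 / 4 : ℝ) + x ^ (-(1 / 4) : ℝ))) * x ^ (-(1 / 2) : ℝ) := by gcongr
      _ = 4 * (x ^ (1 / 4 : ℝ) * x ^ (-(1 / 2) : ℝ) + x ^ (-(1 / 4) : ℝ) * x ^ (-(1 / 2) : ℝ)) := by
          ring
      _ = _ := by simp only [← Real.rpow_add hx]; norm_num
  calc Real.exp (-x) * (|Real.log x| * x ^ (-(1 / 2) : ℝ)) ≤ Real.exp (-x) * _ :=
        mul_le_mul_of_nonneg_left h2 (Real.exp_nonneg _)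
    _ = _ := by simp only [Pi.add_apply]; ring

lemma memLp_log_expLaw : MemLp Real.log 2 expLaw := by
  rw [memLp_two_iff_integrable_sq (Real.measurable_log.aestronglyMeasurable),
    integrable_expLaw_iff]
  exact integrableOn_exp_neg_mul_log_sq

lemma integrable_log_expLaw : Integrable Real.log expLaw :=
  memLp_log_expLaw.integrable (by norm_num)

/-- The mean of the logarithm of an exponential variable. -/
def logMean : ℝ := ∫ x, Real.log x ∂expLaw

/-- The second moment of the logarithm of an exponential variable. -/
def logSqMean : ℝ := ∫ x, Real.log x ^ 2 ∂expLaw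

lemma integrable_stdComplexNormal_iff {F : ℂ → ℝ} (hF : Measurable F) :
    Integrable F stdComplexNormal ↔
      Integrable (fun p : ℝ × ℝ => F (circleMap 0 (Real.sqrt p.1) p.2)) (expLaw.prod angleLaw) := by
  rw [stdComplexNormal_eq_map_polar, integrable_map_measure hF.aestronglyMeasurable
    measurable_polar.aemeasurable]
  rfl

lemma integral_stdComplexNormal {F : ℂ → ℝ} (hF : Measurable F)
    (hi : Integrable F stdComplexNormal) :
    ∫ z, F z ∂stdComplexNormal = ∫ x, Real.circleAverage F 0 (Real.sqrt x) ∂expLaw := by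
  rw [stdComplexNormal_eq_map_polar, integral_map measurable_polar.aemeasurable
    hF.aestronglyMeasurable, integral_prod _ ((integrable_stdComplexNormal_iff hF).1 hi)]
  simp_rw [integral_angleLaw_circleMap]

/-- The squared modulus of a standard complex normal variable is exponentially distributed. -/
lemma map_sq_norm_stdComplexNormal : stdComplexNormal.map (fun z => ‖z‖ ^ 2) = expLaw := by
  rw [stdComplexNormal_eq_map_polar, Measure.map_map (by fun_prop) measurable_polar]
  have : ((fun z : ℂ => ‖z‖ ^ 2) ∘ fun p : ℝ × ℝ => circleMap 0 (Real.sqrt p.1) p.2)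
      =ᵐ[expLaw.prod angleLaw] Prod.fst := by
    have h := Measure.quasiMeasurePreserving_fst (μ := expLaw) (ν := angleLaw)
    filter_upwards [h.ae ae_expLaw_pos] with p hp
    simp [hp.le]
  rw [Measure.map_congr this, Measure.map_fst_prod]
  simp

lemma log_norm_eq (z : ℂ) : Real.log ‖z‖ = Real.log (‖z‖ ^ 2) / 2 := by
  rw [Real.log_pow]; push_cast; ring

lemma memLp_log_norm : MemLp (fun z : ℂ => Real.log ‖z‖) 2 stdComplexNormal := by
  have h : MemLp (fun z : ℂ => Real.log (‖z‖ ^ 2)) 2 stdComplexNormal := by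
    have := memLp_log_expLaw
    rw [← map_sq_norm_stdComplexNormal] at this
    exact (memLp_map_measure_iff Real.measurable_log.aestronglyMeasurable
      (by fun_prop)).1 this
  simp_rw [log_norm_eq]
  exact h.const_mul (1 / 2) |>.ae_eq (ae_of_all _ fun z => by ring)

lemma integral_comp_sq_norm {h : ℝ → ℝ} (hh : Measurable h) :
    ∫ z, h (‖z‖ ^ 2) ∂stdComplexNormal = ∫ x, h x ∂expLaw := by
  rw [← map_sq_norm_stdComplexNormal, integral_map (by fun_prop) hh.aestronglyMeasurable]

lemma integral_log_norm : ∫ z, Real.log ‖z‖ ∂stdComplexNormal = logMean / 2 := by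
  simp_rw [log_norm_eq]
  rw [integral_div, integral_comp_sq_norm Real.measurable_log]
  rfl

lemma tendsto_mul_exp_neg_atTop : Tendsto (fun x : ℝ => x * Real.exp (-x)) atTop (𝓝 0) := by
  simpa using Real.tendsto_pow_mul_exp_neg_atTop_nhds_zero 1

/-- The mean of `log⁺ (S / a)` for an exponential variable `S` is an exponential integral. -/
lemma integral_posLog_expLaw {a : ℝ} (ha : 0 < a) :
    ∫ x, Real.posLog (a⁻¹ * x) ∂expLaw = ∫ u in Ioi a, Real.exp (-u) / u := by
  rw [integral_expLaw]
  have hbound : ∀ x ∈ Ioi a, 0 ≤ Real.log (a⁻¹ * x) ∧ Real.log (a⁻¹ * x) ≤ a⁻¹ * x := by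
    intro x hx
    have hx : a < x := hx
    have : 1 < a⁻¹ * x := by rw [inv_mul_eq_div, one_lt_div ha]; exact hx
    exact ⟨Real.log_nonneg this.le, Real.log_le_self (by linarith)⟩
  have h1 : ∫ x in Ioi 0, Real.exp (-x) * Real.posLog (a⁻¹ * x)
      = ∫ x in Ioi a, Real.exp (-x) * Real.log (a⁻¹ * x) := by
    rw [setIntegral_eq_of_subset_of_forall_sdiff_eq_zero measurableSet_Ioi
      (Ioi_subset_Ioi ha.le)]
    · refine setIntegral_congr_fun measurableSet_Ioi fun x hx => ?_
      simp only [Real.posLog, max_eq_right (hbound x hx).1]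
    · intro x hx
      have hx0 : 0 < x := hx.1
      have hxa : x ≤ a := not_lt.1 hx.2
      rw [(Real.posLog_eq_zero_iff _).2, mul_zero]
      rw [abs_of_pos (by positivity), inv_mul_eq_div, div_le_one ha]
      exact hxa
  rw [h1]
  have hi1 : IntegrableOn (fun x => Real.exp (-x) * Real.log (a⁻¹ * x)) (Ioi a) := by
    have h := ((integrableOn_exp_neg_mul_rpow (s := 1) (by norm_num)).mono_set
      (Ioi_subset_Ioi ha.le)).const_mul a⁻¹
    refine Integrable.mono' h (by fun_prop) ?_
    filter_upwards [ae_restrict_mem measurableSet_Ioi] with x hx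
    rw [norm_mul, Real.norm_of_nonneg (Real.exp_nonneg _),
      Real.norm_of_nonneg (hbound x hx).1, Real.rpow_one]
    calc _ ≤ Real.exp (-x) * (a⁻¹ * x) :=
          mul_le_mul_of_nonneg_left (hbound x hx).2 (Real.exp_nonneg _)
      _ = _ := by ring
  have hi2 : IntegrableOn (fun x => Real.exp (-x) / x) (Ioi a) := by
    have h := (integrableOn_exp_neg_Ioi a).const_mul a⁻¹
    refine Integrable.mono' h (Measurable.aestronglyMeasurable (by fun_prop)) ?_
    filter_upwards [ae_restrict_mem measurableSet_Ioi] with x hx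
    have hx : a < x := hx
    have hx0 : 0 < x := ha.trans hx
    rw [Real.norm_of_nonneg (by positivity), div_eq_inv_mul]
    gcongr
  -- Integration by parts: the boundary terms vanish, at `a` because `log 1 = 0` and at infinity by
  -- exponential decay.
  have hd : ∀ x ∈ Ici a, HasDerivAt (fun x => -Real.exp (-x) * Real.log (a⁻¹ * x))
      (Real.exp (-x) * Real.log (a⁻¹ * x) - Real.exp (-x) / x) x := by
    intro x hx
    have hx0 : 0 < x := ha.trans_le hx
    have e1 : HasDerivAt (fun x => Real.exp (-x)) (-Real.exp (-x)) x := by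
      simpa using (hasDerivAt_neg x).exp
    have e2 : HasDerivAt (fun x => Real.log (a⁻¹ * x)) (a⁻¹ / (a⁻¹ * x)) x := by
      simpa using ((hasDerivAt_id x).const_mul a⁻¹).log (by positivity)
    refine (e1.neg.mul e2).congr_deriv ?_
    rw [Pi.neg_apply]
    field_simp
    ring
  have hlim : Tendsto (fun x => -Real.exp (-x) * Real.log (a⁻¹ * x)) atTop (𝓝 0) := by
    have h0 : Tendsto (fun x => a⁻¹ * (x * Real.exp (-x))) atTop (𝓝 0) := by
      simpa using tendsto_mul_exp_neg_atTop.const_mul a⁻¹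
    refine squeeze_zero_norm' ?_ h0
    filter_upwards [eventually_gt_atTop a] with x hx
    rw [norm_mul, norm_neg, Real.norm_of_nonneg (Real.exp_nonneg _),
      Real.norm_of_nonneg (hbound x hx).1]
    calc _ ≤ Real.exp (-x) * (a⁻¹ * x) :=
          mul_le_mul_of_nonneg_left (hbound x hx).2 (Real.exp_nonneg _)
      _ = _ := by ring
  have h := integral_Ioi_of_hasDerivAt_of_tendsto' hd (hi1.sub hi2) hlim
  rw [integral_sub hi1 hi2, inv_mul_cancel₀ ha.ne', Real.log_one, mul_zero, sub_zero] at h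
  linarith

/-- The substitution `u = vR` frees the range of integration from `R`, so that Fubini applies when
`R` is averaged. -/
lemma integral_exp_neg_div_Ioi_mul {c R : ℝ} (hR : 0 < R) :
    ∫ u in Ioi (c * R), Real.exp (-u) / u = ∫ v in Ioi c, Real.exp (-(v * R)) / v := by
  have h := integral_comp_mul_right_Ioi (fun u => Real.exp (-u) / u) c hR
  rw [smul_eq_mul, inv_mul_eq_div, eq_div_iff hR.ne', mul_comm, ← integral_const_mul] at h
  rw [← h]
  refine setIntegral_congr_fun measurableSet_Ioi fun v _ => ?_
  by_cases hv : v = 0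
  · simp [hv]
  · field_simp

/-- Rescaling by `x = (1 + v) R` reduces this to the mean of `log x`. -/
lemma integral_exp_mul_log {v : ℝ} (hv : 0 < v) :
    ∫ R in Ioi 0, Real.exp (-R) * (Real.log R * Real.exp (-(v * R)))
      = (logMean - Real.log (1 + v)) / (1 + v) := by
  have h1 : (0 : ℝ) < 1 + v := by linarith
  have h := integral_comp_mul_left_Ioi
    (fun x => Real.exp (-x) * Real.log x - Real.exp (-x) * Real.log (1 + v)) 0 h1
  have h2 : ∫ x in Ioi (0 : ℝ), (Real.exp (-x) * Real.log x - Real.exp (-x) * Real.log (1 + v))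
      = logMean - Real.log (1 + v) := by
    rw [integral_sub (integrable_expLaw_iff.1 integrable_log_expLaw)
      ((integrableOn_exp_neg_Ioi 0).mul_const _), integral_mul_const, integral_exp_neg_Ioi,
      ← integral_expLaw]
    simp [logMean]
  rw [mul_zero, smul_eq_mul, h2] at h
  rw [div_eq_inv_mul, ← h]
  refine setIntegral_congr_fun measurableSet_Ioi fun R hR => ?_
  have hR : 0 < R := hR
  rw [Real.log_mul h1.ne' hR.ne', show -((1 + v) * R) = -R + -(v * R) by ring, Real.exp_add]
  ring

lemma exp_neg_le_rpow {y : ℝ} (hy : 0 < y) : Real.exp (-y) ≤ y ^ (-(1 / 2) : ℝ) := by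
  rw [Real.rpow_neg hy.le, Real.exp_neg]
  apply inv_anti₀ (Real.rpow_pos_of_pos hy _)
  rw [← Real.sqrt_eq_rpow, Real.sqrt_le_left (Real.exp_nonneg _), ← Real.exp_nat_mul]
  have := Real.add_one_le_exp ((2 : ℕ) * y)
  push_cast at this ⊢
  linarith

/-- The bound `e^(-vR) ≤ v^(-1/2) R^(-1/2)` separates the variables: what remains is `v^(-3/2)`,
integrable on `(c, ∞)`, times `e^(-R) |log R| R^(-1/2)`, integrable on `(0, ∞)`. -/
lemma integrable_exp_log_exp_div {c : ℝ} (hc : 0 < c) :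
    Integrable (fun p : ℝ × ℝ => Real.exp (-p.1) * (Real.log p.1 * (Real.exp (-(p.2 * p.1)) / p.2)))
      ((volume.restrict (Ioi 0)).prod (volume.restrict (Ioi c))) := by
  have hv : IntegrableOn (fun v : ℝ => v ^ (-(3 / 2) : ℝ)) (Ioi c) :=
    integrableOn_Ioi_rpow_of_lt (by norm_num) hc
  refine (integrableOn_exp_neg_mul_log_mul_rpow.mul_prod hv).mono (by fun_prop) ?_
  rw [Measure.prod_restrict]
  filter_upwards [ae_restrict_mem (measurableSet_Ioi.prod measurableSet_Ioi)] with p hp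
  have h1 : 0 < p.1 := hp.1
  have h2 : 0 < p.2 := hc.trans hp.2
  simp only [norm_mul, norm_div, Real.norm_of_nonneg (Real.exp_nonneg _), Real.norm_of_nonneg h2.le,
    Real.norm_of_nonneg (Real.rpow_nonneg h1.le _), Real.norm_of_nonneg (Real.rpow_nonneg h2.le _)]
  have h3 := exp_neg_le_rpow (mul_pos h2 h1)
  rw [Real.mul_rpow h2.le h1.le] at h3
  have h4 : p.2 ^ (-(3 / 2) : ℝ) = p.2 ^ (-(1 / 2) : ℝ) / p.2 := by
    rw [show (-(3 / 2) : ℝ) = -(1 / 2) - 1 by norm_num, Real.rpow_sub h2, Real.rpow_one]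
  rw [h4, mul_assoc, mul_assoc]
  gcongr
  rw [← mul_div_assoc]
  gcongr
  linarith

/-- The mean of `log R · log⁺ (S / (c R))` for independent exponential variables `R` and `S`. -/
lemma integral_log_mul_posLog {c : ℝ} (hc : 0 < c) :
    Integrable (fun R => Real.log R * ∫ v in Ioi c, Real.exp (-(v * R)) / v) expLaw ∧
    ∫ R, Real.log R * (∫ v in Ioi c, Real.exp (-(v * R)) / v) ∂expLaw
      = ∫ v in Ioi c, (logMean - Real.log (1 + v)) / (v * (1 + v)) := by
  have hI := integrable_exp_log_exp_div hc
  constructor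
  · rw [integrable_expLaw_iff]
    refine hI.integral_prod_left.congr (ae_of_all _ fun R => ?_)
    simp only [integral_const_mul]
  · rw [integral_expLaw]
    simp_rw [← integral_const_mul]
    rw [integral_integral_swap hI]
    refine setIntegral_congr_fun measurableSet_Ioi fun v hv => ?_
    have hv : 0 < v := hc.trans hv
    have h1 : (0 : ℝ) < 1 + v := by linarith
    simp only [← mul_div_assoc]
    rw [integral_div, integral_exp_mul_log hv, div_div, mul_comm v]

/-- The mixed logarithmic moment of two standard complex normal variables whose correlation has
squared modulus `x`. -/
def logCorr (x : ℝ) : ℝ :=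
  logMean * Real.log x + logSqMean +
    ∫ v in Ioi (x / (1 - x)), (logMean - Real.log (1 + v)) / (v * (1 + v))

lemma integrableOn_logMean_div {c : ℝ} (hc : 0 < c) :
    IntegrableOn (fun v => (logMean - Real.log (1 + v)) / (v * (1 + v))) (Ioi c) := by
  have hI := (integrable_exp_log_exp_div hc).integral_prod_right
  refine hI.congr ?_
  filter_upwards [ae_restrict_mem measurableSet_Ioi] with v hv
  have hv : 0 < v := hc.trans hv
  simp only [← mul_div_assoc]
  rw [integral_div, integral_exp_mul_log hv, div_div, mul_comm v]

/-- With `v = x / (1 - x)` one has `1 + v = 1 / (1 - x)` and `v (1 + v) = x / (1 - x)²`. The two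
contributions of `logMean` cancel, so neither it nor `logSqMean` ever has to be evaluated. -/
lemma hasDerivAt_logCorr {x : ℝ} (h0 : 0 < x) (h1 : x < 1) :
    HasDerivAt logCorr (-Real.log (1 - x) / x) x := by
  have hx1 : 0 < 1 - x := by linarith
  set f : ℝ → ℝ := fun v => (logMean - Real.log (1 + v)) / (v * (1 + v)) with hf
  have hc : 0 < x / (1 - x) := by positivity
  have hG : HasDerivAt (fun c => ∫ v in Ioi c, f v) (-f (x / (1 - x))) (x / (1 - x)) := by
    set c := x / (1 - x)
    have hcont : ContinuousOn f (Ioi 0) := by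
      refine ContinuousOn.div (continuousOn_const.sub (ContinuousOn.log (by fun_prop) ?_))
        (by fun_prop) ?_
      · intro v hv; have : 0 < v := hv; positivity
      · intro v hv; have : 0 < v := hv; positivity
    -- Near `c`, the tail integral is the fixed tail from `c / 2` minus an integral over a bounded
    -- interval, to which the fundamental theorem of calculus applies.
    have h := intervalIntegral.integral_hasDerivAt_right (a := c / 2) (b := c) (f := f)
      ((hcont.mono (by
        intro v hv
        rw [uIcc_of_le (by linarith)] at hv
        exact (half_pos hc).trans_le hv.1)).intervalIntegrable)
      (hcont.stronglyMeasurableAtFilter isOpen_Ioi c hc) (hcont.continuousAt (Ioi_mem_nhds hc))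
    have h2 := (hasDerivAt_const c (∫ v in Ioi (c / 2), f v)).sub h
    rw [zero_sub] at h2
    refine h2.congr_of_eventuallyEq ?_
    filter_upwards [Ioi_mem_nhds (half_lt_self hc)] with d hd
    have hd : c / 2 < d := hd
    rw [Pi.sub_apply, intervalIntegral.integral_of_le hd.le, eq_sub_iff_add_eq, add_comm,
      ← setIntegral_union (Ioc_disjoint_Ioi_same) measurableSet_Ioi, Ioc_union_Ioi_eq_Ioi hd.le]
    · exact (integrableOn_logMean_div (half_pos hc)).mono_set Ioc_subset_Ioi_self
    · exact (integrableOn_logMean_div (half_pos hc)).mono_set (Ioi_subset_Ioi hd.le)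
  have hq : HasDerivAt (fun x : ℝ => x / (1 - x)) (1 / (1 - x) ^ 2) x := by
    refine ((hasDerivAt_id x).div ((hasDerivAt_id x).const_sub 1) hx1.ne').congr_deriv ?_
    simp
  have := (((Real.hasDerivAt_log h0.ne').const_mul logMean).add_const logSqMean).add
    (HasDerivAt.comp x hG hq)
  refine this.congr_deriv ?_
  have e1 : 1 + x / (1 - x) = (1 - x)⁻¹ := by field_simp; ring
  rw [hf]; beta_reduce
  rw [e1, Real.log_inv]
  field_simp
  ring

end

end HyperbolicGAF

/-! ### Pairs of correlated complex normal variables. -/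

namespace HyperbolicGAF

open Set Filter Topology

noncomputable section

lemma exists_re_mul_eq (T : ℂ →L[ℝ] ℝ) : ∃ u : ℂ, ∀ z, T z = (u * z).re := by
  refine ⟨T 1 - Complex.I * T Complex.I, fun z => ?_⟩
  conv_lhs => rw [← Complex.re_add_im z]
  rw [map_add, mul_comm (z.im : ℂ), ← mul_one (z.re : ℂ), mul_comm (z.re : ℂ)]
  rw [show (1 : ℂ) * (z.re : ℂ) = z.re • (1 : ℂ) by simp,
    show Complex.I * (z.im : ℂ) = z.im • Complex.I by rw [Complex.real_smul, mul_comm], map_smul, map_smul]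
  simp; ring

/-- A probability measure on `ℂ × ℂ` is determined by its characteristic function. -/
lemma ext_of_integral_cexp_prod {ν₁ ν₂ : Measure (ℂ × ℂ)} [IsProbabilityMeasure ν₁]
    [IsProbabilityMeasure ν₂]
    (h : ∀ u v : ℂ, ∫ p, Complex.exp (((u * p.1 + v * p.2).re : ℝ) * Complex.I) ∂ν₁
      = ∫ p, Complex.exp (((u * p.1 + v * p.2).re : ℝ) * Complex.I) ∂ν₂) : ν₁ = ν₂ := by
  refine Measure.ext_of_charFunDual (funext fun T => ?_)
  obtain ⟨u, hu⟩ := exists_re_mul_eq (T.comp (.inl ℝ ℂ ℂ))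
  obtain ⟨v, hv⟩ := exists_re_mul_eq (T.comp (.inr ℝ ℂ ℂ))
  have hT : ∀ p : ℂ × ℂ, T p = (u * p.1 + v * p.2).re := by
    intro p
    rw [Complex.add_re, ← hu, ← hv]
    simp [← map_add]
  rw [charFunDual_apply, charFunDual_apply]
  simp_rw [hT]
  exact h u v

/-- The standard complex normal distribution is determined by its characteristic function. -/
lemma eq_stdComplexNormal {ν : Measure ℂ} [IsProbabilityMeasure ν]
    (h : ∀ u : ℂ, ∫ z, Complex.exp (((u * z).re : ℝ) * Complex.I) ∂ν
      = Complex.exp (-‖u‖ ^ 2 / 4)) : ν = stdComplexNormal := by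
  refine Measure.ext_of_charFunDual (funext fun T => ?_)
  obtain ⟨u, hu⟩ := exists_re_mul_eq T
  rw [charFunDual_apply, charFunDual_apply]
  simp_rw [hu]
  rw [h u, integral_cexp_stdComplexNormal]

lemma integral_cexp_prod_stdComplexNormal (u v : ℂ) :
    ∫ p, Complex.exp (((u * p.1 + v * p.2).re : ℝ) * Complex.I)
        ∂(stdComplexNormal.prod stdComplexNormal)
      = Complex.exp (-(‖u‖ ^ 2 + ‖v‖ ^ 2) / 4) := by
  have : ∀ p : ℂ × ℂ, Complex.exp (((u * p.1 + v * p.2).re : ℝ) * Complex.I)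
      = Complex.exp (((u * p.1).re : ℝ) * Complex.I) *
        Complex.exp (((v * p.2).re : ℝ) * Complex.I) := by
    intro p; rw [← Complex.exp_add, Complex.add_re]; push_cast; ring_nf
  simp_rw [this]
  rw [integral_prod_mul (fun z : ℂ => Complex.exp (((u * z).re : ℝ) * Complex.I))
    (fun z : ℂ => Complex.exp (((v * z).re : ℝ) * Complex.I)), integral_cexp_stdComplexNormal,
    integral_cexp_stdComplexNormal, ← Complex.exp_add]
  ring_nf

/-- Unitary invariance of the Gaussian law. It carries the integrability and moments of `log |z|`
over to the correlated variable `ρ z + σ w`. -/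
lemma map_add_stdComplexNormal {ρ σ : ℂ} (h : ‖ρ‖ ^ 2 + ‖σ‖ ^ 2 = 1) :
    (stdComplexNormal.prod stdComplexNormal).map (fun p => ρ * p.1 + σ * p.2)
      = stdComplexNormal := by
  have hm : Measurable fun p : ℂ × ℂ => ρ * p.1 + σ * p.2 := by fun_prop
  have := Measure.isProbabilityMeasure_map
    (μ := stdComplexNormal.prod stdComplexNormal) hm.aemeasurable
  refine eq_stdComplexNormal fun u => ?_
  rw [integral_map hm.aemeasurable (Continuous.aestronglyMeasurable (by fun_prop))]
  have h1 := integral_cexp_prod_stdComplexNormal (u * ρ) (u * σ)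
  simp only [mul_assoc, ← mul_add] at h1
  rw [h1]
  congr 2
  norm_cast
  rw [norm_mul, norm_mul, mul_pow, mul_pow, ← mul_add, h, mul_one]

/-- Both sides are `log (max A R)`. The right-hand form isolates `log A` and depends on `R` only
through `R²`, which will be a multiple of an exponential variable. -/
lemma log_add_posLog {A R : ℝ} (hA : 0 < A) (hR : 0 < R) :
    Real.log R + Real.posLog (R⁻¹ * A) = Real.log A + Real.posLog ((A ^ 2)⁻¹ * R ^ 2) / 2 := by
  simp only [Real.posLog]
  rw [Real.log_mul (by positivity) (by positivity), Real.log_mul (by positivity) (by positivity),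
    Real.log_inv, Real.log_inv, Real.log_pow, Real.log_pow]
  push_cast
  rcases le_total (Real.log A) (Real.log R) with h | h
  · rw [max_eq_left (by linarith), max_eq_right (by linarith)]; ring
  · rw [max_eq_right (by linarith), max_eq_left (by linarith)]; ring

/-- By Jensen's formula for an affine function, the mean over the circle is the logarithm of the
larger of `‖a‖` and `σ √x`. -/
lemma circleAverage_log_norm_add {a : ℂ} (ha : a ≠ 0) {σ x : ℝ} (hσ : 0 < σ) (hx : 0 < x) :
    Real.circleAverage (fun w => Real.log ‖a + σ * w‖) 0 (Real.sqrt x)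
      = Real.log ‖a‖ + Real.posLog ((‖a‖ ^ 2 / σ ^ 2)⁻¹ * x) / 2 := by
  have hR : 0 < σ * Real.sqrt x := by positivity
  have h1 : Real.circleAverage (fun w => Real.log ‖a + σ * w‖) 0 (Real.sqrt x)
      = Real.circleAverage (Real.log ‖· - (-a)‖) 0 (σ * Real.sqrt x) := by
    simp only [Real.circleAverage_def]
    congr 1
    refine intervalIntegral.integral_congr fun θ _ => ?_
    simp only [circleMap]
    push_cast
    congr 2
    ring
  rw [h1, circleAverage_log_norm_sub_const_eq_log_radius_add_posLog hR.ne', zero_sub, neg_neg,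
    log_add_posLog (norm_pos_iff.2 ha) hR, mul_pow, Real.sq_sqrt hx.le]
  congr 3
  field_simp

lemma integral_log_norm_add {a : ℂ} (ha : a ≠ 0) {σ : ℝ} (hσ : 0 < σ)
    (hi : Integrable (fun w => Real.log ‖a + σ * w‖) stdComplexNormal) :
    ∫ w, Real.log ‖a + σ * w‖ ∂stdComplexNormal
      = Real.log ‖a‖ + (∫ u in Ioi (‖a‖ ^ 2 / σ ^ 2), Real.exp (-u) / u) / 2 := by
  have hna := norm_pos_iff.2 ha
  rw [integral_stdComplexNormal (by fun_prop) hi]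
  have hc : 0 < ‖a‖ ^ 2 / σ ^ 2 := by positivity
  have h1 : ∀ᵐ x ∂expLaw, Real.circleAverage (fun w => Real.log ‖a + σ * w‖) 0 (Real.sqrt x)
      = Real.log ‖a‖ + Real.posLog ((‖a‖ ^ 2 / σ ^ 2)⁻¹ * x) / 2 := by
    filter_upwards [ae_expLaw_pos] with x hx
    exact circleAverage_log_norm_add ha hσ hx
  rw [integral_congr_ae h1, integral_add (integrable_const _), integral_const, integral_div,
    integral_posLog_expLaw hc]
  · simp
  · refine Integrable.div_const ?_ _
    have h2 : Integrable (fun x => |Real.log (‖a‖ ^ 2 / σ ^ 2)⁻¹| + |Real.log x|) expLaw :=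
      (integrable_const _).add integrable_log_expLaw.abs
    refine h2.mono' (Measurable.aestronglyMeasurable (by unfold Real.posLog; fun_prop)) ?_
    filter_upwards [ae_expLaw_pos] with x hx
    rw [Real.norm_of_nonneg Real.posLog_nonneg]
    simp only [Real.posLog]
    rw [Real.log_mul (by positivity) hx.ne']
    refine max_le (by positivity) ?_
    exact add_le_add (le_abs_self _) (le_abs_self _)

lemma memLp_log_norm_fst :
    MemLp (fun p : ℂ × ℂ => Real.log ‖p.1‖) 2 (stdComplexNormal.prod stdComplexNormal) :=
  memLp_log_norm.comp_fst _

lemma memLp_log_norm_add {ρ σ : ℂ} (h : ‖ρ‖ ^ 2 + ‖σ‖ ^ 2 = 1) :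
    MemLp (fun p : ℂ × ℂ => Real.log ‖ρ * p.1 + σ * p.2‖) 2
      (stdComplexNormal.prod stdComplexNormal) := by
  have := memLp_log_norm
  rw [← map_add_stdComplexNormal h] at this
  exact (memLp_map_measure_iff (Measurable.aestronglyMeasurable (by fun_prop))
    (by fun_prop)).1 this

/-- The mixed logarithmic moment of two standard complex normal variables of correlation `ρ`. -/
theorem integral_log_norm_mul_log_norm_add {ρ : ℂ} {σ : ℝ} (hρ : ρ ≠ 0) (hσ : 0 < σ)
    (h : ‖ρ‖ ^ 2 + σ ^ 2 = 1) :
    ∫ p, Real.log ‖p.1‖ * Real.log ‖ρ * p.1 + σ * p.2‖ ∂(stdComplexNormal.prod stdComplexNormal)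
      = logCorr (‖ρ‖ ^ 2) / 4 := by
  have h' : ‖ρ‖ ^ 2 + ‖(σ : ℂ)‖ ^ 2 = 1 := by simpa using h
  have hnρ := norm_pos_iff.2 hρ
  have hi1 := (memLp_log_norm_add h').integrable (by norm_num)
  have hi2 := memLp_log_norm_fst.integrable_mul (memLp_log_norm_add h')
  rw [integral_prod (fun p : ℂ × ℂ => Real.log ‖p.1‖ * Real.log ‖ρ * p.1 + σ * p.2‖) hi2]
  have hne : ∀ᵐ z ∂stdComplexNormal, z ≠ 0 := by
    have h0 : stdComplexNormal ≪ volume := withDensity_absolutelyContinuous _ _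
    exact h0.ae_le (Measure.ae_ne volume 0)
  set c := ‖ρ‖ ^ 2 / (1 - ‖ρ‖ ^ 2) with hc
  have hσ2 : 1 - ‖ρ‖ ^ 2 = σ ^ 2 := by linarith
  have hc0 : 0 < c := by rw [hc, hσ2]; positivity
  set H : ℝ → ℝ := fun R => ∫ v in Ioi c, Real.exp (-(v * R)) / v with hH
  -- Conditionally on `z`, everything depends on `R = ‖z‖²` alone. Each logarithm of a modulus is
  -- half that of its square, whence the factor `1 / 4`.
  have hinner : ∀ᵐ z ∂stdComplexNormal,
      ∫ w, Real.log ‖z‖ * Real.log ‖ρ * z + σ * w‖ ∂stdComplexNormal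
        = (fun R => (Real.log (‖ρ‖ ^ 2) * Real.log R + Real.log R ^ 2 + Real.log R * H R) / 4)
            (‖z‖ ^ 2) := by
    filter_upwards [hne, hi1.prod_right_ae] with z hz hiz
    have hnz := norm_pos_iff.2 hz
    rw [integral_const_mul, integral_log_norm_add (mul_ne_zero hρ hz) hσ hiz]
    have e : ‖ρ * z‖ ^ 2 / σ ^ 2 = c * ‖z‖ ^ 2 := by
      rw [hc, hσ2, norm_mul]; ring
    rw [e, integral_exp_neg_div_Ioi_mul (by positivity), norm_mul,
      Real.log_mul hnρ.ne' hnz.ne', Real.log_pow, Real.log_pow]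
    push_cast
    rw [hH]
    ring
  have hHm : Measurable H := by
    have : StronglyMeasurable fun R : ℝ => ∫ v in Ioi c, Real.exp (-(v * R)) / v := by
      apply StronglyMeasurable.integral_prod_right'
        (f := fun p : ℝ × ℝ => Real.exp (-(p.2 * p.1)) / p.2)
      exact Measurable.stronglyMeasurable (by fun_prop)
    exact this.measurable
  rw [integral_congr_ae hinner, integral_comp_sq_norm (h := fun R =>
    (Real.log (‖ρ‖ ^ 2) * Real.log R + Real.log R ^ 2 + Real.log R * H R) / 4) (by fun_prop)]
  obtain ⟨hi3, he⟩ := integral_log_mul_posLog hc0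
  have hsq : Integrable (fun x => Real.log x ^ 2) expLaw := memLp_log_expLaw.integrable_sq
  have hlog : Integrable (fun x => Real.log (‖ρ‖ ^ 2) * Real.log x) expLaw :=
    integrable_log_expLaw.const_mul _
  have hls : Integrable (fun x => Real.log (‖ρ‖ ^ 2) * Real.log x + Real.log x ^ 2) expLaw :=
    hlog.add hsq
  rw [integral_div, integral_add hls hi3, integral_add hlog hsq, he,
    integral_const_mul, logCorr, ← hc, mul_comm logMean]
  rfl

/-! ### Characteristic functions of Gaussian series. -/

section Series

variable {Ω : Type*} [MeasurableSpace Ω] {μ : Measure Ω}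
  {a : ℕ → Ω → ℂ}

lemma integral_cexp_sum (ha_indep : iIndepFun a μ) (ha_law : ∀ n, HasLaw (a n) stdComplexNormal μ)
    (u : ℕ → ℂ) (N : ℕ) :
    ∫ ω, Complex.exp (((∑ n ∈ Finset.range N, u n * a n ω).re : ℝ) * Complex.I) ∂μ
      = Complex.exp (-(∑ n ∈ Finset.range N, ‖u n‖ ^ 2 : ℝ) / 4) := by
  have hg : ∀ n, Measurable fun z : ℂ => Complex.exp (((u n * z).re : ℝ) * Complex.I) :=
    fun n => by fun_prop
  have hind : iIndepFun (fun (n : Fin N) ω =>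
      Complex.exp (((u n * a n ω).re : ℝ) * Complex.I)) μ :=
    (ha_indep.precomp (g := fun n : Fin N => (n : ℕ)) Fin.val_injective).comp
      (fun n z => Complex.exp (((u n * z).re : ℝ) * Complex.I)) (fun n => hg n)
  have h := hind.integral_fun_prod_eq_prod_integral (fun n =>
    ((hg n).comp_aemeasurable (ha_law n).aemeasurable).aestronglyMeasurable)
  have h1 : ∀ n, ∫ ω, Complex.exp (((u n * a n ω).re : ℝ) * Complex.I) ∂μ
      = Complex.exp (-‖u n‖ ^ 2 / 4) := by
    intro n
    rw [← integral_cexp_stdComplexNormal, ← (ha_law n).map_eq,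
      integral_map (ha_law n).aemeasurable (hg n).aestronglyMeasurable]
  simp_rw [h1] at h
  rw [← Complex.exp_sum, Fin.sum_univ_eq_sum_range (fun n => -(‖u n‖ : ℂ) ^ 2 / 4)] at h
  rw [← Finset.sum_div, Finset.sum_neg_distrib] at h
  push_cast
  rw [← h]
  refine integral_congr_ae (ae_of_all _ fun ω => ?_)
  simp only
  rw [← Complex.exp_sum, Fin.sum_univ_eq_sum_range
    (fun n => (((u n * a n ω).re : ℝ) : ℂ) * Complex.I), ← Finset.sum_mul, Complex.re_sum]
  push_cast
  rfl

/-- The characteristic function of an almost surely convergent Gaussian series. -/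
theorem integral_cexp_hasSum [IsProbabilityMeasure μ] (ha_indep : iIndepFun a μ)
    (ha_law : ∀ n, HasLaw (a n) stdComplexNormal μ)
    {u : ℕ → ℂ} {S : Ω → ℂ} {V : ℝ} (hS : ∀ᵐ ω ∂μ, HasSum (fun n => u n * a n ω) (S ω))
    (hV : HasSum (fun n => ‖u n‖ ^ 2) V) :
    ∫ ω, Complex.exp (((S ω).re : ℝ) * Complex.I) ∂μ = Complex.exp (-V / 4) := by
  have h1 : Tendsto (fun N => ∫ ω, Complex.exp
      (((∑ n ∈ Finset.range N, u n * a n ω).re : ℝ) * Complex.I) ∂μ) atTop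
      (𝓝 (∫ ω, Complex.exp (((S ω).re : ℝ) * Complex.I) ∂μ)) := by
    refine tendsto_integral_of_dominated_convergence (fun _ => 1) (fun N => ?_)
      (integrable_const _) (fun N => ae_of_all _ fun ω => ?_) ?_
    · have : AEMeasurable (fun ω => ∑ n ∈ Finset.range N, u n * a n ω) μ := by
        refine Finset.aemeasurable_fun_sum _ fun n _ => ?_
        exact (ha_law n).aemeasurable.const_mul _
      exact ((Continuous.measurable (f := fun z : ℂ => Complex.exp ((z.re : ℝ) * Complex.I))
        (by fun_prop)).comp_aemeasurable this).aestronglyMeasurable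
    · rw [Complex.norm_exp_ofReal_mul_I]
    · filter_upwards [hS] with ω hω
      have := hω.tendsto_sum_nat
      exact ((Continuous.tendsto (f := fun z : ℂ => Complex.exp ((z.re : ℝ) * Complex.I))
        (by fun_prop) (S ω)).comp this)
  have h2 : Tendsto (fun N => ∫ ω, Complex.exp
      (((∑ n ∈ Finset.range N, u n * a n ω).re : ℝ) * Complex.I) ∂μ) atTop
      (𝓝 (Complex.exp (-V / 4))) := by
    simp_rw [integral_cexp_sum ha_indep ha_law u]
    have hc : Continuous fun x : ℝ => Complex.exp (-(x : ℂ) / 4) := by fun_prop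
    exact (hc.tendsto V).comp hV.tendsto_sum_nat
  exact tendsto_nhds_unique h1 h2

end Series

end

end HyperbolicGAF

/-! ### The random power series: convergence and joint law of two values. -/

namespace HyperbolicGAF

open Set Filter Topology ComplexConjugate

noncomputable section

lemma binomCoeff_nonneg {L : ℝ} (hL : 0 < L) (n : ℕ) : 0 ≤ binomCoeff L n := by
  unfold binomCoeff
  have h1 := Real.Gamma_pos_of_pos (show 0 < L + n by positivity)
  have h2 := Real.Gamma_pos_of_pos (show (0 : ℝ) < n + 1 by positivity)
  have h3 := Real.Gamma_pos_of_pos hL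
  positivity

lemma binomCoeff_zero {L : ℝ} (hL : 0 < L) : binomCoeff L 0 = 1 := by
  simp [binomCoeff, (Real.Gamma_pos_of_pos hL).ne']

/-- Identifies the Gamma quotient with the coefficient in the Taylor series of `(1 - x)^(-L)`;
positivity of `L` avoids the poles of Gamma. -/
lemma ofReal_binomCoeff {L : ℝ} (hL : 0 < L) (n : ℕ) :
    (binomCoeff L n : ℂ) = Ring.choose ((L : ℂ) + n - 1) n := by
  rw [← Ring.multichoose_eq]
  have h := Ring.factorial_nsmul_multichoose_eq_ascPochhammer (L : ℂ) n
  rw [Polynomial.ascPochhammer_smeval_cast, Polynomial.ascPochhammer_smeval_eq_eval,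
    ← Complex.Gamma_add_nat_div_Gamma_eq, nsmul_eq_mul] at h
  · have hf : (n.factorial : ℂ) ≠ 0 := by exact_mod_cast n.factorial_ne_zero
    rw [← mul_right_inj' hf, h, binomCoeff, Real.Gamma_nat_eq_factorial]
    have hg := Complex.Gamma_ofReal L
    have hg2 := Complex.Gamma_ofReal (L + n)
    push_cast at hg2 ⊢
    rw [hg, hg2]
    field_simp
  · intro m hm
    have : L = -m := by exact_mod_cast hm
    have h0 : (0 : ℝ) ≤ m := Nat.cast_nonneg m
    linarith

/-- The binomial series. -/
lemma hasSum_binomCoeff {L : ℝ} (hL : 0 < L) {x : ℂ} (hx : ‖x‖ < 1) :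
    HasSum (fun n => (binomCoeff L n : ℂ) * x ^ n) (1 / (1 - x) ^ (L : ℂ)) := by
  have hmem : x ∈ Metric.eball (0 : ℂ) 1 := by
    rw [Metric.mem_eball, edist_zero_right]
    rw [← ofReal_norm]
    exact_mod_cast (ENNReal.ofReal_lt_one.2 hx)
  have h := (Complex.one_div_one_sub_cpow_hasFPowerSeriesOnBall_zero (L : ℂ)).hasSum hmem
  rw [zero_add] at h
  simp_rw [ofReal_binomCoeff hL]
  convert! h using 2 with n
  rw [FormalMultilinearSeries.ofScalars_apply_eq, smul_eq_mul]

lemma hasSum_binomCoeff_real {L : ℝ} (hL : 0 < L) {x : ℝ} (h0 : 0 ≤ x) (h1 : x < 1) :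
    HasSum (fun n => binomCoeff L n * x ^ n) ((1 - x) ^ (-L)) := by
  have h := hasSum_binomCoeff hL (x := (x : ℂ)) (by rwa [Complex.norm_real, Real.norm_of_nonneg h0])
  rw [← Complex.hasSum_ofReal]
  convert h using 1
  · funext n; push_cast; rfl
  · rw [Complex.ofReal_cpow (by linarith), one_div, ← Complex.cpow_neg]
    push_cast; rfl

section Deterministic

variable {L : ℝ} {c : ℕ → ℂ} {C : ℝ}

/-- With `y = √ρ`, one factor `y ^ n` absorbs the square root of the binomial coefficient, because
`binomCoeff L n * ρ ^ n` is bounded. The other factor `y ^ n` makes the linear growth of the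
coefficients summable. -/
lemma exists_gafTerm_bound (hL : 0 < L) (hc : ∀ n, ‖c n‖ ≤ C * (n + 1)) {ρ : ℝ} (h0 : 0 < ρ)
    (h1 : ρ < 1) : ∃ u : ℕ → ℝ, Summable u ∧ ∀ n z, ‖z‖ ≤ ρ → ‖gafTerm L c z n‖ ≤ u n := by
  set y := Real.sqrt ρ with hy
  have hy0 : 0 < y := Real.sqrt_pos.2 h0
  have hy1 : y < 1 := by rw [hy, Real.sqrt_lt' one_pos]; simpa using h1
  have hC : 0 ≤ C := by simpa using (norm_nonneg _).trans (hc 0)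
  obtain ⟨B, hB⟩ := (hasSum_binomCoeff_real hL h0.le h1).summable.tendsto_atTop_zero.bddAbove_range
  have hB' : ∀ n, Real.sqrt (binomCoeff L n) * y ^ n ≤ Real.sqrt B := by
    intro n
    have h2 : y ^ n = Real.sqrt (ρ ^ n) := by
      rw [hy, Real.sqrt_eq_rpow, Real.sqrt_eq_rpow, ← Real.rpow_natCast, ← Real.rpow_natCast,
        ← Real.rpow_mul h0.le, ← Real.rpow_mul h0.le, mul_comm]
    rw [h2, ← Real.sqrt_mul (binomCoeff_nonneg hL n)]
    exact Real.sqrt_le_sqrt (hB ⟨n, rfl⟩)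
  refine ⟨fun n => C * Real.sqrt B * ((n : ℝ) ^ 1 * y ^ n + y ^ n), ?_, fun n z hz => ?_⟩
  · refine Summable.mul_left _ (Summable.add ?_ ?_)
    · exact summable_pow_mul_geometric_of_norm_lt_one 1 (by rwa [Real.norm_of_nonneg hy0.le])
    · exact summable_geometric_of_lt_one hy0.le hy1
  · rw [gafTerm, norm_mul, norm_mul, Complex.norm_real, Real.norm_of_nonneg (Real.sqrt_nonneg _),
      norm_pow]
    have hzn : ‖z‖ ^ n ≤ y ^ n * y ^ n := by
      rw [← mul_pow, hy, Real.mul_self_sqrt h0.le]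
      gcongr
    calc ‖c n‖ * Real.sqrt (binomCoeff L n) * ‖z‖ ^ n
        ≤ (C * (n + 1)) * Real.sqrt (binomCoeff L n) * (y ^ n * y ^ n) := by
          gcongr; exact hc n
      _ = C * (n + 1) * y ^ n * (Real.sqrt (binomCoeff L n) * y ^ n) := by ring
      _ ≤ C * (n + 1) * y ^ n * Real.sqrt B := by
          gcongr; exact hB' n
      _ = _ := by ring

lemma hasSum_gaf (hL : 0 < L) (hc : ∀ n, ‖c n‖ ≤ C * (n + 1)) {z : ℂ} (hz : ‖z‖ < 1) :
    HasSum (gafTerm L c z) (gaf L c z) := by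
  obtain ⟨ρ, h1, h2⟩ := exists_between hz
  obtain ⟨u, hu, hb⟩ := exists_gafTerm_bound hL hc ((norm_nonneg z).trans_lt h1) h2
  exact (Summable.of_norm_bounded hu fun n => hb n z h1.le).hasSum

lemma analyticOnNhd_gaf (hL : 0 < L) (hc : ∀ n, ‖c n‖ ≤ C * (n + 1)) :
    AnalyticOnNhd ℂ (gaf L c) (Metric.ball 0 1) := by
  intro z hz
  rw [mem_ball_zero_iff] at hz
  obtain ⟨ρ, h1, h2⟩ := exists_between hz
  obtain ⟨u, hu, hb⟩ := exists_gafTerm_bound hL hc ((norm_nonneg z).trans_lt h1) h2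
  have : DifferentiableOn ℂ (gaf L c) (Metric.ball 0 ρ) := by
    refine Complex.differentiableOn_tsum_of_summable_norm hu (fun n => ?_) Metric.isOpen_ball
      (fun n w hw => hb n w (mem_ball_zero_iff.1 hw).le)
    unfold gafTerm
    fun_prop
  exact this.analyticAt (Metric.isOpen_ball.mem_nhds (mem_ball_zero_iff.2 h1))

lemma gaf_zero (hL : 0 < L) : gaf L c 0 = c 0 := by
  rw [gaf, tsum_eq_single 0]
  · simp [gafTerm, binomCoeff_zero hL]
  · intro n hn; simp [gafTerm, hn]

end Deterministic

/-- Random coefficients which are measurable, grow at most linearly and whose first term does not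
vanish. -/
structure IsTame {Ω : Type*} [MeasurableSpace Ω] (a : ℕ → Ω → ℂ) : Prop where
  measurable : ∀ n, Measurable (a n)
  bound : ∀ ω, ∃ C : ℝ, ∀ n, ‖a n ω‖ ≤ C * (n + 1)
  ne_zero : ∀ ω, a 0 ω ≠ 0

/-- Half the logarithm of the variance of `f_L(z)` for `‖z‖ = p`. -/
def logSd (L p : ℝ) : ℝ := -(L / 2) * Real.log (1 - p ^ 2)

/-- The squared modulus of the correlation of `f_L(z)` and `f_L(w)`. -/
def corrSq (L : ℝ) (z w : ℂ) : ℝ :=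
  ((1 - ‖z‖ ^ 2) * (1 - ‖w‖ ^ 2) / ‖1 - z * conj w‖ ^ 2) ^ L

section Random

variable {Ω : Type*} [MeasurableSpace Ω] {μ : Measure Ω} {a : ℕ → Ω → ℂ} {L : ℝ}

lemma IsTame.hasSum_gaf (ha : IsTame a) (hL : 0 < L) (ω : Ω) {z : ℂ} (hz : ‖z‖ < 1) :
    HasSum (gafTerm L (fun n => a n ω) z) (gaf L (fun n => a n ω) z) := by
  obtain ⟨C, hC⟩ := ha.bound ω
  exact HyperbolicGAF.hasSum_gaf hL hC hz

/-- Letting the evaluation point depend on the parameter gives joint measurability in `ω` and the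
angles on the circles, as Fubini requires. -/
lemma IsTame.measurable_gaf (ha : IsTame a) (hL : 0 < L) {X : Type*} [MeasurableSpace X]
    {φ : X → Ω} {g : X → ℂ} (hφ : Measurable φ) (hg : Measurable g) (hg1 : ∀ x, ‖g x‖ < 1) :
    Measurable fun x => gaf L (fun n => a n (φ x)) (g x) := by
  refine measurable_of_tendsto_metrizable
    (f := fun N x => ∑ n ∈ Finset.range N, gafTerm L (fun n => a n (φ x)) (g x) n) (fun N => ?_) ?_
  · refine Finset.measurable_fun_sum _ fun n _ => ?_
    unfold gafTerm
    exact (((ha.measurable n).comp hφ).mul_const _).mul (hg.pow_const n)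
  · rw [tendsto_pi_nhds]
    intro x
    exact (ha.hasSum_gaf hL (φ x) (hg1 x)).tendsto_sum_nat

lemma IsTame.measurable_gaf_left (ha : IsTame a) (hL : 0 < L) {z : ℂ} (hz : ‖z‖ < 1) :
    Measurable fun ω => gaf L (fun n => a n ω) z :=
  ha.measurable_gaf hL measurable_id measurable_const fun _ => hz

variable [IsProbabilityMeasure μ]

/-- The joint law of `f_L(z)` and `f_L(w)`. -/
lemma IsTame.map_gaf_prod (ha : IsTame a) (hL : 0 < L) (ha_indep : iIndepFun a μ)
    (ha_law : ∀ n, HasLaw (a n) stdComplexNormal μ) {z w : ℂ} (hz : ‖z‖ < 1) (hw : ‖w‖ < 1)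
    {α σ : ℝ} {β : ℂ} (h1 : α ^ 2 = (1 - ‖z‖ ^ 2) ^ (-L))
    (h2 : ‖β‖ ^ 2 + σ ^ 2 = (1 - ‖w‖ ^ 2) ^ (-L))
    (h3 : α * conj β = 1 / (1 - z * conj w) ^ (L : ℂ)) :
    μ.map (fun ω => (gaf L (fun n => a n ω) z, gaf L (fun n => a n ω) w))
      = (stdComplexNormal.prod stdComplexNormal).map
          (fun p => ((α : ℂ) * p.1, β * p.1 + (σ : ℂ) * p.2)) := by
  have hm1 : Measurable fun ω => (gaf L (fun n => a n ω) z, gaf L (fun n => a n ω) w) :=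
    (ha.measurable_gaf_left hL hz).prodMk (ha.measurable_gaf_left hL hw)
  have hm2 : Measurable fun p : ℂ × ℂ => ((α : ℂ) * p.1, β * p.1 + (σ : ℂ) * p.2) := by fun_prop
  have := Measure.isProbabilityMeasure_map (μ := μ) hm1.aemeasurable
  have := Measure.isProbabilityMeasure_map
    (μ := stdComplexNormal.prod stdComplexNormal) hm2.aemeasurable
  refine ext_of_integral_cexp_prod fun ξ η => ?_
  rw [integral_map hm1.aemeasurable (Continuous.aestronglyMeasurable (by fun_prop)),
    integral_map hm2.aemeasurable (Continuous.aestronglyMeasurable (by fun_prop))]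
  -- `ξ f(z) + η f(w)` is a Gaussian series with these coefficients. Its variance is a sum of three
  -- binomial series; `h1`, `h2`, `h3` say that the triangular combination of two independent
  -- normals has the same covariance matrix.
  set u : ℕ → ℂ := fun n => Real.sqrt (binomCoeff L n) * (ξ * z ^ n + η * w ^ n) with hu
  have hS : ∀ ω, HasSum (fun n => u n * a n ω)
      (ξ * gaf L (fun n => a n ω) z + η * gaf L (fun n => a n ω) w) := by
    intro ω
    have := ((ha.hasSum_gaf hL ω hz).mul_left ξ).add ((ha.hasSum_gaf hL ω hw).mul_left η)
    convert! this using 2 with n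
    simp only [hu, gafTerm]; ring
  have hzw : ‖z * conj w‖ < 1 := by
    rw [norm_mul, Complex.norm_conj]; exact mul_lt_one_of_nonneg_of_lt_one_left (norm_nonneg _) hz hw.le
  have hV : HasSum (fun n => ‖u n‖ ^ 2)
      (‖ξ‖ ^ 2 * α ^ 2 + ‖η‖ ^ 2 * (‖β‖ ^ 2 + σ ^ 2) + 2 * (ξ * conj η * (α * conj β)).re) := by
    have e1 := (hasSum_binomCoeff_real hL (sq_nonneg ‖z‖) (by
      rw [sq_lt_one_iff_abs_lt_one, abs_norm]; exact hz)).mul_left (‖ξ‖ ^ 2)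
    have e2 := (hasSum_binomCoeff_real hL (sq_nonneg ‖w‖) (by
      rw [sq_lt_one_iff_abs_lt_one, abs_norm]; exact hw)).mul_left (‖η‖ ^ 2)
    have e3 := (Complex.hasSum_re ((hasSum_binomCoeff hL hzw).mul_left (ξ * conj η))).mul_left 2
    rw [h1, h2, h3]
    convert! (e1.add e2).add e3 using 2 with n
    rw [hu]
    simp only
    rw [norm_mul, mul_pow, Complex.norm_real, Real.norm_of_nonneg (Real.sqrt_nonneg _),
      Real.sq_sqrt (binomCoeff_nonneg hL n), ← Complex.normSq_eq_norm_sq, Complex.normSq_add,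
      Complex.normSq_eq_norm_sq, Complex.normSq_eq_norm_sq, norm_mul, norm_mul, norm_pow, norm_pow]
    have : (ξ * conj η * ((binomCoeff L n : ℂ) * (z * conj w) ^ n)).re
        = binomCoeff L n * (ξ * z ^ n * conj (η * w ^ n)).re := by
      rw [← Complex.re_ofReal_mul, map_mul, map_pow, mul_pow]
      congr 1; ring
    rw [this]
    ring
  rw [integral_cexp_hasSum ha_indep ha_law (ae_of_all _ hS) hV]
  have := integral_cexp_prod_stdComplexNormal (ξ * α + η * β) (η * σ)
  have e : ∀ p : ℂ × ℂ, (ξ * α + η * β) * p.1 + η * σ * p.2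
      = ξ * (α * p.1) + η * (β * p.1 + σ * p.2) := fun p => by ring
  simp_rw [e] at this
  rw [this]
  congr 2
  norm_cast
  congr 1
  rw [← Complex.normSq_eq_norm_sq (ξ * α + η * β), Complex.normSq_add, Complex.normSq_eq_norm_sq,
    Complex.normSq_eq_norm_sq]
  simp only [norm_mul, Complex.norm_real, map_mul, mul_pow, Real.norm_eq_abs,
    sq_abs]
  have : ξ * conj η * (α * conj β) = ξ * α * (conj η * conj β) := by ring
  rw [this]
  ring

end Random

end

end HyperbolicGAF

/-! ### Moments of `log |f_L|` at one and two points. -/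

namespace HyperbolicGAF

open Set Filter Topology ComplexConjugate

noncomputable section

/-- This makes the strict Cauchy–Schwarz inequality explicit: the squared correlation is below `1`
by an amount governed by `‖z - w‖²`. -/
lemma norm_one_sub_mul_conj_sq (z w : ℂ) :
    ‖1 - z * conj w‖ ^ 2 = (1 - ‖z‖ ^ 2) * (1 - ‖w‖ ^ 2) + ‖z - w‖ ^ 2 := by
  simp only [← Complex.normSq_eq_norm_sq, Complex.normSq_apply, Complex.sub_re, Complex.sub_im,
    Complex.mul_re, Complex.mul_im, Complex.conj_re, Complex.conj_im, Complex.one_re, Complex.one_im]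
  ring

lemma one_sub_sq_norm_pos {z : ℂ} (hz : ‖z‖ < 1) : 0 < 1 - ‖z‖ ^ 2 := by
  have := (sq_lt_one_iff_abs_lt_one ‖z‖).2 (by rwa [abs_norm])
  linarith

lemma corrSq_pos {L : ℝ} {z w : ℂ} (hz : ‖z‖ < 1) (hw : ‖w‖ < 1) : 0 < corrSq L z w := by
  have h1 := one_sub_sq_norm_pos hz
  have h2 := one_sub_sq_norm_pos hw
  have h3 := norm_one_sub_mul_conj_sq z w
  unfold corrSq
  rw [h3]
  positivity

lemma corrSq_lt_one {L : ℝ} (hL : 0 < L) {z w : ℂ} (hz : ‖z‖ < 1) (hw : ‖w‖ < 1) (hzw : z ≠ w) :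
    corrSq L z w < 1 := by
  have h1 := one_sub_sq_norm_pos hz
  have h2 := one_sub_sq_norm_pos hw
  have h3 : 0 < ‖z - w‖ := norm_pos_iff.2 (sub_ne_zero.2 hzw)
  unfold corrSq
  rw [norm_one_sub_mul_conj_sq z w]
  refine Real.rpow_lt_one (by positivity) ?_ hL
  rw [div_lt_one (by positivity)]
  linarith [pow_pos h3 2]

lemma exp_logSd_sq {L p : ℝ} (hp : 0 < 1 - p ^ 2) :
    Real.exp (logSd L p) ^ 2 = (1 - p ^ 2) ^ (-L) := by
  rw [Real.rpow_def_of_pos hp, ← Real.exp_nat_mul, logSd]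
  push_cast; ring_nf

lemma ae_ne_zero_stdComplexNormal : ∀ᵐ z ∂stdComplexNormal, z ≠ 0 := by
  have h0 : stdComplexNormal ≪ volume := withDensity_absolutelyContinuous _ _
  exact h0.ae_le (Measure.ae_ne volume 0)

lemma log_norm_exp_mul (s : ℝ) {z : ℂ} (hz : z ≠ 0) :
    Real.log ‖(Real.exp s : ℂ) * z‖ = s + Real.log ‖z‖ := by
  rw [norm_mul, Complex.norm_real, Real.norm_of_nonneg (Real.exp_nonneg _),
    Real.log_mul (Real.exp_ne_zero _) (norm_ne_zero_iff.2 hz), Real.log_exp]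

section Random

variable {Ω : Type*} [MeasurableSpace Ω] {μ : Measure Ω} [IsProbabilityMeasure μ]
  {a : ℕ → Ω → ℂ} {L : ℝ}

/-- The law of `f_L(z)`. -/
lemma IsTame.map_gaf (ha : IsTame a) (hL : 0 < L) (ha_indep : iIndepFun a μ)
    (ha_law : ∀ n, HasLaw (a n) stdComplexNormal μ) {z : ℂ} (hz : ‖z‖ < 1) :
    μ.map (fun ω => gaf L (fun n => a n ω) z)
      = stdComplexNormal.map (fun x => (Real.exp (logSd L ‖z‖) : ℂ) * x) := by
  have hp := one_sub_sq_norm_pos hz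
  have h2 := exp_logSd_sq (L := L) hp
  -- The degenerate case `w = z`, `σ = 0` of the joint law; the first marginal is then taken.
  have h := ha.map_gaf_prod hL ha_indep ha_law hz hz (α := Real.exp (logSd L ‖z‖)) (σ := 0)
    (β := Real.exp (logSd L ‖z‖)) h2 (by simpa [abs_of_pos (Real.exp_pos _)] using h2) (by
      rw [Complex.conj_ofReal, ← Complex.ofReal_mul, ← sq, h2, Complex.mul_conj,
        Complex.normSq_eq_norm_sq, one_div, ← Complex.cpow_neg, Complex.ofReal_cpow hp.le]
      push_cast; rfl)
  have hm := (ha.measurable_gaf_left hL hz)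
  have h' := congrArg (Measure.map Prod.fst) h
  rw [Measure.map_map measurable_fst (hm.prodMk hm), Measure.map_map measurable_fst (by fun_prop)]
    at h'
  have h5 : stdComplexNormal.map (fun x => (Real.exp (logSd L ‖z‖) : ℂ) * x)
      = ((stdComplexNormal.prod stdComplexNormal).map Prod.fst).map
        (fun x => (Real.exp (logSd L ‖z‖) : ℂ) * x) := by
    rw [Measure.map_fst_prod]; simp
  rw [h5, Measure.map_map (by fun_prop) measurable_fst]
  exact h'

lemma log_norm_exp_mul_ae (s : ℝ) :
    (fun x : ℂ => Real.log ‖(Real.exp s : ℂ) * x‖) =ᵐ[stdComplexNormal]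
      fun x => s + Real.log ‖x‖ := by
  filter_upwards [ae_ne_zero_stdComplexNormal] with x hx
  exact log_norm_exp_mul s hx

lemma IsTame.memLp_log_gaf (ha : IsTame a) (hL : 0 < L) (ha_indep : iIndepFun a μ)
    (ha_law : ∀ n, HasLaw (a n) stdComplexNormal μ) {z : ℂ} (hz : ‖z‖ < 1) :
    MemLp (fun ω => Real.log ‖gaf L (fun n => a n ω) z‖) 2 μ := by
  have hm := (ha.measurable_gaf_left hL hz).aemeasurable (μ := μ)
  have hg : ∀ ν : Measure ℂ, AEStronglyMeasurable (fun x : ℂ => Real.log ‖x‖) ν :=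
    fun ν => Measurable.aestronglyMeasurable (by fun_prop)
  have h1 : MemLp (fun x : ℂ => Real.log ‖x‖) 2
      (μ.map (fun ω => gaf L (fun n => a n ω) z)) := by
    rw [ha.map_gaf hL ha_indep ha_law hz, memLp_map_measure_iff (hg _) (by fun_prop)]
    exact ((memLp_const (logSd L ‖z‖)).add memLp_log_norm).ae_eq (log_norm_exp_mul_ae _).symm
  exact (memLp_map_measure_iff (hg _) hm).1 h1

lemma IsTame.integral_log_gaf (ha : IsTame a) (hL : 0 < L) (ha_indep : iIndepFun a μ)
    (ha_law : ∀ n, HasLaw (a n) stdComplexNormal μ) {z : ℂ} (hz : ‖z‖ < 1) :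
    ∫ ω, Real.log ‖gaf L (fun n => a n ω) z‖ ∂μ = logSd L ‖z‖ + logMean / 2 := by
  have hm := (ha.measurable_gaf_left hL hz).aemeasurable (μ := μ)
  have hg : ∀ ν : Measure ℂ, AEStronglyMeasurable (fun x : ℂ => Real.log ‖x‖) ν :=
    fun ν => Measurable.aestronglyMeasurable (by fun_prop)
  rw [← integral_map hm (hg _), ha.map_gaf hL ha_indep ha_law hz,
    integral_map (by fun_prop) (hg _), integral_congr_ae (log_norm_exp_mul_ae _),
    integral_add (integrable_const _) (memLp_log_norm.integrable (by norm_num)), integral_log_norm]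
  simp

lemma IsTame.integral_log_gaf_sq (ha : IsTame a) (hL : 0 < L) (ha_indep : iIndepFun a μ)
    (ha_law : ∀ n, HasLaw (a n) stdComplexNormal μ) {z : ℂ} (hz : ‖z‖ < 1) :
    ∫ ω, Real.log ‖gaf L (fun n => a n ω) z‖ ^ 2 ∂μ
      = ∫ x, Real.log ‖(Real.exp (logSd L ‖z‖) : ℂ) * x‖ ^ 2 ∂stdComplexNormal := by
  have hm := (ha.measurable_gaf_left hL hz).aemeasurable (μ := μ)
  have hg : ∀ ν : Measure ℂ, AEStronglyMeasurable (fun x : ℂ => Real.log ‖x‖ ^ 2) ν :=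
    fun ν => Measurable.aestronglyMeasurable (by fun_prop)
  rw [← integral_map hm (hg _), ha.map_gaf hL ha_indep ha_law hz,
    integral_map (by fun_prop) (hg _)]

/-- The mixed second moment of `log |f_L(z)|` and `log |f_L(w)|`. -/
theorem IsTame.integral_log_gaf_mul (ha : IsTame a) (hL : 0 < L) (ha_indep : iIndepFun a μ)
    (ha_law : ∀ n, HasLaw (a n) stdComplexNormal μ) {z w : ℂ} (hz : ‖z‖ < 1) (hw : ‖w‖ < 1)
    (hzw : z ≠ w) :
    ∫ ω, Real.log ‖gaf L (fun n => a n ω) z‖ * Real.log ‖gaf L (fun n => a n ω) w‖ ∂μ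
      = logSd L ‖z‖ * logSd L ‖w‖ + (logSd L ‖z‖ + logSd L ‖w‖) * (logMean / 2)
        + logCorr (corrSq L z w) / 4 := by
  have hp := one_sub_sq_norm_pos hz
  have hq := one_sub_sq_norm_pos hw
  have hz2 := exp_logSd_sq (L := L) hp
  have hw2 := exp_logSd_sq (L := L) hq
  have hc0 := corrSq_pos (L := L) hz hw
  have hc1 := corrSq_lt_one hL hz hw hzw
  set A := logSd L ‖z‖
  set B := logSd L ‖w‖
  set κ : ℂ := 1 / (1 - z * conj w) ^ (L : ℂ) with hκ
  set s := Real.sqrt (1 - corrSq L z w) with hs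
  have hs0 : 0 < s := Real.sqrt_pos.2 (by linarith)
  have hs2 : s ^ 2 = 1 - corrSq L z w := Real.sq_sqrt (by linarith)
  -- `exp A` and `exp B` are the standard deviations at `z` and `w` and `κ` is the covariance. After
  -- normalization, the second value is `ρ` times the first plus an independent normal of standard
  -- deviation `s`.
  set ρ : ℂ := conj κ / (Real.exp A * Real.exp B) with hρ
  have hne : 0 < ‖1 - z * conj w‖ := by
    have := norm_one_sub_mul_conj_sq z w
    have h : 0 < ‖1 - z * conj w‖ ^ 2 := by rw [this]; positivity
    exact lt_of_le_of_ne (norm_nonneg _) fun h0 => by simp [← h0] at h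
  have hκn : ‖κ‖ ^ 2 = (‖1 - z * conj w‖ ^ 2) ^ (-L) := by
    rw [hκ, norm_div, norm_one, Complex.norm_cpow_real, one_div, ← Real.rpow_neg hne.le,
      ← Real.rpow_natCast, ← Real.rpow_natCast, ← Real.rpow_mul hne.le, ← Real.rpow_mul hne.le,
      mul_comm (-L)]
  have hρn : ‖ρ‖ ^ 2 = corrSq L z w := by
    rw [hρ, norm_div, norm_mul, Complex.norm_conj, Complex.norm_real, Complex.norm_real,
      Real.norm_of_nonneg (Real.exp_nonneg _), Real.norm_of_nonneg (Real.exp_nonneg _), div_pow,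
      mul_pow, hz2, hw2, hκn, corrSq, ← Real.mul_rpow hp.le hq.le, ← Real.div_rpow (by positivity)
      (by positivity), Real.rpow_neg (by positivity), ← Real.inv_rpow (by positivity), inv_div]
  have hρ0 : ρ ≠ 0 := by
    intro h; rw [h] at hρn; simp at hρn; linarith
  have hρs : ‖ρ‖ ^ 2 + s ^ 2 = 1 := by rw [hρn, hs2]; ring
  have hmap := ha.map_gaf_prod hL ha_indep ha_law hz hw (α := Real.exp A) (σ := Real.exp B * s)
    (β := Real.exp B * ρ) hz2 (by
      rw [norm_mul, Complex.norm_real, Real.norm_of_nonneg (Real.exp_nonneg _), mul_pow, mul_pow,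
        ← mul_add, hρs, mul_one, hw2]) (by
      have hA : (Real.exp A : ℂ) ≠ 0 := by exact_mod_cast Real.exp_ne_zero A
      have hB : (Real.exp B : ℂ) ≠ 0 := by exact_mod_cast Real.exp_ne_zero B
      rw [← hκ, hρ, map_mul, map_div₀, Complex.conj_conj, map_mul, Complex.conj_ofReal,
        Complex.conj_ofReal]
      field_simp)
  have hm1 : Measurable fun ω => (gaf L (fun n => a n ω) z, gaf L (fun n => a n ω) w) :=
    (ha.measurable_gaf_left hL hz).prodMk (ha.measurable_gaf_left hL hw)
  have hg : ∀ ν : Measure (ℂ × ℂ),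
      AEStronglyMeasurable (fun p : ℂ × ℂ => Real.log ‖p.1‖ * Real.log ‖p.2‖) ν :=
    fun ν => Measurable.aestronglyMeasurable (by fun_prop)
  have h1 := integral_map hm1.aemeasurable (hg (μ.map
    fun ω => (gaf L (fun n => a n ω) z, gaf L (fun n => a n ω) w)))
  rw [hmap, integral_map (Measurable.aemeasurable (by fun_prop)) (hg _)] at h1
  rw [← h1]
  have hρs' : ‖ρ‖ ^ 2 + ‖(s : ℂ)‖ ^ 2 = 1 := by simpa using hρs
  have hae : ∀ᵐ p ∂(stdComplexNormal.prod stdComplexNormal),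
      Real.log ‖(Real.exp A : ℂ) * p.1‖ *
        Real.log ‖(Real.exp B : ℂ) * ρ * p.1 + ((Real.exp B * s : ℝ) : ℂ) * p.2‖
      = A * B + A * Real.log ‖ρ * p.1 + s * p.2‖ + B * Real.log ‖p.1‖
        + Real.log ‖p.1‖ * Real.log ‖ρ * p.1 + s * p.2‖ := by
    have hm : Measurable fun p : ℂ × ℂ => ρ * p.1 + s * p.2 := by fun_prop
    have hx := Measure.quasiMeasurePreserving_fst (μ := stdComplexNormal)
      (ν := stdComplexNormal) |>.ae ae_ne_zero_stdComplexNormal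
    have hy : ∀ᵐ p ∂(stdComplexNormal.prod stdComplexNormal), ρ * p.1 + s * p.2 ≠ 0 := by
      have := ae_ne_zero_stdComplexNormal
      rw [← map_add_stdComplexNormal hρs'] at this
      exact ae_of_ae_map hm.aemeasurable this
    filter_upwards [hx, hy] with p hp1 hp2
    have : (Real.exp B : ℂ) * ρ * p.1 + ((Real.exp B * s : ℝ) : ℂ) * p.2
        = (Real.exp B : ℂ) * (ρ * p.1 + s * p.2) := by push_cast; ring
    rw [this, log_norm_exp_mul A hp1, log_norm_exp_mul B hp2]
    ring
  rw [integral_congr_ae hae]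
  have i1 := (memLp_log_norm_fst).integrable (by norm_num)
  have i2 := (memLp_log_norm_add hρs').integrable (by norm_num)
  have i3 : Integrable (fun p : ℂ × ℂ => Real.log ‖p.1‖ * Real.log ‖ρ * p.1 + s * p.2‖)
    (stdComplexNormal.prod stdComplexNormal) :=
    memLp_log_norm_fst.integrable_mul (memLp_log_norm_add hρs')
  have v1 : ∫ p : ℂ × ℂ, Real.log ‖p.1‖ ∂(stdComplexNormal.prod stdComplexNormal)
      = logMean / 2 := by
    rw [← integral_log_norm]
    have := integral_prod_mul (μ := stdComplexNormal) (ν := stdComplexNormal)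
      (fun z : ℂ => Real.log ‖z‖) (fun _ => (1 : ℝ))
    simpa using this
  have v2 : ∫ p : ℂ × ℂ, Real.log ‖ρ * p.1 + s * p.2‖ ∂(stdComplexNormal.prod stdComplexNormal)
      = logMean / 2 := by
    rw [← integral_log_norm]
    conv_rhs => rw [← map_add_stdComplexNormal hρs']
    rw [integral_map (Measurable.aemeasurable (by fun_prop))
      (Measurable.aestronglyMeasurable (by fun_prop))]
  have j1 := integrable_const (μ := stdComplexNormal.prod stdComplexNormal) (A * B)
  have j2 := j1.fun_add (i2.const_mul A)
  have j3 := j2.fun_add (i1.const_mul B)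
  rw [integral_add j3 i3, integral_add j2 (i1.const_mul B), integral_add j1 (i2.const_mul A),
    integral_const_mul A fun p : ℂ × ℂ => Real.log ‖ρ * p.1 + s * p.2‖,
    integral_const_mul B fun p : ℂ × ℂ => Real.log ‖p.1‖, v1, v2,
    integral_log_norm_mul_log_norm_add hρ0 hs0 hρs, hρn]
  simp
  ring

end Random

end

end HyperbolicGAF

/-! ### Jensen's formula: the zero count as a left derivative. -/

namespace HyperbolicGAF

open Set Filter Topology ComplexConjugate

noncomputable section

/-- The mean of `log |f|` over the circle of radius `exp s`. -/
def logMeanCircle (f : ℂ → ℂ) (s : ℝ) : ℝ :=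
  Real.circleAverage (fun z => Real.log ‖f z‖) 0 (Real.exp s)

/-- The number of zeros of `f` in the open disc of radius `exp s`. -/
def diskCount (f : ℂ → ℂ) (s : ℝ) : ℝ :=
  (zeroMeasure f (Metric.ball 0 (Real.exp s))).toReal

section Jensen

variable {f : ℂ → ℂ}

/-- The defining sum over all points of the disc has only finitely many nonzero terms on the smaller
disc; finite orders of vanishing allow it to be written with natural numbers. -/
lemma zeroMeasure_eq_sum {p : ℝ} (hp1 : p < 1) (hord : ∀ z ∈ Metric.ball (0 : ℂ) 1, analyticOrderAt f z ≠ ⊤)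
    {Z : Finset ℂ} (hZ : ∀ z, ‖z‖ < p → z ∉ Z → analyticOrderAt f z = 0) :
    zeroMeasure f (Metric.ball 0 p)
      = ((∑ u ∈ Z, if ‖u‖ < p then analyticOrderNatAt f u else 0 : ℕ) : ℝ≥0∞) := by
  rw [zeroMeasure, Measure.sum_apply _ measurableSet_ball]
  set g : ℂ → ℝ≥0∞ := fun z => if ‖z‖ < p then (analyticOrderNatAt f z : ℝ≥0∞) else 0 with hg
  have h1 : ∀ z : Metric.ball (0 : ℂ) 1,
      ((((analyticOrderAt f (z : ℂ) : ℕ∞) : ℝ≥0∞) • Measure.dirac (z : ℂ)) (Metric.ball 0 p))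
        = g z := by
    intro z
    rw [Measure.smul_apply, Measure.dirac_apply' _ measurableSet_ball, smul_eq_mul]
    have := Nat.cast_analyticOrderNatAt (hord z z.2)
    rw [← this]
    by_cases hz : ‖(z : ℂ)‖ < p
    · rw [indicator_of_mem (mem_ball_zero_iff.2 hz), hg]
      simp only [if_pos hz, Pi.one_apply, mul_one]
      exact ENat.toENNReal_coe _
    · rw [indicator_of_notMem (by rwa [mem_ball_zero_iff]), hg]
      simp only [if_neg hz, mul_zero]
  simp_rw [h1]
  rw [tsum_subtype (Metric.ball (0 : ℂ) 1) g, tsum_eq_sum (s := Z)]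
  · push_cast
    refine Finset.sum_congr rfl fun u _ => ?_
    by_cases hu : ‖u‖ < p
    · have : u ∈ Metric.ball (0 : ℂ) 1 := mem_ball_zero_iff.2 (hu.trans hp1)
      simp [indicator_of_mem this, g, hu]
    · simp [indicator, g, hu]
  · intro u hu
    by_cases h : ‖u‖ < p
    · simp [g, indicator, h, analyticOrderNatAt, hZ u h hu]
    · simp [indicator, g, h]

/-- Jensen's formula for the circles of radius at most `exp t < 1`. -/
lemma exists_jensen (hf : AnalyticOnNhd ℂ f (Metric.ball 0 1)) (h0 : f 0 ≠ 0) {t : ℝ} (ht : t < 0) :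
    ∃ (Z : Finset ℂ) (m : ℂ → ℕ), ∀ s ≤ t,
      logMeanCircle f s = Real.log ‖f 0‖ + ∑ u ∈ Z, m u * max 0 (s - Real.log ‖u‖) ∧
      zeroMeasure f (Metric.ball 0 (Real.exp s))
        = ((∑ u ∈ Z, if Real.log ‖u‖ < s then m u else 0 : ℕ) : ℝ≥0∞) := by
  have hord : ∀ z ∈ Metric.ball (0 : ℂ) 1, analyticOrderAt f z ≠ ⊤ := by
    intro z hz
    refine hf.analyticOrderAt_ne_top_of_isPreconnected (convex_ball _ _).isPreconnected
      (Metric.mem_ball_self one_pos) hz ?_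
    rw [(hf 0 (Metric.mem_ball_self one_pos)).analyticOrderAt_eq_zero.2 h0]
    simp
  have hball : ∀ {s}, s ≤ t → Metric.closedBall (0 : ℂ) |Real.exp s| ⊆ Metric.ball 0 1 := by
    intro s hs z hz
    rw [abs_of_pos (Real.exp_pos s), mem_closedBall_zero_iff] at hz
    rw [mem_ball_zero_iff]
    exact hz.trans_lt (Real.exp_lt_one_iff.2 (by linarith))
  -- The support of the divisor on the largest disc serves for every `s ≤ t`: a zero outside a
  -- smaller disc contributes `0` to both formulas.
  set D := MeromorphicOn.divisor f (Metric.closedBall (0 : ℂ) |Real.exp t|) with hD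
  have hfin := D.finiteSupport (isCompact_closedBall _ _)
  have hdiv : ∀ {s}, s ≤ t → ∀ u, ‖u‖ ≤ Real.exp s →
      MeromorphicOn.divisor f (Metric.closedBall (0 : ℂ) |Real.exp s|) u
        = (analyticOrderNatAt f u : ℤ) := by
    intro s hs u hu
    have hmem : u ∈ Metric.closedBall (0 : ℂ) |Real.exp s| := by
      rwa [abs_of_pos (Real.exp_pos s), mem_closedBall_zero_iff]
    rw [MeromorphicOn.AnalyticOnNhd.divisor_apply (hf.mono (hball hs)) hmem,
      ← Nat.cast_analyticOrderNatAt (hord u (hball hs hmem))]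
    rfl
  have hZ : ∀ u, ‖u‖ ≤ Real.exp t → u ∉ hfin.toFinset → analyticOrderNatAt f u = 0 := by
    intro u hu huZ
    have : D u = 0 := by simpa using huZ
    rw [hD, hdiv le_rfl u hu] at this
    exact_mod_cast this
  have hz0 : analyticOrderNatAt f 0 = 0 := by
    rw [analyticOrderNatAt,
      (hf 0 (Metric.mem_ball_self one_pos)).analyticOrderAt_eq_zero.2 h0]
    rfl
  refine ⟨hfin.toFinset, analyticOrderNatAt f, fun s hs => ⟨?_, ?_⟩⟩
  · rw [logMeanCircle, MeromorphicOn.circleAverage_log_norm (Real.exp_ne_zero s)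
      (hf.mono (hball hs)).meromorphicOn, hdiv hs 0 (by simp [Real.exp_nonneg]), hz0,
      (hf 0 (Metric.mem_ball_self one_pos)).meromorphicTrailingCoeffAt_of_ne_zero h0]
    simp only [Nat.cast_zero, Int.cast_zero, zero_mul, add_zero, zero_sub, norm_neg]
    rw [add_comm]
    congr 1
    have hterm : ∀ u : ℂ,
        (MeromorphicOn.divisor f (Metric.closedBall (0 : ℂ) |Real.exp s|) u : ℝ)
          * Real.log (Real.exp s * ‖u‖⁻¹)
        = if ‖u‖ ≤ Real.exp s then (analyticOrderNatAt f u : ℝ) * max 0 (s - Real.log ‖u‖) else 0 := by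
      intro u
      by_cases hu : ‖u‖ ≤ Real.exp s
      · rw [if_pos hu, hdiv hs u hu]
        by_cases hu0 : u = 0
        · simp [hu0, hz0]
        · have hpos : 0 < ‖u‖ := norm_pos_iff.2 hu0
          have : Real.log ‖u‖ ≤ s := (Real.log_le_iff_le_exp hpos).2 hu
          rw [max_eq_right (by linarith), Real.log_mul (Real.exp_ne_zero _) (by positivity),
            Real.log_exp, Real.log_inv]
          push_cast; ring
      · rw [if_neg hu, Function.locallyFinsuppWithin.apply_eq_zero_of_notMem]
        · simp
        · rwa [abs_of_pos (Real.exp_pos s), mem_closedBall_zero_iff]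
    simp_rw [hterm]
    rw [finsum_eq_sum_of_support_subset (s := hfin.toFinset)]
    · refine Finset.sum_congr rfl fun u _ => ?_
      split_ifs with hu
      · rfl
      · have hpos : 0 < ‖u‖ := (Real.exp_pos s).trans (not_le.1 hu)
        have : s ≤ Real.log ‖u‖ := (Real.le_log_iff_exp_le hpos).2 (not_le.1 hu).le
        rw [max_eq_left (by linarith), mul_zero]
    · intro u hu
      rw [Function.mem_support] at hu
      by_contra hnot
      refine hu ?_
      split_ifs with h
      · rw [hZ u (h.trans (Real.exp_le_exp.2 hs)) hnot]; simp
      · rfl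
  · rw [zeroMeasure_eq_sum (Z := hfin.toFinset) (Real.exp_lt_one_iff.2 (by linarith)) hord]
    · congr 1
      refine Finset.sum_congr rfl fun u _ => ?_
      -- The default value `Real.log 0 = 0` does no harm, since `0` is not a zero of `f` and has
      -- multiplicity `0`.
      by_cases hu0 : u = 0
      · simp [hu0, hz0]
      · have hpos : 0 < ‖u‖ := norm_pos_iff.2 hu0
        simp only [Real.log_lt_iff_lt_exp hpos]
    · intro u hu huZ
      have h1 : ‖u‖ < Real.exp t := hu.trans_le (Real.exp_le_exp.2 hs)
      rw [← Nat.cast_analyticOrderNatAt (hord u (mem_ball_zero_iff.2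
        (h1.trans (Real.exp_lt_one_iff.2 ht)))), hZ u h1.le huZ]
      rfl

variable (hf : AnalyticOnNhd ℂ f (Metric.ball 0 1)) (h0 : f 0 ≠ 0) {t : ℝ} (ht : t < 0)
include hf h0 ht

lemma zeroMeasure_lt_top : zeroMeasure f (Metric.ball 0 (Real.exp t)) < ∞ := by
  obtain ⟨Z, m, h⟩ := exists_jensen hf h0 ht
  rw [(h t le_rfl).2]
  exact ENNReal.natCast_lt_top _

lemma exists_jensen_real : ∃ (Z : Finset ℂ) (m : ℂ → ℕ), ∀ s ≤ t,
      logMeanCircle f s = Real.log ‖f 0‖ + ∑ u ∈ Z, m u * max 0 (s - Real.log ‖u‖) ∧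
      diskCount f s = ∑ u ∈ Z, (m u : ℝ) * (if Real.log ‖u‖ < s then 1 else 0) := by
  obtain ⟨Z, m, h⟩ := exists_jensen hf h0 ht
  refine ⟨Z, m, fun s hs => ⟨(h s hs).1, ?_⟩⟩
  rw [diskCount, (h s hs).2, ENNReal.toReal_natCast]
  push_cast
  exact Finset.sum_congr rfl fun u _ => by split_ifs <;> simp

omit hf h0 ht in
lemma diskCount_nonneg (s : ℝ) : 0 ≤ diskCount f s := ENNReal.toReal_nonneg

lemma diskCount_mono {s : ℝ} (hs : s ≤ t) : diskCount f s ≤ diskCount f t := by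
  obtain ⟨Z, m, h⟩ := exists_jensen_real hf h0 ht
  rw [(h s hs).2, (h t le_rfl).2]
  gcongr with u
  split_ifs <;> first | rfl | linarith

/-- The discs are open, so the count is left-continuous; this is what the passage to equal radii
uses. -/
lemma tendsto_diskCount : Tendsto (diskCount f) (𝓝[<] t) (𝓝 (diskCount f t)) := by
  obtain ⟨Z, m, h⟩ := exists_jensen_real hf h0 ht
  rw [(h t le_rfl).2]
  have : ∀ᶠ s in 𝓝[<] t, ∑ u ∈ Z, (m u : ℝ) * (if Real.log ‖u‖ < s then 1 else 0) = diskCount f s := by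
    filter_upwards [self_mem_nhdsWithin] with s hs
    exact (h s (le_of_lt hs)).2.symm
  refine Tendsto.congr' this (tendsto_finsetSum _ fun u _ => Tendsto.const_mul _ ?_)
  by_cases hu : Real.log ‖u‖ < t
  · refine tendsto_const_nhds.congr' ?_
    filter_upwards [mem_nhdsWithin_of_mem_nhds (Ioi_mem_nhds hu)] with s hs
    rw [if_pos hu, if_pos (mem_Ioi.1 hs)]
  · refine tendsto_const_nhds.congr' ?_
    filter_upwards [self_mem_nhdsWithin] with s hs
    rw [if_neg hu, if_neg]
    have : s < t := hs
    linarith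

lemma logMeanCircle_sub_nonneg {h : ℝ} (hh : 0 < h) :
    0 ≤ (logMeanCircle f t - logMeanCircle f (t - h)) / h := by
  obtain ⟨Z, m, hz⟩ := exists_jensen_real hf h0 ht
  rw [(hz t le_rfl).1, (hz (t - h) (by linarith)).1, add_sub_add_left_eq_sub]
  refine div_nonneg (sub_nonneg.2 ?_) hh.le
  gcongr
  linarith

/-- Convexity: backward difference quotients lie below the left derivative. This supplies the
domination for the limits under the expectation. -/
lemma logMeanCircle_sub_le {h : ℝ} (hh : 0 < h) :
    (logMeanCircle f t - logMeanCircle f (t - h)) / h ≤ diskCount f t := by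
  obtain ⟨Z, m, hz⟩ := exists_jensen_real hf h0 ht
  rw [(hz t le_rfl).1, (hz (t - h) (by linarith)).1, (hz t le_rfl).2, add_sub_add_left_eq_sub,
    div_le_iff₀ hh, ← Finset.sum_sub_distrib, Finset.sum_mul]
  refine Finset.sum_le_sum fun u _ => ?_
  rw [← mul_sub, mul_assoc]
  refine mul_le_mul_of_nonneg_left ?_ (Nat.cast_nonneg _)
  split_ifs with hu
  · rw [max_eq_right (by linarith)]
    have := le_max_right 0 (t - h - Real.log ‖u‖)
    linarith
  · rw [max_eq_left (by linarith), max_eq_left (by linarith)]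
    linarith

/-- Each summand has a single kink, at `log ‖u‖`, so its quotient is constant for small `h`. A zero
on the boundary circle gives `0`, in accordance with the open disc. -/
lemma tendsto_logMeanCircle_sub :
    Tendsto (fun h => (logMeanCircle f t - logMeanCircle f (t - h)) / h) (𝓝[>] 0)
      (𝓝 (diskCount f t)) := by
  obtain ⟨Z, m, hz⟩ := exists_jensen_real hf h0 ht
  rw [(hz t le_rfl).2]
  have : ∀ᶠ h in 𝓝[>] (0 : ℝ), ∑ u ∈ Z, (m u : ℝ) *
      ((max 0 (t - Real.log ‖u‖) - max 0 (t - h - Real.log ‖u‖)) / h)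
      = (logMeanCircle f t - logMeanCircle f (t - h)) / h := by
    filter_upwards [self_mem_nhdsWithin] with h hh
    have hh : 0 < h := hh
    rw [(hz t le_rfl).1, (hz (t - h) (by linarith)).1, add_sub_add_left_eq_sub,
      ← Finset.sum_sub_distrib, Finset.sum_div]
    exact Finset.sum_congr rfl fun u _ => by ring
  refine Tendsto.congr' this (tendsto_finsetSum _ fun u _ => Tendsto.const_mul _ ?_)
  refine tendsto_const_nhds.congr' ?_
  by_cases hu : Real.log ‖u‖ < t
  · filter_upwards [self_mem_nhdsWithin, mem_nhdsWithin_of_mem_nhds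
      (Iio_mem_nhds (sub_pos.2 hu))] with h hh hh2
    have hh : 0 < h := hh
    have hh2 : h < t - Real.log ‖u‖ := hh2
    rw [if_pos hu, max_eq_right (by linarith), max_eq_right (by linarith), eq_div_iff hh.ne']
    ring
  · filter_upwards [self_mem_nhdsWithin] with h hh
    have hh : 0 < h := hh
    rw [if_neg hu, max_eq_left (by linarith), max_eq_left (by linarith)]
    simp

end Jensen

end

end HyperbolicGAF

/-! ### The mixed radial derivative of the logarithmic correlation. -/

namespace HyperbolicGAF

open Set Filter Topology ComplexConjugate

noncomputable section

/-- Joint continuity bounds the derivative on a compact neighbourhood, and the constant bound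
justifies differentiation under the integral. -/
lemma hasDerivAt_intervalIntegral_of_continuousOn {F F' : ℝ → ℝ → ℝ} {U : Set ℝ} (hU : IsOpen U)
    {x₀ : ℝ} (hx₀ : x₀ ∈ U) (a b : ℝ) (hF : ∀ x ∈ U, Continuous (F x))
    (hd : ∀ x ∈ U, ∀ θ, HasDerivAt (fun x => F x θ) (F' x θ) x)
    (hF' : ContinuousOn (fun p : ℝ × ℝ => F' p.1 p.2) (U ×ˢ univ)) :
    HasDerivAt (fun x => ∫ θ in a..b, F x θ) (∫ θ in a..b, F' x₀ θ) x₀ := by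
  obtain ⟨ε, hε, hball⟩ := Metric.nhds_basis_closedBall.mem_iff.1 (hU.mem_nhds hx₀)
  have hcomp : IsCompact (Metric.closedBall x₀ ε ×ˢ uIcc a b) :=
    (isCompact_closedBall x₀ ε).prod isCompact_uIcc
  obtain ⟨C, hC⟩ := hcomp.exists_bound_of_continuousOn
    (hF'.mono (prod_mono hball (subset_univ _)))
  refine (intervalIntegral.hasDerivAt_integral_of_dominated_loc_of_deriv_le (bound := fun _ => C)
    (F' := F') (Metric.closedBall_mem_nhds x₀ hε) ?_ ((hF x₀ hx₀).intervalIntegrable a b) ?_ ?_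
    intervalIntegrable_const ?_).2
  · filter_upwards [hU.mem_nhds hx₀] with x hx
    exact (hF x hx).aestronglyMeasurable
  · have : Continuous (F' x₀) := by
      rw [← continuousOn_univ]
      exact hF'.comp (f := fun θ => (x₀, θ)) (by fun_prop) fun θ _ => ⟨hx₀, mem_univ _⟩
    exact this.aestronglyMeasurable
  · exact ae_of_all _ fun θ hθ x hx => hC (x, θ) ⟨hx, uIoc_subset_uIcc hθ⟩
  · exact ae_of_all _ fun θ _ x hx => hd x (hball hx) θ

/-- The squared modulus of `1 - exp (u + iθ)`. -/
def den (u θ : ℝ) : ℝ := 1 - 2 * Real.exp u * Real.cos θ + Real.exp u ^ 2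

/-- The logarithm of the squared correlation of the values of `f_L` at two points of moduli `exp s`
and `exp t` whose arguments differ by `θ`. -/
def logCorrSq (L s t θ : ℝ) : ℝ :=
  L * (Real.log (1 - Real.exp s ^ 2) + Real.log (1 - Real.exp t ^ 2) - Real.log (den (s + t) θ))

/-- The derivative of `logCorrSq` in its first variable. -/
def logCorrSqDeriv (L s t θ : ℝ) : ℝ :=
  L * (-(2 * Real.exp s ^ 2 / (1 - Real.exp s ^ 2))
    - (2 * Real.exp (s + t) ^ 2 - 2 * Real.exp (s + t) * Real.cos θ) / den (s + t) θ)

/-- The second radial logarithmic derivative of `den`. -/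
def denHess (u θ : ℝ) : ℝ :=
  ((4 * Real.exp u ^ 2 - 2 * Real.exp u * Real.cos θ) * den u θ
    - (2 * Real.exp u ^ 2 - 2 * Real.exp u * Real.cos θ) ^ 2) / den u θ ^ 2

/-- The integrand of the covariance of the zero counts of two concentric discs. -/
def covKernel (L s t θ : ℝ) : ℝ :=
  Real.exp (logCorrSq L s t θ) / (1 - Real.exp (logCorrSq L s t θ)) *
    (logCorrSqDeriv L s t θ * logCorrSqDeriv L t s θ
      + (L * (2 * Real.exp (s + t) * Real.sin θ / den (s + t) θ)) ^ 2)

lemma logCorrSq_comm (L s t θ : ℝ) : logCorrSq L s t θ = logCorrSq L t s θ := by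
  unfold logCorrSq; rw [add_comm s t]; ring

lemma one_sub_exp_sq_pos {s : ℝ} (hs : s < 0) : 0 < 1 - Real.exp s ^ 2 := by
  have h1 := Real.exp_lt_one_iff.2 hs
  have h2 := Real.exp_pos s
  nlinarith

/-- The bracket is the squared distance of the two points: `norm_one_sub_mul_conj_sq` in polar
coordinates. -/
lemma den_eq (s t θ : ℝ) : den (s + t) θ = (1 - Real.exp s ^ 2) * (1 - Real.exp t ^ 2)
    + ((Real.exp s - Real.exp t) ^ 2 + 2 * Real.exp s * Real.exp t * (1 - Real.cos θ)) := by
  rw [den, Real.exp_add]; ring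

lemma den_pos {u : ℝ} (hu : u < 0) (θ : ℝ) : 0 < den u θ := by
  have h1 := Real.exp_lt_one_iff.2 hu
  have h2 := Real.exp_pos u
  have h3 := Real.cos_le_one θ
  unfold den
  nlinarith [mul_nonneg h2.le (sub_nonneg.2 h3), pow_pos (sub_pos.2 h1) 2]

lemma logCorrSq_neg {L s t θ : ℝ} (hL : 0 < L) (hs : s < 0) (ht : t < 0)
    (h : s ≠ t ∨ Real.cos θ ≠ 1) : logCorrSq L s t θ < 0 := by
  have h1 := one_sub_exp_sq_pos hs
  have h2 := one_sub_exp_sq_pos ht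
  have h3 : 0 ≤ 1 - Real.cos θ := sub_nonneg.2 (Real.cos_le_one θ)
  have hpq : 0 < 2 * Real.exp s * Real.exp t := by positivity
  have hE : 0 < (Real.exp s - Real.exp t) ^ 2 + 2 * Real.exp s * Real.exp t * (1 - Real.cos θ) := by
    rcases h with h | h
    · have : Real.exp s - Real.exp t ≠ 0 := sub_ne_zero.2 fun e => h (Real.exp_injective e)
      have := pow_pos (abs_pos.2 this) 2
      rw [sq_abs] at this
      positivity
    · have : 0 < 1 - Real.cos θ := lt_of_le_of_ne h3 fun e => h (by linarith)
      positivity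
  unfold logCorrSq
  refine mul_neg_of_pos_of_neg hL ?_
  rw [← Real.log_mul h1.ne' h2.ne', sub_neg]
  refine Real.log_lt_log (by positivity) ?_
  rw [den_eq]
  linarith

lemma hasDerivAt_logCorrSq (L : ℝ) {s t : ℝ} (hs : s < 0) (ht : t < 0) (θ : ℝ) :
    HasDerivAt (fun s => logCorrSq L s t θ) (logCorrSqDeriv L s t θ) s := by
  have h1 := one_sub_exp_sq_pos hs
  have hD := den_pos (add_neg hs ht) θ
  have e1 : HasDerivAt (fun s => Real.exp s ^ 2) (2 * Real.exp s ^ 2) s :=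
    ((Real.hasDerivAt_exp s).pow 2).congr_deriv (by push_cast; ring)
  have e2 : HasDerivAt (fun s => Real.exp (s + t)) (Real.exp (s + t)) s := by
    simpa using ((hasDerivAt_id s).add_const t).exp
  have e3 : HasDerivAt (fun s => den (s + t) θ)
      (2 * Real.exp (s + t) ^ 2 - 2 * Real.exp (s + t) * Real.cos θ) s := by
    have := (((e2.const_mul 2).mul_const (Real.cos θ)).const_sub 1).add (e2.pow 2)
    exact this.congr_deriv (by push_cast; ring)
  have := ((((e1.const_sub 1).log h1.ne').add_const (Real.log (1 - Real.exp t ^ 2))).sub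
    (e3.log hD.ne')).const_mul L
  exact this.congr_deriv (by rw [logCorrSqDeriv]; ring)

lemma hasDerivAt_logCorrSqDeriv (L : ℝ) {s t : ℝ} (hs : s < 0) (ht : t < 0) (θ : ℝ) :
    HasDerivAt (fun s => logCorrSqDeriv L t s θ) (-(L * denHess (s + t) θ)) s := by
  have hD := den_pos (add_neg hs ht) θ
  have e2 : HasDerivAt (fun s => Real.exp (s + t)) (Real.exp (s + t)) s := by
    simpa using ((hasDerivAt_id s).add_const t).exp
  have e3 : HasDerivAt (fun s => den (s + t) θ)
      (2 * Real.exp (s + t) ^ 2 - 2 * Real.exp (s + t) * Real.cos θ) s := by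
    have := (((e2.const_mul 2).mul_const (Real.cos θ)).const_sub 1).add (e2.pow 2)
    exact this.congr_deriv (by push_cast; ring)
  have e4 : HasDerivAt
      (fun s => 2 * Real.exp (s + t) ^ 2 - 2 * Real.exp (s + t) * Real.cos θ)
      (4 * Real.exp (s + t) ^ 2 - 2 * Real.exp (s + t) * Real.cos θ) s := by
    have := ((e2.pow 2).const_mul 2).sub ((e2.const_mul 2).mul_const (Real.cos θ))
    exact this.congr_deriv (by push_cast; ring)
  have := ((e4.div e3 hD.ne').const_sub (-(2 * Real.exp t ^ 2 / (1 - Real.exp t ^ 2)))).const_mul L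
  have h2 : (fun s => logCorrSqDeriv L t s θ) = fun s => L *
      (-(2 * Real.exp t ^ 2 / (1 - Real.exp t ^ 2)) -
      (2 * Real.exp (s + t) ^ 2 - 2 * Real.exp (s + t) * Real.cos θ) / den (s + t) θ) := by
    funext s; rw [logCorrSqDeriv, add_comm t s]
  rw [h2]
  exact this.congr_deriv (by rw [denHess]; ring)

lemma hasDerivAt_logCorrSq_angle (L : ℝ) {s t : ℝ} (hs : s < 0) (ht : t < 0) (θ : ℝ) :
    HasDerivAt (fun θ => logCorrSq L s t θ)
      (-(L * (2 * Real.exp (s + t) * Real.sin θ / den (s + t) θ))) θ := by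
  have hD := den_pos (add_neg hs ht) θ
  have e3 : HasDerivAt (fun θ => den (s + t) θ) (2 * Real.exp (s + t) * Real.sin θ) θ := by
    have := ((((Real.hasDerivAt_cos θ).const_mul (2 * Real.exp (s + t))).const_sub 1)).add_const
      (Real.exp (s + t) ^ 2)
    exact this.congr_deriv (by ring)
  have := ((e3.log hD.ne').const_sub
    (Real.log (1 - Real.exp s ^ 2) + Real.log (1 - Real.exp t ^ 2))).const_mul L
  exact this.congr_deriv (by ring)

/-- `log den` is harmonic in `(u, θ)`, being the logarithm of the squared modulus of `1 - exp (u +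
iθ)`. Its second angular derivative is thus minus its second radial derivative `denHess`. -/
lemma hasDerivAt_den_angle_log {u : ℝ} (hu : u < 0) (θ : ℝ) :
    HasDerivAt (fun θ => 2 * Real.exp u * Real.sin θ / den u θ) (-denHess u θ) θ := by
  have hD := den_pos hu θ
  have e3 : HasDerivAt (fun θ => den u θ) (2 * Real.exp u * Real.sin θ) θ := by
    have := ((((Real.hasDerivAt_cos θ).const_mul (2 * Real.exp u)).const_sub 1)).add_const
      (Real.exp u ^ 2)
    exact this.congr_deriv (by ring)
  refine (((Real.hasDerivAt_sin θ).const_mul (2 * Real.exp u)).div e3 hD.ne').congr_deriv ?_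
  rw [denHess, ← neg_div]
  congr 1
  have h1 := Real.sin_sq θ
  have : (2 * Real.exp u * Real.sin θ) * (2 * Real.exp u * Real.sin θ)
      = 4 * Real.exp u ^ 2 * Real.sin θ ^ 2 := by ring
  rw [this, h1, den]
  ring

lemma hasDerivAt_logCorr_exp {g g' : ℝ → ℝ} {x : ℝ} (hg : HasDerivAt g (g' x) x) (h : g x < 0) :
    HasDerivAt (fun x => logCorr (Real.exp (g x))) (-Real.log (1 - Real.exp (g x)) * g' x) x := by
  have h1 := hasDerivAt_logCorr (Real.exp_pos (g x)) (Real.exp_lt_one_iff.2 h)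
  have h2 := HasDerivAt.comp x h1 hg.exp
  refine h2.congr_deriv ?_
  have := Real.exp_ne_zero (g x)
  field_simp

lemma hasDerivAt_log_one_sub_exp {g : ℝ → ℝ} {g' x : ℝ} (hg : HasDerivAt g g' x) (h : g x < 0) :
    HasDerivAt (fun x => Real.log (1 - Real.exp (g x)))
      (-(Real.exp (g x) / (1 - Real.exp (g x)) * g')) x := by
  have h0 : 0 < 1 - Real.exp (g x) := sub_pos.2 (Real.exp_lt_one_iff.2 h)
  refine ((hg.exp.const_sub 1).log h0.ne').congr_deriv ?_
  ring

section Continuity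

variable {X : Type*} [TopologicalSpace X] {A : Set X} {s t θ : X → ℝ}

lemma continuousOn_den {u : X → ℝ} (hu : ContinuousOn u A) (hθ : ContinuousOn θ A) :
    ContinuousOn (fun x => den (u x) (θ x)) A := by
  unfold den; fun_prop

lemma continuousOn_logCorrSq (L : ℝ) (hs : ContinuousOn s A) (ht : ContinuousOn t A)
    (hθ : ContinuousOn θ A) (hs0 : ∀ x ∈ A, s x < 0) (ht0 : ∀ x ∈ A, t x < 0) :
    ContinuousOn (fun x => logCorrSq L (s x) (t x) (θ x)) A := by
  have hD := continuousOn_den (u := fun x => s x + t x) (hs.add ht) hθ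
  unfold logCorrSq
  refine continuousOn_const.mul ((ContinuousOn.add (ContinuousOn.log (by fun_prop) ?_)
    (ContinuousOn.log (by fun_prop) ?_)).sub (hD.log ?_))
  · exact fun x hx => (one_sub_exp_sq_pos (hs0 x hx)).ne'
  · exact fun x hx => (one_sub_exp_sq_pos (ht0 x hx)).ne'
  · exact fun x hx => (den_pos (add_neg (hs0 x hx) (ht0 x hx)) _).ne'

lemma continuousOn_logCorrSqDeriv (L : ℝ) (hs : ContinuousOn s A) (ht : ContinuousOn t A)
    (hθ : ContinuousOn θ A) (hs0 : ∀ x ∈ A, s x < 0) (ht0 : ∀ x ∈ A, t x < 0) :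
    ContinuousOn (fun x => logCorrSqDeriv L (s x) (t x) (θ x)) A := by
  have hD := continuousOn_den (u := fun x => s x + t x) (hs.add ht) hθ
  unfold logCorrSqDeriv
  refine continuousOn_const.mul ((ContinuousOn.neg (ContinuousOn.div (by fun_prop) (by fun_prop)
    ?_)).sub (ContinuousOn.div (by fun_prop) hD ?_))
  · exact fun x hx => (one_sub_exp_sq_pos (hs0 x hx)).ne'
  · exact fun x hx => (den_pos (add_neg (hs0 x hx) (ht0 x hx)) _).ne'

lemma continuousOn_denHess {u : X → ℝ} (hu : ContinuousOn u A) (hθ : ContinuousOn θ A)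
    (hu0 : ∀ x ∈ A, u x < 0) : ContinuousOn (fun x => denHess (u x) (θ x)) A := by
  have hD := continuousOn_den hu hθ
  unfold denHess
  refine ContinuousOn.div (by fun_prop) (by fun_prop) ?_
  exact fun x hx => pow_ne_zero 2 (den_pos (hu0 x hx) _).ne'

lemma continuousOn_covKernel {L : ℝ} (hL : 0 < L) (hs : ContinuousOn s A) (ht : ContinuousOn t A)
    (hθ : ContinuousOn θ A) (hs0 : ∀ x ∈ A, s x < 0) (ht0 : ∀ x ∈ A, t x < 0)
    (h : ∀ x ∈ A, s x ≠ t x ∨ Real.cos (θ x) ≠ 1) :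
    ContinuousOn (fun x => covKernel L (s x) (t x) (θ x)) A := by
  have hg := continuousOn_logCorrSq L hs ht hθ hs0 ht0
  have hd1 := continuousOn_logCorrSqDeriv L hs ht hθ hs0 ht0
  have hd2 := continuousOn_logCorrSqDeriv L ht hs hθ ht0 hs0
  have hD := continuousOn_den (u := fun x => s x + t x) (hs.add ht) hθ
  unfold covKernel
  refine (ContinuousOn.div (by fun_prop) (by fun_prop) ?_).mul ((hd1.mul hd2).add
    (ContinuousOn.pow (continuousOn_const.mul (ContinuousOn.div (by fun_prop) hD ?_)) 2))
  · exact fun x hx => (sub_pos.2 (Real.exp_lt_one_iff.2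
      (logCorrSq_neg hL (hs0 x hx) (ht0 x hx) (h x hx)))).ne'
  · exact fun x hx => (den_pos (add_neg (hs0 x hx) (ht0 x hx)) _).ne'

end Continuity

/-- `2π` times the angular mean of the mixed logarithmic moment. -/
def corrMean (L s t : ℝ) : ℝ :=
  ∫ θ in (-Real.pi)..Real.pi, logCorr (Real.exp (logCorrSq L s t θ))

/-- The derivative of `corrMean` in its second variable. -/
def corrMeanDeriv (L s t : ℝ) : ℝ :=
  ∫ θ in (-Real.pi)..Real.pi,
    -Real.log (1 - Real.exp (logCorrSq L s t θ)) * logCorrSqDeriv L t s θ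

variable {L s t : ℝ}

lemma continuous_logCorr_logCorrSq (hL : 0 < L) (hs : s < 0) (ht : t < 0) (hst : s ≠ t) :
    Continuous fun θ => logCorr (Real.exp (logCorrSq L s t θ)) := by
  rw [continuous_iff_continuousAt]
  intro θ
  exact (hasDerivAt_logCorr_exp (g' := fun θ => _) (hasDerivAt_logCorrSq_angle L hs ht θ)
    (logCorrSq_neg hL hs ht (Or.inl hst))).continuousAt

lemma hasDerivAt_corrMean (hL : 0 < L) (hst : s < t) (ht : t < 0) :
    HasDerivAt (fun t => corrMean L s t) (corrMeanDeriv L s t) t := by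
  have hs : s < 0 := hst.trans ht
  refine hasDerivAt_intervalIntegral_of_continuousOn (U := Ioo s 0) isOpen_Ioo ⟨hst, ht⟩
    (-Real.pi) Real.pi (F := fun t θ => logCorr (Real.exp (logCorrSq L s t θ)))
    (F' := fun t θ => -Real.log (1 - Real.exp (logCorrSq L s t θ)) * logCorrSqDeriv L t s θ)
    ?_ ?_ ?_
  · exact fun x hx => continuous_logCorr_logCorrSq hL hs hx.2 hx.1.ne
  · intro x hx θ
    refine hasDerivAt_logCorr_exp (g := fun x => logCorrSq L s x θ)
      (g' := fun x => logCorrSqDeriv L x s θ) ?_ (logCorrSq_neg hL hs hx.2 (Or.inl hx.1.ne))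
    simp_rw [logCorrSq_comm L s]
    exact hasDerivAt_logCorrSq L hx.2 hs θ
  · have hs0 : ∀ x ∈ Ioo s 0 ×ˢ (univ : Set ℝ), (fun _ : ℝ × ℝ => s) x < 0 := fun _ _ => hs
    have ht0 : ∀ x ∈ Ioo s 0 ×ˢ (univ : Set ℝ), x.1 < 0 := fun x hx => hx.1.2
    have hg := continuousOn_logCorrSq L (A := Ioo s 0 ×ˢ (univ : Set ℝ)) (s := fun _ => s)
      (t := Prod.fst) (θ := Prod.snd) (by fun_prop) (by fun_prop) (by fun_prop) hs0 ht0
    have hd := continuousOn_logCorrSqDeriv L (A := Ioo s 0 ×ˢ (univ : Set ℝ)) (s := Prod.fst)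
      (t := fun _ => s) (θ := Prod.snd) (by fun_prop) (by fun_prop) (by fun_prop) ht0 hs0
    refine (ContinuousOn.neg (ContinuousOn.log (by fun_prop) ?_)).mul hd
    exact fun x hx => (sub_pos.2 (Real.exp_lt_one_iff.2
      (logCorrSq_neg hL hs hx.1.2 (Or.inl hx.1.1.ne)))).ne'

lemma hasDerivAt_corrMeanDeriv_aux (hL : 0 < L) (hst : s < t) (ht : t < 0) :
    HasDerivAt (fun s => corrMeanDeriv L s t)
      (∫ θ in (-Real.pi)..Real.pi,
        (Real.exp (logCorrSq L s t θ) / (1 - Real.exp (logCorrSq L s t θ))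
          * logCorrSqDeriv L s t θ * logCorrSqDeriv L t s θ
        + Real.log (1 - Real.exp (logCorrSq L s t θ)) * (L * denHess (s + t) θ))) s := by
  have hs : s < 0 := hst.trans ht
  have hs0 : ∀ x ∈ Iio t ×ˢ (univ : Set ℝ), x.1 < 0 := fun x hx => (mem_Iio.1 hx.1).trans ht
  have ht0 : ∀ x ∈ Iio t ×ˢ (univ : Set ℝ), (fun _ : ℝ × ℝ => t) x < 0 := fun _ _ => ht
  refine hasDerivAt_intervalIntegral_of_continuousOn (U := Iio t) isOpen_Iio hst
    (-Real.pi) Real.pi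
    (F := fun s θ => -Real.log (1 - Real.exp (logCorrSq L s t θ)) * logCorrSqDeriv L t s θ)
    (F' := fun s θ => Real.exp (logCorrSq L s t θ) / (1 - Real.exp (logCorrSq L s t θ))
          * logCorrSqDeriv L s t θ * logCorrSqDeriv L t s θ
        + Real.log (1 - Real.exp (logCorrSq L s t θ)) * (L * denHess (s + t) θ)) ?_ ?_ ?_
  · intro x hx
    have hx0 : x < 0 := (mem_Iio.1 hx).trans ht
    rw [← continuousOn_univ]
    have hg := continuousOn_logCorrSq L (A := (univ : Set ℝ)) (s := fun _ => x)
      (t := fun _ => t) (θ := id) (by fun_prop) (by fun_prop) (by fun_prop)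
      (fun _ _ => hx0) (fun _ _ => ht)
    have hd := continuousOn_logCorrSqDeriv L (A := (univ : Set ℝ)) (s := fun _ => t)
      (t := fun _ => x) (θ := id) (by fun_prop) (by fun_prop) (by fun_prop)
      (fun _ _ => ht) (fun _ _ => hx0)
    refine (ContinuousOn.neg (ContinuousOn.log (continuousOn_const.sub hg.rexp) ?_)).mul hd
    exact fun θ _ => (sub_pos.2 (Real.exp_lt_one_iff.2
      (logCorrSq_neg hL hx0 ht (Or.inl (ne_of_lt hx))))).ne'
  · intro x hx θ
    have hx0 : x < 0 := (mem_Iio.1 hx).trans ht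
    have h1 := (hasDerivAt_log_one_sub_exp (hasDerivAt_logCorrSq L hx0 ht θ)
      (logCorrSq_neg hL hx0 ht (Or.inl (ne_of_lt hx)))).neg.mul (hasDerivAt_logCorrSqDeriv L hx0 ht θ)
    refine h1.congr_deriv ?_
    rw [Pi.neg_apply]
    ring
  · have hg := continuousOn_logCorrSq L (A := Iio t ×ˢ (univ : Set ℝ)) (s := Prod.fst)
      (t := fun _ => t) (θ := Prod.snd) (by fun_prop) (by fun_prop) (by fun_prop) hs0 ht0
    have hd := continuousOn_logCorrSqDeriv L (A := Iio t ×ˢ (univ : Set ℝ)) (s := Prod.fst)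
      (t := fun _ => t) (θ := Prod.snd) (by fun_prop) (by fun_prop) (by fun_prop) hs0 ht0
    have hd2 := continuousOn_logCorrSqDeriv L (A := Iio t ×ˢ (univ : Set ℝ)) (s := fun _ => t)
      (t := Prod.fst) (θ := Prod.snd) (by fun_prop) (by fun_prop) (by fun_prop) ht0 hs0
    have hh := continuousOn_denHess (A := Iio t ×ˢ (univ : Set ℝ)) (u := fun x => x.1 + t)
      (θ := Prod.snd) (by fun_prop) (by fun_prop) (fun x hx => add_neg (hs0 x hx) ht)
    have hne : ∀ x ∈ Iio t ×ˢ (univ : Set ℝ), 1 - Real.exp (logCorrSq L x.1 t x.2) ≠ 0 :=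
      fun x hx => (sub_pos.2 (Real.exp_lt_one_iff.2
        (logCorrSq_neg hL (hs0 x hx) ht (Or.inl (ne_of_lt hx.1))))).ne'
    exact (((ContinuousOn.div hg.rexp (continuousOn_const.sub hg.rexp) hne).mul hd).mul hd2).add
      ((ContinuousOn.log (continuousOn_const.sub hg.rexp) hne).mul (continuousOn_const.mul hh))

/-- The second mixed derivative of `corrMean`. -/
lemma hasDerivAt_corrMeanDeriv (hL : 0 < L) (hst : s < t) (ht : t < 0) :
    HasDerivAt (fun s => corrMeanDeriv L s t)
      (∫ θ in (-Real.pi)..Real.pi, covKernel L s t θ) s := by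
  have hs : s < 0 := hst.trans ht
  refine (hasDerivAt_corrMeanDeriv_aux hL hst ht).congr_deriv ?_
  have hneg : ∀ θ, logCorrSq L s t θ < 0 := fun θ => logCorrSq_neg hL hs ht (Or.inl hst.ne)
  have hne : ∀ θ, 1 - Real.exp (logCorrSq L s t θ) ≠ 0 := fun θ =>
    (sub_pos.2 (Real.exp_lt_one_iff.2 (hneg θ))).ne'
  -- `P` is `-log (1 - e^g) g_θ`, with `g` the function `logCorrSq`. It vanishes at `±π`, so `∫ P' =
  -- 0`; adding this integral replaces the logarithmic term containing `denHess` by the term with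
  -- `g_θ²`.
  set P : ℝ → ℝ := fun θ => L * (Real.log (1 - Real.exp (logCorrSq L s t θ))
    * (2 * Real.exp (s + t) * Real.sin θ / den (s + t) θ)) with hP
  set P' : ℝ → ℝ := fun θ => L * (Real.exp (logCorrSq L s t θ) / (1 - Real.exp (logCorrSq L s t θ))
      * (L * (2 * Real.exp (s + t) * Real.sin θ / den (s + t) θ) ^ 2)
      - Real.log (1 - Real.exp (logCorrSq L s t θ)) * denHess (s + t) θ) with hP'
  have hd : ∀ θ, HasDerivAt P (P' θ) θ := by
    intro θ
    refine (((hasDerivAt_log_one_sub_exp (hasDerivAt_logCorrSq_angle L hs ht θ) (hneg θ)).mul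
      (hasDerivAt_den_angle_log (add_neg hs ht) θ)).const_mul L).congr_deriv ?_
    rw [hP']
    ring
  have hg : Continuous fun θ => logCorrSq L s t θ :=
    continuous_iff_continuousAt.2 fun θ => (hasDerivAt_logCorrSq_angle L hs ht θ).continuousAt
  have hD : Continuous fun θ => den (s + t) θ := by unfold den; fun_prop
  have hD0 : ∀ θ, den (s + t) θ ≠ 0 := fun θ => (den_pos (add_neg hs ht) θ).ne'
  have hH : Continuous fun θ => denHess (s + t) θ := by
    rw [← continuousOn_univ]
    exact continuousOn_denHess (by fun_prop) (by fun_prop) fun _ _ => add_neg hs ht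
  have hd1 : Continuous fun θ => logCorrSqDeriv L s t θ := by
    rw [← continuousOn_univ]
    exact continuousOn_logCorrSqDeriv L (by fun_prop) (by fun_prop) (by fun_prop) (fun _ _ => hs)
      fun _ _ => ht
  have hd2 : Continuous fun θ => logCorrSqDeriv L t s θ := by
    rw [← continuousOn_univ]
    exact continuousOn_logCorrSqDeriv L (by fun_prop) (by fun_prop) (by fun_prop) (fun _ _ => ht)
      fun _ _ => hs
  have hlog : Continuous fun θ => Real.log (1 - Real.exp (logCorrSq L s t θ)) :=
    (continuous_const.sub hg.rexp).log hne
  have hq : Continuous fun θ =>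
      Real.exp (logCorrSq L s t θ) / (1 - Real.exp (logCorrSq L s t θ)) :=
    hg.rexp.div (continuous_const.sub hg.rexp) hne
  have hr : Continuous fun θ => 2 * Real.exp (s + t) * Real.sin θ / den (s + t) θ :=
    (by fun_prop : Continuous fun θ => 2 * Real.exp (s + t) * Real.sin θ).div hD hD0
  have hP'c : Continuous P' := by rw [hP']; fun_prop
  have hzero : ∫ θ in (-Real.pi)..Real.pi, P' θ = 0 := by
    rw [intervalIntegral.integral_eq_sub_of_hasDerivAt (fun θ _ => hd θ)
      (hP'c.intervalIntegrable _ _)]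
    simp [hP]
  rw [← add_zero (∫ θ in (-Real.pi)..Real.pi, _), ← hzero, ← intervalIntegral.integral_add]
  · refine intervalIntegral.integral_congr fun θ _ => ?_
    simp only [hP', covKernel]
    ring
  · exact Continuous.intervalIntegrable (by fun_prop) _ _
  · exact hP'c.intervalIntegrable _ _

end

end HyperbolicGAF

/-! ### Boundedness of the covariance kernel and its value at equal radii. -/

namespace HyperbolicGAF

open Set Filter Topology ComplexConjugate

noncomputable section

/-- Over a common denominator, the numerator visibly vanishes to first order when the two points
merge. -/
lemma logCorrSqDeriv_eq (L : ℝ) {s t : ℝ} (hs : s < 0) (ht : t < 0) (θ : ℝ) :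
    logCorrSqDeriv L s t θ = -(2 * L * Real.exp s *
      ((1 + Real.exp s ^ 2) * (Real.exp s - Real.exp t * Real.cos θ)
        + Real.exp s * (Real.exp t ^ 2 - Real.exp s ^ 2)) /
      ((1 - Real.exp s ^ 2) * den (s + t) θ)) := by
  have h1 := (one_sub_exp_sq_pos hs).ne'
  have hD := (den_pos (add_neg hs ht) θ).ne'
  rw [logCorrSqDeriv]
  field_simp
  rw [den, Real.exp_add]
  ring

lemma logCorrSqDeriv_sq_le {L : ℝ} {s t : ℝ} (hs : s < 0) (ht : t < 0) (θ : ℝ) :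
    logCorrSqDeriv L s t θ ^ 2 ≤ 64 * L ^ 2 *
      ((Real.exp s - Real.exp t) ^ 2 + 2 * Real.exp s * Real.exp t * (1 - Real.cos θ)) /
      ((1 - Real.exp s ^ 2) ^ 2 * den (s + t) θ ^ 2) := by
  have h1 := one_sub_exp_sq_pos hs
  have hD := den_pos (add_neg hs ht) θ
  have hp0 := Real.exp_pos s
  have hq0 := Real.exp_pos t
  have hp1 := Real.exp_lt_one_iff.2 hs
  have hq1 := Real.exp_lt_one_iff.2 ht
  have hc1 := Real.cos_le_one θ
  have hcs := Real.sin_sq_add_cos_sq θ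
  rw [logCorrSqDeriv_eq L hs ht, neg_sq, div_pow, mul_pow _ _ 2, mul_pow (1 - Real.exp s ^ 2)]
  refine div_le_div_of_nonneg_right ?_ (by positivity)
  set p := Real.exp s
  set q := Real.exp t
  set c := Real.cos θ
  set E := (p - q) ^ 2 + 2 * p * q * (1 - c) with hE
  -- `E` is the squared modulus of `p - q e^(iθ)`, whose real part is `p - q c`. Both summands of
  -- the numerator have square at most `4E`, so their sum has square at most `16E`.
  have hE1 : (p - q * c) ^ 2 ≤ E := by
    have : E = (p - q * c) ^ 2 + q ^ 2 * Real.sin θ ^ 2 := by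
      rw [hE, Real.sin_sq]; ring
    rw [this]; nlinarith [sq_nonneg (q * Real.sin θ)]
  have hE2 : (p - q) ^ 2 ≤ E := by
    rw [hE]
    have : 0 ≤ 2 * p * q * (1 - c) := mul_nonneg (by positivity) (by linarith)
    linarith
  have hp2 : p ^ 2 ≤ 1 := by nlinarith
  have e1 : ((1 + p ^ 2) * (p - q * c)) ^ 2 ≤ 4 * E := by
    rw [mul_pow]
    exact mul_le_mul (by nlinarith) hE1 (sq_nonneg _) (by norm_num)
  have e2 : (p * (q ^ 2 - p ^ 2)) ^ 2 ≤ 4 * E := by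
    have : (p * (q ^ 2 - p ^ 2)) ^ 2 = (p ^ 2 * (p + q) ^ 2) * (p - q) ^ 2 := by ring
    rw [this]
    refine mul_le_mul ?_ hE2 (sq_nonneg _) (by norm_num)
    calc p ^ 2 * (p + q) ^ 2 ≤ 1 * 2 ^ 2 := by gcongr; linarith
      _ = 4 := by norm_num
  have e3 : ((1 + p ^ 2) * (p - q * c) + p * (q ^ 2 - p ^ 2)) ^ 2 ≤ 16 * E := by
    nlinarith [sq_nonneg ((1 + p ^ 2) * (p - q * c) - p * (q ^ 2 - p ^ 2))]
  calc (2 * L * p) ^ 2 * _ ≤ (2 * L) ^ 2 * 1 * (16 * E) := by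
        rw [mul_pow]
        gcongr
    _ = 64 * L ^ 2 * E := by ring

/-- The quotient is `1 / (e^(-g) - 1)`, at most `1 / (-g)`. With `D` the denominator and `E` the
squared distance, `-g = L log (D / (D - E)) ≥ L E / D`, by `log x ≥ 1 - 1 / x`. -/
lemma exp_logCorrSq_div_le {L : ℝ} (hL : 0 < L) {s t : ℝ} (hs : s < 0) (ht : t < 0) {θ : ℝ}
    (h : s ≠ t ∨ Real.cos θ ≠ 1) :
    Real.exp (logCorrSq L s t θ) / (1 - Real.exp (logCorrSq L s t θ)) ≤
      den (s + t) θ / (L * ((Real.exp s - Real.exp t) ^ 2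
        + 2 * Real.exp s * Real.exp t * (1 - Real.cos θ))) := by
  have h1 := one_sub_exp_sq_pos hs
  have h2 := one_sub_exp_sq_pos ht
  have hD := den_pos (add_neg hs ht) θ
  have hg := logCorrSq_neg hL hs ht h
  set E := (Real.exp s - Real.exp t) ^ 2 + 2 * Real.exp s * Real.exp t * (1 - Real.cos θ) with hE
  have hDE := den_eq s t θ
  rw [← hE] at hDE
  set g := logCorrSq L s t θ with hgdef
  have hlog : E / den (s + t) θ * L ≤ -g := by
    have h3 := Real.one_sub_inv_le_log_of_pos
      (show 0 < den (s + t) θ / ((1 - Real.exp s ^ 2) * (1 - Real.exp t ^ 2)) by positivity)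
    rw [Real.log_div hD.ne' (by positivity), Real.log_mul h1.ne' h2.ne', inv_div] at h3
    have h4 : 1 - (1 - Real.exp s ^ 2) * (1 - Real.exp t ^ 2) / den (s + t) θ
        = E / den (s + t) θ := by
      field_simp
      linarith
    rw [h4] at h3
    calc _ ≤ _ := mul_le_mul_of_nonneg_right h3 hL.le
      _ = -g := by rw [hgdef, logCorrSq]; ring
  have hEpos : 0 < E := by
    by_contra hcon
    have h5 : den (s + t) θ ≤ (1 - Real.exp s ^ 2) * (1 - Real.exp t ^ 2) := by linarith
    have h6 := Real.log_le_log hD h5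
    rw [Real.log_mul h1.ne' h2.ne'] at h6
    have : 0 ≤ g := by
      rw [hgdef, logCorrSq]
      exact mul_nonneg hL.le (by linarith)
    linarith
  have h5 : Real.exp g / (1 - Real.exp g) = 1 / (Real.exp (-g) - 1) := by
    rw [Real.exp_neg]
    have := Real.exp_pos g
    field_simp
  have h6 : E / den (s + t) θ * L ≤ Real.exp (-g) - 1 := by
    have := Real.add_one_le_exp (-g)
    linarith
  rw [h5]
  calc 1 / (Real.exp (-g) - 1) ≤ 1 / (E / den (s + t) θ * L) :=
        one_div_le_one_div_of_le (by positivity) h6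
    _ = _ := by field_simp

/-- A bound for the covariance kernel which is uniform in the smaller radius. -/
def covBound (L t : ℝ) : ℝ :=
  (64 * L / (1 - Real.exp t ^ 2) ^ 2 + 4 * L) / (1 - Real.exp t) ^ 2

lemma abs_covKernel_le {L : ℝ} (hL : 0 < L) {s t : ℝ} (hst : s ≤ t) (ht : t < 0) (θ : ℝ) :
    |covKernel L s t θ| ≤ covBound L t := by
  have hs : s < 0 := hst.trans_lt ht
  have hp0 := Real.exp_pos s
  have hq0 := Real.exp_pos t
  have hq1 := Real.exp_lt_one_iff.2 ht
  have hpq := Real.exp_le_exp.2 hst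
  have h2 := one_sub_exp_sq_pos ht
  have hD := den_pos (add_neg hs ht) θ
  have hc1 := Real.cos_le_one θ
  have hc2 := Real.neg_one_le_cos θ
  by_cases h : s ≠ t ∨ Real.cos θ ≠ 1
  swap
  · push Not at h
    obtain ⟨rfl, hc⟩ := h
    -- When the two points coincide, the correlation is `1`, and the kernel takes the default value
    -- `0` of division by zero.
    have : logCorrSq L s s θ = 0 := by
      rw [logCorrSq, den_eq, hc, ← Real.log_mul h2.ne' h2.ne']
      simp
    rw [covKernel, this]
    simp only [Real.exp_zero, sub_self, div_zero, zero_mul, abs_zero, covBound]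
    have : 0 < 1 - Real.exp s := by linarith
    positivity
  have hfrac := exp_logCorrSq_div_le hL hs ht h
  have hg := logCorrSq_neg hL hs ht h
  have hfrac0 : 0 ≤ Real.exp (logCorrSq L s t θ) / (1 - Real.exp (logCorrSq L s t θ)) :=
    div_nonneg (Real.exp_nonneg _) (sub_nonneg.2 (Real.exp_le_one_iff.2 hg.le))
  have hd1 := logCorrSqDeriv_sq_le (L := L) hs ht θ
  have hd2 := logCorrSqDeriv_sq_le (L := L) ht hs θ
  rw [add_comm t s, show (Real.exp t - Real.exp s) ^ 2 + 2 * Real.exp t * Real.exp s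
    * (1 - Real.cos θ) = (Real.exp s - Real.exp t) ^ 2 + 2 * Real.exp s * Real.exp t
    * (1 - Real.cos θ) by ring] at hd2
  rw [covKernel, abs_mul, abs_of_nonneg hfrac0]
  have hsin : (L * (2 * Real.exp (s + t) * Real.sin θ / den (s + t) θ)) ^ 2
      ≤ 4 * L ^ 2 * ((Real.exp s - Real.exp t) ^ 2
        + 2 * Real.exp s * Real.exp t * (1 - Real.cos θ)) / den (s + t) θ ^ 2 := by
    rw [mul_pow, div_pow, ← mul_div_assoc]
    refine div_le_div_of_nonneg_right ?_ (by positivity)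
    rw [Real.exp_add, mul_pow _ (Real.sin θ), Real.sin_sq]
    have e1 : 0 < Real.exp s * Real.exp t := by positivity
    have e2 : Real.exp s * Real.exp t ≤ 1 := by nlinarith
    have e3 : 1 - Real.cos θ ^ 2 ≤ 2 * (1 - Real.cos θ) := by nlinarith
    have e4 : Real.exp s * Real.exp t * (Real.exp s * Real.exp t * (1 - Real.cos θ ^ 2))
        ≤ 1 * (Real.exp s * Real.exp t * (2 * (1 - Real.cos θ))) := by
      have : 0 ≤ 1 - Real.cos θ ^ 2 := by nlinarith
      gcongr
    have := sq_nonneg (Real.exp s - Real.exp t)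
    nlinarith [mul_nonneg (sq_nonneg L) this, mul_le_mul_of_nonneg_left e4 (sq_nonneg L)]
  set E := (Real.exp s - Real.exp t) ^ 2 + 2 * Real.exp s * Real.exp t * (1 - Real.cos θ) with hE
  have hE0 : 0 ≤ E := by
    rw [hE]
    have : 0 ≤ 1 - Real.cos θ := by linarith
    positivity
  set D := den (s + t) θ
  set b := 1 - Real.exp t ^ 2
  have hb1 : b ≤ 1 - Real.exp s ^ 2 := by
    have : Real.exp s ^ 2 ≤ Real.exp t ^ 2 := by gcongr
    simp only [b]; linarith
  have hd1' : logCorrSqDeriv L s t θ ^ 2 ≤ 64 * L ^ 2 * E / (b ^ 2 * D ^ 2) :=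
    hd1.trans (by gcongr)
  have habs : |logCorrSqDeriv L s t θ * logCorrSqDeriv L t s θ
      + (L * (2 * Real.exp (s + t) * Real.sin θ / D)) ^ 2|
      ≤ 64 * L ^ 2 * E / (b ^ 2 * D ^ 2) + 4 * L ^ 2 * E / D ^ 2 := by
    refine (abs_add_le _ _).trans (add_le_add ?_ ?_)
    · rw [abs_le]
      constructor <;> nlinarith [sq_nonneg (logCorrSqDeriv L s t θ + logCorrSqDeriv L t s θ),
        sq_nonneg (logCorrSqDeriv L s t θ - logCorrSqDeriv L t s θ)]
    · rw [abs_of_nonneg (sq_nonneg _)]; exact hsin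
  have hD1 : (1 - Real.exp t) ^ 2 ≤ D := by
    have : (1 - Real.exp t) ^ 2 ≤ (1 - Real.exp s * Real.exp t) ^ 2 := by
      have : Real.exp s * Real.exp t ≤ Real.exp t := by nlinarith
      gcongr
    refine this.trans ?_
    simp only [D, den, Real.exp_add]
    have : 0 ≤ (Real.exp s * Real.exp t) * (1 - Real.cos θ) := mul_nonneg (by positivity) (by linarith)
    nlinarith
  have hq2 : 0 < (1 - Real.exp t) ^ 2 := pow_pos (by linarith) 2
  -- The simple pole in `E` of the first factor cancels against the factor `E` bounding the second.
  calc _ ≤ D / (L * E) * (64 * L ^ 2 * E / (b ^ 2 * D ^ 2) + 4 * L ^ 2 * E / D ^ 2) :=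
        mul_le_mul hfrac habs (abs_nonneg _) (by positivity)
    _ = (E / E) * ((64 * L / b ^ 2 + 4 * L) / D) := by field_simp
    _ ≤ 1 * ((64 * L / b ^ 2 + 4 * L) / D) := by
        gcongr
        exact div_self_le_one E
    _ ≤ covBound L t := by
        rw [one_mul, covBound]
        gcongr

lemma norm_one_sub_sq_mul_exp (s θ : ℝ) :
    ‖1 - (Real.exp s : ℂ) ^ 2 * Complex.exp (θ * Complex.I)‖ ^ 2 = den (s + s) θ := by
  rw [← Complex.normSq_eq_norm_sq, Complex.normSq_apply, Complex.exp_mul_I, den, Real.exp_add,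
    ← Complex.ofReal_pow, ← Complex.ofReal_cos, ← Complex.ofReal_sin]
  have := Real.sin_sq_add_cos_sq θ
  generalize Real.exp s = p at *
  generalize Real.cos θ = c at *
  generalize Real.sin θ = d at *
  simp only [Complex.sub_re, Complex.sub_im, Complex.one_re, Complex.one_im,
    Complex.add_re, Complex.add_im, Complex.ofReal_re, Complex.ofReal_im,
    Complex.mul_re, Complex.mul_im, Complex.I_re, Complex.I_im]
  linear_combination (p ^ 4) * this

lemma cos_ne_one_of_mem_Icc {θ : ℝ} (hθ : θ ∈ Icc (-Real.pi) Real.pi) (h0 : θ ≠ 0) :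
    Real.cos θ ≠ 1 := by
  intro h
  have hp := Real.pi_pos
  exact h0 ((Real.cos_eq_one_iff_of_lt_of_lt (by linarith [hθ.1]) (by linarith [hθ.2])).1 h)

lemma exp_logCorrSq_self {L s : ℝ} (hs : s < 0) (θ : ℝ) :
    Real.exp (logCorrSq L s s θ) = (1 - Real.exp s ^ 2) ^ (2 * L) /
      ‖1 - (Real.exp s : ℂ) ^ 2 * Complex.exp (θ * Complex.I)‖ ^ (2 * L) := by
  have h1 := one_sub_exp_sq_pos hs
  have hD := den_pos (add_neg hs hs) θ
  have hn := norm_one_sub_sq_mul_exp s θ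
  set N := ‖1 - (Real.exp s : ℂ) ^ 2 * Complex.exp (θ * Complex.I)‖ with hN
  have hN0 : 0 < N := lt_of_le_of_ne (norm_nonneg _) fun h => by
    rw [← h] at hn; simp at hn; linarith
  rw [logCorrSq, ← hn, Real.log_pow, Real.rpow_def_of_pos h1, Real.rpow_def_of_pos hN0,
    ← Real.exp_sub]
  push_cast; ring_nf

/-- On the diagonal the covariance kernel is a multiple of the integrand of `I_L(r)`. -/
lemma covKernel_self {L : ℝ} {s : ℝ} (hs : s < 0) (θ : ℝ) :
    covKernel L s s θ = 4 * L ^ 2 * Real.exp s ^ 4 / (1 - Real.exp s ^ 2) ^ 2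
      * integrandI L (Real.exp s) θ := by
  have h1 := one_sub_exp_sq_pos hs
  have hD := den_pos (add_neg hs hs) θ
  have hn := norm_one_sub_sq_mul_exp s θ
  have hexp := exp_logCorrSq_self (L := L) hs θ
  rw [integrandI, covKernel, hexp, hn]
  set N := ‖1 - (Real.exp s : ℂ) ^ 2 * Complex.exp (θ * Complex.I)‖ with hN
  have hN0 : 0 < N := lt_of_le_of_ne (norm_nonneg _) fun h => by
    rw [← h] at hn; simp at hn; linarith
  have hb : 0 < N ^ (2 * L) := Real.rpow_pos_of_pos hN0 _
  have hfrac : (1 - Real.exp s ^ 2) ^ (2 * L) / N ^ (2 * L) /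
      (1 - (1 - Real.exp s ^ 2) ^ (2 * L) / N ^ (2 * L))
      = (1 - Real.exp s ^ 2) ^ (2 * L) / (N ^ (2 * L) - (1 - Real.exp s ^ 2) ^ (2 * L)) := by
    rw [div_div, mul_sub, mul_one, mul_div_cancel₀ _ hb.ne']
  rw [hfrac]
  have hpoly : logCorrSqDeriv L s s θ * logCorrSqDeriv L s s θ
      + (L * (2 * Real.exp (s + s) * Real.sin θ / den (s + s) θ)) ^ 2
      = 4 * L ^ 2 * Real.exp s ^ 4 / (1 - Real.exp s ^ 2) ^ 2
        * (2 * (1 - Real.cos θ) / den (s + s) θ) := by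
    rw [logCorrSqDeriv_eq L hs hs]
    have hsin := Real.sin_sq θ
    have h1' := h1.ne'
    have hD' := hD.ne'
    have hden : den (s + s) θ = 1 - 2 * Real.exp s ^ 2 * Real.cos θ + Real.exp s ^ 4 := by
      rw [den, Real.exp_add]; ring
    rw [Real.exp_add]
    generalize den (s + s) θ = D at *
    generalize Real.exp s = p at *
    field_simp
    rw [hsin, hden]
    ring
  rw [hpoly]
  ring

lemma integrandI_pos {L : ℝ} (hL : 0 < L) {s : ℝ} (hs : s < 0) {θ : ℝ}
    (hθ : θ ∈ Icc (-Real.pi) Real.pi) (h0 : θ ≠ 0) : 0 < integrandI L (Real.exp s) θ := by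
  have h1 := one_sub_exp_sq_pos hs
  have hD := den_pos (add_neg hs hs) θ
  have hn := norm_one_sub_sq_mul_exp s θ
  have hexp := exp_logCorrSq_self (L := L) hs θ
  have hc := cos_ne_one_of_mem_Icc hθ h0
  have hlt := Real.exp_lt_one_iff.2 (logCorrSq_neg hL hs hs (Or.inr hc))
  have hc1 : 0 < 1 - Real.cos θ := sub_pos.2 (lt_of_le_of_ne (Real.cos_le_one θ) hc)
  rw [integrandI, hn]
  rw [hexp] at hlt
  set N := ‖1 - (Real.exp s : ℂ) ^ 2 * Complex.exp (θ * Complex.I)‖ with hN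
  have hN0 : 0 < N := lt_of_le_of_ne (norm_nonneg _) fun h => by
    rw [← h] at hn; simp at hn; linarith
  have hb : 0 < N ^ (2 * L) := Real.rpow_pos_of_pos hN0 _
  rw [div_lt_one hb] at hlt
  have := Real.rpow_pos_of_pos h1 (2 * L)
  have h3 : 0 < N ^ (2 * L) - (1 - Real.exp s ^ 2) ^ (2 * L) := by linarith
  positivity

lemma measurable_covKernel (L s t : ℝ) : Measurable (covKernel L s t) := by
  unfold covKernel logCorrSq logCorrSqDeriv den
  fun_prop

lemma intervalIntegrable_covKernel {L : ℝ} (hL : 0 < L) {s t : ℝ} (hst : s ≤ t) (ht : t < 0)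
    (a b : ℝ) : IntervalIntegrable (covKernel L s t) volume a b := by
  refine (intervalIntegrable_const (c := covBound L t)).mono_fun
    (measurable_covKernel L s t).aestronglyMeasurable (ae_of_all _ fun θ => ?_)
  simp only [Real.norm_eq_abs]
  exact (abs_covKernel_le hL hst ht θ).trans (le_abs_self _)

/-- The integrand inherits the boundedness of the diagonal kernel, so its behaviour at `θ = 0` needs
no separate expansion. -/
lemma intervalIntegrable_integrandI {L : ℝ} (hL : 0 < L) {s : ℝ} (hs : s < 0) (a b : ℝ) :
    IntervalIntegrable (integrandI L (Real.exp s)) volume a b := by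
  have h1 := one_sub_exp_sq_pos hs
  have h2 : integrandI L (Real.exp s) = fun θ =>
      (4 * L ^ 2 * Real.exp s ^ 4 / (1 - Real.exp s ^ 2) ^ 2)⁻¹ * covKernel L s s θ := by
    funext θ
    rw [covKernel_self hs, inv_mul_cancel_left₀]
    positivity
  rw [h2]
  exact (intervalIntegrable_covKernel hL le_rfl hs a b).const_mul _

lemma tendsto_integral_covKernel {L : ℝ} (hL : 0 < L) {t : ℝ} (ht : t < 0) :
    Tendsto (fun s => ∫ θ in (-Real.pi)..Real.pi, covKernel L s t θ) (𝓝[<] t)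
      (𝓝 (∫ θ in (-Real.pi)..Real.pi, covKernel L t t θ)) := by
  have hpi := Real.pi_pos
  refine intervalIntegral.tendsto_integral_filter_of_dominated_convergence
    (fun _ => covBound L t) ?_ ?_ intervalIntegrable_const ?_
  · exact Eventually.of_forall fun s => (measurable_covKernel L s t).aestronglyMeasurable
  · filter_upwards [self_mem_nhdsWithin] with s hs
    exact ae_of_all _ fun θ _ => abs_covKernel_le hL (le_of_lt hs) ht θ
  -- The angle `0` is discarded: continuity of the kernel up to `s = t` requires `cos θ ≠ 1`.
  · filter_upwards [Measure.ae_ne volume (0 : ℝ)] with θ hθ hθ2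
    rw [uIoc_of_le (by linarith)] at hθ2
    have hc := cos_ne_one_of_mem_Icc (Ioc_subset_Icc_self hθ2) hθ
    have hcont : ContinuousOn (fun s => covKernel L s t θ) (Iio 0) :=
      continuousOn_covKernel hL (by fun_prop) (by fun_prop) (by fun_prop) (fun x hx => hx)
        (fun _ _ => ht) (fun _ _ => Or.inr hc)
    exact (hcont.continuousAt (Iio_mem_nhds ht)).tendsto.mono_left nhdsWithin_le_nhds

end

end HyperbolicGAF

/-! ### Moments of circle means and of zero counts. -/

namespace HyperbolicGAF

open Set Filter Topology ComplexConjugate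

noncomputable section

/-- If nonnegative functions converge pointwise to a function which dominates them, then their
integrals converge to its integral as soon as they converge. -/
lemma integrable_and_integral_eq_of_tendsto {Ω : Type*} [MeasurableSpace Ω] {μ : Measure Ω}
    {X : ℕ → Ω → ℝ} {Y : Ω → ℝ} {c : ℝ} (hX : ∀ n, Integrable (X n) μ)
    (h0 : ∀ n ω, 0 ≤ X n ω) (hle : ∀ n ω, X n ω ≤ Y ω)
    (hlim : ∀ ω, Tendsto (fun n => X n ω) atTop (𝓝 (Y ω)))
    (hc : Tendsto (fun n => ∫ ω, X n ω ∂μ) atTop (𝓝 c)) :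
    Integrable Y μ ∧ ∫ ω, Y ω ∂μ = c := by
  have hYm : AEStronglyMeasurable Y μ :=
    aestronglyMeasurable_of_tendsto_ae atTop (fun n => (hX n).aestronglyMeasurable)
      (ae_of_all _ hlim)
  have hY0 : ∀ ω, 0 ≤ Y ω := fun ω => (h0 0 ω).trans (hle 0 ω)
  -- Fatou's lemma yields integrability of `Y`, which then serves as the dominating function.
  have hfin : ∫⁻ ω, ENNReal.ofReal (Y ω) ∂μ ≤ ENNReal.ofReal c := by
    calc ∫⁻ ω, ENNReal.ofReal (Y ω) ∂μ
        = ∫⁻ ω, liminf (fun n => ENNReal.ofReal (X n ω)) atTop ∂μ := by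
          refine lintegral_congr fun ω => ?_
          exact ((ENNReal.continuous_ofReal.tendsto _).comp (hlim ω)).liminf_eq.symm
      _ ≤ liminf (fun n => ∫⁻ ω, ENNReal.ofReal (X n ω) ∂μ) atTop :=
          lintegral_liminf_le' fun n => (hX n).aemeasurable.ennreal_ofReal
      _ = liminf (fun n => ENNReal.ofReal (∫ ω, X n ω ∂μ)) atTop := by
          congr 1; funext n
          rw [ofReal_integral_eq_lintegral_ofReal (hX n) (ae_of_all _ (h0 n))]
      _ = ENNReal.ofReal c := ((ENNReal.continuous_ofReal.tendsto _).comp hc).liminf_eq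
  have hYi : Integrable Y μ := by
    refine ⟨hYm, ?_⟩
    rw [hasFiniteIntegral_iff_ofReal (ae_of_all _ hY0)]
    exact hfin.trans_lt ENNReal.ofReal_lt_top
  refine ⟨hYi, tendsto_nhds_unique ?_ hc⟩
  refine tendsto_integral_of_dominated_convergence Y (fun n => (hX n).aestronglyMeasurable) hYi
    (fun n => ae_of_all _ fun ω => ?_) (ae_of_all _ hlim)
  rw [Real.norm_of_nonneg (h0 n ω)]
  exact hle n ω

lemma integrable_prod_of_le {Ω Y : Type*} [MeasurableSpace Ω] [MeasurableSpace Y] {μ : Measure Ω}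
    [SFinite μ] {ν : Measure Y} [IsFiniteMeasure ν] {f : Ω × Y → ℝ} (hf : Measurable f) {C : ℝ}
    (hi : ∀ y, Integrable (fun ω => f (ω, y)) μ) (hC : ∀ y, ∫ ω, ‖f (ω, y)‖ ∂μ ≤ C) :
    Integrable f (μ.prod ν) := by
  rw [integrable_prod_iff' hf.aestronglyMeasurable]
  refine ⟨ae_of_all _ hi, ?_⟩
  refine (integrable_const C).mono' ?_ (ae_of_all _ fun y => ?_)
  · exact hf.norm.stronglyMeasurable.integral_prod_left'.aestronglyMeasurable
  · rw [Real.norm_of_nonneg (integral_nonneg fun _ => norm_nonneg _)]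
    exact hC y

lemma tendsto_backward_quotient {K : ℝ → ℝ} {K' s : ℝ} (h : HasDerivAt K K' s) :
    Tendsto (fun h => (K s - K (s - h)) / h) (𝓝[>] 0) (𝓝 K') := by
  have h1 := hasDerivAt_iff_tendsto_slope.1 h
  have h2 : Tendsto (fun h : ℝ => s - h) (𝓝[>] 0) (𝓝[≠] s) := by
    refine tendsto_nhdsWithin_iff.2 ⟨?_, ?_⟩
    · have : Tendsto (fun h : ℝ => s - h) (𝓝 0) (𝓝 (s - 0)) := Continuous.tendsto (by fun_prop) 0
      rw [sub_zero] at this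
      exact this.mono_left nhdsWithin_le_nhds
    · filter_upwards [self_mem_nhdsWithin] with x hx
      have : 0 < x := hx
      simp [this.ne']
  refine (h1.comp h2).congr' ?_
  filter_upwards [self_mem_nhdsWithin] with x hx
  have : 0 < x := hx
  simp only [Function.comp_apply, slope_def_field]
  rw [show s - x - s = -x by ring, div_neg, ← neg_div, neg_sub]

lemma logMeanCircle_eq_integral (f : ℂ → ℂ) (s : ℝ) :
    logMeanCircle f s = ∫ θ, Real.log ‖f (circleMap 0 (Real.exp s) θ)‖ ∂angleLaw := by
  rw [logMeanCircle, ← integral_angleLaw_circleMap]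

lemma norm_circleMap_exp (s θ : ℝ) : ‖circleMap 0 (Real.exp s) θ‖ = Real.exp s := by
  rw [norm_circleMap_zero, abs_of_pos (Real.exp_pos s)]

lemma corrSq_circleMap {L s t : ℝ} (hs : s < 0) (ht : t < 0) (α β : ℝ) :
    corrSq L (circleMap 0 (Real.exp s) α) (circleMap 0 (Real.exp t) β)
      = Real.exp (logCorrSq L s t (α - β)) := by
  have h1 := one_sub_exp_sq_pos hs
  have h2 := one_sub_exp_sq_pos ht
  have hD := den_pos (add_neg hs ht) (α - β)
  have h3 : ‖circleMap 0 (Real.exp s) α - circleMap 0 (Real.exp t) β‖ ^ 2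
      = (Real.exp s - Real.exp t) ^ 2 + 2 * Real.exp s * Real.exp t * (1 - Real.cos (α - β)) := by
    rw [← Complex.normSq_eq_norm_sq, Complex.normSq_apply, circleMap, circleMap,
      Complex.exp_mul_I, Complex.exp_mul_I, Real.cos_sub,
      ← Complex.ofReal_cos, ← Complex.ofReal_sin, ← Complex.ofReal_cos, ← Complex.ofReal_sin]
    have e1 := Real.sin_sq_add_cos_sq α
    have e2 := Real.sin_sq_add_cos_sq β
    generalize Real.exp s = p at *
    generalize Real.exp t = q at *
    generalize Real.cos α = c at *
    generalize Real.sin α = d at *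
    generalize Real.cos β = c' at *
    generalize Real.sin β = d' at *
    simp only [Complex.sub_re, Complex.sub_im, Complex.zero_re, Complex.zero_im,
      Complex.add_re, Complex.add_im, Complex.ofReal_re, Complex.ofReal_im,
      Complex.mul_re, Complex.mul_im, Complex.I_re, Complex.I_im]
    linear_combination (p ^ 2) * e1 + q ^ 2 * e2
  rw [corrSq, norm_one_sub_mul_conj_sq, h3, norm_circleMap_exp, norm_circleMap_exp, ← den_eq,
    Real.rpow_def_of_pos (by positivity), Real.log_div (by positivity) hD.ne',
    Real.log_mul h1.ne' h2.ne', logCorrSq]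
  congr 1
  ring

lemma circleMap_exp_ne {s t : ℝ} (hst : s ≠ t) (α β : ℝ) :
    circleMap 0 (Real.exp s) α ≠ circleMap 0 (Real.exp t) β := by
  intro h
  have := congrArg norm h
  rw [norm_circleMap_exp, norm_circleMap_exp] at this
  exact hst (Real.exp_injective this)

/-- The logarithmic derivative of `logSd`, which is the mean of the zero count. -/
def meanCount (L s : ℝ) : ℝ := L * Real.exp s ^ 2 / (1 - Real.exp s ^ 2)

lemma hasDerivAt_logSd (L : ℝ) {s : ℝ} (hs : s < 0) :
    HasDerivAt (fun s => logSd L (Real.exp s)) (meanCount L s) s := by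
  have h1 := one_sub_exp_sq_pos hs
  have e1 : HasDerivAt (fun s => Real.exp s ^ 2) (2 * Real.exp s ^ 2) s :=
    ((Real.hasDerivAt_exp s).pow 2).congr_deriv (by push_cast; ring)
  refine (((e1.const_sub 1).log h1.ne').const_mul (-(L / 2))).congr_deriv ?_
  rw [meanCount]; ring

/-- The mixed second moment of the circle means of `log |f_L|`. -/
def mixedMean (L s t : ℝ) : ℝ :=
  logSd L (Real.exp s) * logSd L (Real.exp t)
    + (logSd L (Real.exp s) + logSd L (Real.exp t)) * (logMean / 2)
    + corrMean L s t / (8 * Real.pi)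

/-- The derivative of `mixedMean` in its second variable. -/
def mixedMeanDeriv (L s t : ℝ) : ℝ :=
  (logSd L (Real.exp s) + logMean / 2) * meanCount L t + corrMeanDeriv L s t / (8 * Real.pi)

/-- The mixed second moment of the zero counts of two concentric discs. -/
def mixedCount (L s t : ℝ) : ℝ :=
  meanCount L s * meanCount L t
    + (∫ θ in (-Real.pi)..Real.pi, covKernel L s t θ) / (8 * Real.pi)

lemma hasDerivAt_mixedMean {L s t : ℝ} (hL : 0 < L) (hst : s < t) (ht : t < 0) :
    HasDerivAt (fun t => mixedMean L s t) (mixedMeanDeriv L s t) t := by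
  have h1 := hasDerivAt_logSd L ht
  have h2 := hasDerivAt_corrMean hL hst ht
  refine (((h1.const_mul (logSd L (Real.exp s))).add
    ((h1.const_add (logSd L (Real.exp s))).mul_const (logMean / 2))).add
    (h2.div_const (8 * Real.pi))).congr_deriv ?_
  rw [mixedMeanDeriv]; ring

lemma hasDerivAt_mixedMeanDeriv {L s t : ℝ} (hL : 0 < L) (hst : s < t) (ht : t < 0) :
    HasDerivAt (fun s => mixedMeanDeriv L s t) (mixedCount L s t) s := by
  have h1 := hasDerivAt_logSd L (hst.trans ht)
  have h2 := hasDerivAt_corrMeanDeriv hL hst ht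
  exact ((h1.add_const (logMean / 2)).mul_const (meanCount L t)).add (h2.div_const (8 * Real.pi))

lemma tendsto_mixedCount {L t : ℝ} (hL : 0 < L) (ht : t < 0) :
    Tendsto (fun s => mixedCount L s t) (𝓝[<] t) (𝓝 (mixedCount L t t)) := by
  have h1 : ContinuousAt (meanCount L) t := by
    have := (one_sub_exp_sq_pos ht).ne'
    unfold meanCount
    fun_prop (disch := assumption)
  exact ((h1.tendsto.mono_left nhdsWithin_le_nhds).mul_const _).add
    ((tendsto_integral_covKernel hL ht).div_const _)

section Random

variable {Ω : Type*} [MeasurableSpace Ω] {μ : Measure Ω} [IsProbabilityMeasure μ]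
  {a : ℕ → Ω → ℂ} {L : ℝ}

lemma norm_circleMap_exp_lt_one {s : ℝ} (hs : s < 0) (θ : ℝ) :
    ‖circleMap 0 (Real.exp s) θ‖ < 1 := by
  rw [norm_circleMap_exp]; exact Real.exp_lt_one_iff.2 hs

variable (ha : IsTame a) (hL : 0 < L)
include ha hL

lemma IsTame.measurable_log_circle {s : ℝ} (hs : s < 0) :
    Measurable fun p : Ω × ℝ =>
      Real.log ‖gaf L (fun n => a n p.1) (circleMap 0 (Real.exp s) p.2)‖ := by
  refine Real.measurable_log.comp (Measurable.norm ?_)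
  exact ha.measurable_gaf hL (g := fun p : Ω × ℝ => circleMap 0 (Real.exp s) p.2) measurable_fst
    (by unfold circleMap; fun_prop) fun p => norm_circleMap_exp_lt_one hs p.2

lemma IsTame.analyticOnNhd_gaf (ω : Ω) :
    AnalyticOnNhd ℂ (gaf L (fun n => a n ω)) (Metric.ball 0 1) := by
  obtain ⟨C, hC⟩ := ha.bound ω
  exact HyperbolicGAF.analyticOnNhd_gaf hL hC

lemma IsTame.gaf_zero_ne (ω : Ω) : gaf L (fun n => a n ω) 0 ≠ 0 := by
  rw [gaf_zero hL]; exact ha.ne_zero ω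

variable (ha_indep : iIndepFun a μ) (ha_law : ∀ n, HasLaw (a n) stdComplexNormal μ)
include ha_indep ha_law

lemma IsTame.integral_logMeanCircle {s : ℝ} (hs : s < 0) :
    Integrable (fun ω => logMeanCircle (gaf L (fun n => a n ω)) s) μ ∧
    ∫ ω, logMeanCircle (gaf L (fun n => a n ω)) s ∂μ = logSd L (Real.exp s) + logMean / 2 := by
  have hmem := fun θ => ha.memLp_log_gaf hL ha_indep ha_law (norm_circleMap_exp_lt_one hs θ)
  have hi : Integrable (fun p : Ω × ℝ =>
      Real.log ‖gaf L (fun n => a n p.1) (circleMap 0 (Real.exp s) p.2)‖) (μ.prod angleLaw) := by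
    -- The bound is uniform in the angle, since the law of `f_L(z)` depends only on `‖z‖`; it comes
    -- from `|x| ≤ 1 + x²`.
    refine integrable_prod_of_le (ha.measurable_log_circle hL hs)
      (C := 1 + ∫ x, Real.log ‖(Real.exp (logSd L (Real.exp s)) : ℂ) * x‖ ^ 2 ∂stdComplexNormal)
      (fun θ => (hmem θ).integrable (by norm_num)) fun θ => ?_
    have h2 := ha.integral_log_gaf_sq hL ha_indep ha_law (norm_circleMap_exp_lt_one hs θ)
    rw [norm_circleMap_exp] at h2
    rw [← h2]
    have h3 : ∫ _ : Ω, (1 : ℝ) ∂μ = 1 := by simp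
    nth_rewrite 1 [← h3]
    rw [← integral_add (integrable_const _) (hmem θ).integrable_sq]
    refine integral_mono ((hmem θ).integrable (by norm_num)).norm
      ((integrable_const _).add (hmem θ).integrable_sq) fun ω => ?_
    simp only [Real.norm_eq_abs]
    nlinarith [sq_nonneg (|Real.log ‖gaf L (fun n => a n ω) (circleMap 0 (Real.exp s) θ)‖| - 1),
      sq_abs (Real.log ‖gaf L (fun n => a n ω) (circleMap 0 (Real.exp s) θ)‖)]
  simp_rw [logMeanCircle_eq_integral]
  refine ⟨hi.integral_prod_left, ?_⟩
  rw [integral_integral_swap hi]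
  simp_rw [ha.integral_log_gaf hL ha_indep ha_law (norm_circleMap_exp_lt_one hs _),
    norm_circleMap_exp]
  simp

lemma IsTame.integrable_log_circle_mul {s t : ℝ} (hs : s < 0) (ht : t < 0) :
    Integrable (fun p : Ω × ℝ × ℝ =>
      Real.log ‖gaf L (fun n => a n p.1) (circleMap 0 (Real.exp s) p.2.1)‖ *
      Real.log ‖gaf L (fun n => a n p.1) (circleMap 0 (Real.exp t) p.2.2)‖)
      (μ.prod (angleLaw.prod angleLaw)) := by
  have hmem1 := fun θ => ha.memLp_log_gaf hL ha_indep ha_law (norm_circleMap_exp_lt_one hs θ)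
  have hmem2 := fun θ => ha.memLp_log_gaf hL ha_indep ha_law (norm_circleMap_exp_lt_one ht θ)
  have hm : ∀ {u : ℝ}, u < 0 → ∀ g : Ω × ℝ × ℝ → ℝ, Measurable g →
      Measurable fun p : Ω × ℝ × ℝ =>
        Real.log ‖gaf L (fun n => a n p.1) (circleMap 0 (Real.exp u) (g p))‖ := by
    intro u hu g hg
    refine Real.measurable_log.comp (Measurable.norm ?_)
    exact ha.measurable_gaf hL (g := fun p : Ω × ℝ × ℝ => circleMap 0 (Real.exp u) (g p))
      measurable_fst (by unfold circleMap; fun_prop) fun p => norm_circleMap_exp_lt_one hu (g p)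
  refine integrable_prod_of_le
    (C := (∫ x, Real.log ‖(Real.exp (logSd L (Real.exp s)) : ℂ) * x‖ ^ 2 ∂stdComplexNormal)
      + ∫ x, Real.log ‖(Real.exp (logSd L (Real.exp t)) : ℂ) * x‖ ^ 2 ∂stdComplexNormal)
    ?_ (fun θ => (hmem1 θ.1).integrable_mul (hmem2 θ.2)) fun θ => ?_
  · exact hm hs (fun p : Ω × ℝ × ℝ => p.2.1) (by fun_prop) |>.mul
      (hm ht (fun p : Ω × ℝ × ℝ => p.2.2) (by fun_prop))
  · have h1 := ha.integral_log_gaf_sq hL ha_indep ha_law (norm_circleMap_exp_lt_one hs θ.1)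
    have h2 := ha.integral_log_gaf_sq hL ha_indep ha_law (norm_circleMap_exp_lt_one ht θ.2)
    rw [norm_circleMap_exp] at h1 h2
    rw [← h1, ← h2, ← integral_add (hmem1 θ.1).integrable_sq (hmem2 θ.2).integrable_sq]
    refine integral_mono ((hmem1 θ.1).integrable_mul (hmem2 θ.2)).norm
      ((hmem1 θ.1).integrable_sq.add (hmem2 θ.2).integrable_sq) fun ω => ?_
    simp only [Real.norm_eq_abs]
    rw [abs_le]
    generalize Real.log ‖gaf L (fun n => a n ω) (circleMap 0 (Real.exp s) θ.1)‖ = x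
    generalize Real.log ‖gaf L (fun n => a n ω) (circleMap 0 (Real.exp t) θ.2)‖ = y
    constructor <;> nlinarith [sq_nonneg (x + y), sq_nonneg (x - y)]

lemma IsTame.integral_logMeanCircle_mul {s t : ℝ} (hs : s < 0) (ht : t < 0) :
    Integrable (fun ω => logMeanCircle (gaf L (fun n => a n ω)) s
      * logMeanCircle (gaf L (fun n => a n ω)) t) μ ∧
    (s ≠ t → ∫ ω, logMeanCircle (gaf L (fun n => a n ω)) s
      * logMeanCircle (gaf L (fun n => a n ω)) t ∂μ = mixedMean L s t) := by
  have hi := ha.integrable_log_circle_mul hL ha_indep ha_law hs ht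
  have heq : ∀ ω, logMeanCircle (gaf L (fun n => a n ω)) s
      * logMeanCircle (gaf L (fun n => a n ω)) t
      = ∫ p : ℝ × ℝ, Real.log ‖gaf L (fun n => a n ω) (circleMap 0 (Real.exp s) p.1)‖ *
          Real.log ‖gaf L (fun n => a n ω) (circleMap 0 (Real.exp t) p.2)‖
          ∂(angleLaw.prod angleLaw) := by
    intro ω
    rw [logMeanCircle_eq_integral, logMeanCircle_eq_integral]
    exact (integral_prod_mul
      (fun α => Real.log ‖gaf L (fun n => a n ω) (circleMap 0 (Real.exp s) α)‖)
      (fun β => Real.log ‖gaf L (fun n => a n ω) (circleMap 0 (Real.exp t) β)‖)).symm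
  simp_rw [heq]
  refine ⟨hi.integral_prod_left, fun hst => ?_⟩
  rw [integral_integral_swap hi]
  have hj := hi.integral_prod_right
  have hval : ∀ p : ℝ × ℝ,
      ∫ ω, Real.log ‖gaf L (fun n => a n ω) (circleMap 0 (Real.exp s) p.1)‖ *
          Real.log ‖gaf L (fun n => a n ω) (circleMap 0 (Real.exp t) p.2)‖ ∂μ
      = logSd L (Real.exp s) * logSd L (Real.exp t)
        + (logSd L (Real.exp s) + logSd L (Real.exp t)) * (logMean / 2)
        + logCorr (Real.exp (logCorrSq L s t (p.1 - p.2))) / 4 := by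
    intro p
    rw [ha.integral_log_gaf_mul hL ha_indep ha_law (norm_circleMap_exp_lt_one hs _)
      (norm_circleMap_exp_lt_one ht _) (circleMap_exp_ne hst _ _), norm_circleMap_exp,
      norm_circleMap_exp, corrSq_circleMap hs ht]
  simp_rw [hval] at hj ⊢
  rw [integral_prod _ hj]
  have hcont := continuous_logCorr_logCorrSq hL hs ht hst
  have hper : Function.Periodic (fun θ => logCorr (Real.exp (logCorrSq L s t θ)))
      (2 * Real.pi) := by
    intro θ
    simp only [logCorrSq, den, Real.cos_add_two_pi]
  -- By periodicity, the mean over `β` of a function of `α - β` does not depend on `α`.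
  have hinner : ∀ α, ∫ β, (logSd L (Real.exp s) * logSd L (Real.exp t)
        + (logSd L (Real.exp s) + logSd L (Real.exp t)) * (logMean / 2)
        + logCorr (Real.exp (logCorrSq L s t (α - β))) / 4) ∂angleLaw = mixedMean L s t := by
    intro α
    have hpi := Real.pi_pos
    have hc : Continuous fun β => logCorr (Real.exp (logCorrSq L s t (α - β))) / 4 :=
      (hcont.comp (by fun_prop : Continuous fun β => α - β)).div_const 4
    rw [integral_angleLaw, intervalIntegral.integral_add intervalIntegrable_const
      (hc.intervalIntegrable _ _), intervalIntegral.integral_const, intervalIntegral.integral_div,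
      intervalIntegral.integral_comp_sub_left (fun θ => logCorr (Real.exp (logCorrSq L s t θ)))]
    have h1 := hper.intervalIntegral_add_eq (α - Real.pi) (-Real.pi)
    rw [show α - Real.pi + 2 * Real.pi = α - -Real.pi by ring,
      show -Real.pi + 2 * Real.pi = Real.pi by ring] at h1
    rw [h1, mixedMean, corrMean, smul_eq_mul]
    field_simp
    ring
  simp_rw [hinner]
  simp

/-- The mean of the zero count. -/
lemma IsTame.integral_diskCount {t : ℝ} (ht : t < 0) :
    Integrable (fun ω => diskCount (gaf L (fun n => a n ω)) t) μ ∧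
    ∫ ω, diskCount (gaf L (fun n => a n ω)) t ∂μ = meanCount L t := by
  have hseq : Tendsto (fun n : ℕ => 1 / ((n : ℝ) + 1)) atTop (𝓝[>] 0) :=
    tendsto_nhdsWithin_iff.2 ⟨tendsto_one_div_add_atTop_nhds_zero_nat,
      Eventually.of_forall fun n => mem_Ioi.2 (by positivity)⟩
  have hpos : ∀ n : ℕ, 0 < 1 / ((n : ℝ) + 1) := fun n => by positivity
  have hM := fun s hs => ha.integral_logMeanCircle hL ha_indep ha_law (s := s) hs
  refine integrable_and_integral_eq_of_tendsto
    (X := fun n ω => (logMeanCircle (gaf L (fun n => a n ω)) t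
      - logMeanCircle (gaf L (fun n => a n ω)) (t - 1 / ((n : ℝ) + 1))) / (1 / ((n : ℝ) + 1)))
    (fun n => ?_) (fun n ω => ?_) (fun n ω => ?_) (fun ω => ?_) ?_
  · exact ((hM t ht).1.sub (hM _ (by linarith [hpos n])).1).div_const _
  · exact logMeanCircle_sub_nonneg (ha.analyticOnNhd_gaf hL ω) (ha.gaf_zero_ne hL ω) ht (hpos n)
  · exact logMeanCircle_sub_le (ha.analyticOnNhd_gaf hL ω) (ha.gaf_zero_ne hL ω) ht (hpos n)
  · exact (tendsto_logMeanCircle_sub (ha.analyticOnNhd_gaf hL ω) (ha.gaf_zero_ne hL ω) ht).comp hseq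
  · refine ((tendsto_backward_quotient (hasDerivAt_logSd L ht)).comp hseq).congr fun n => ?_
    have hn : t - 1 / ((n : ℝ) + 1) < 0 := by linarith [hpos n]
    rw [integral_div, integral_sub (hM t ht).1 (hM _ hn).1, (hM t ht).2, (hM _ hn).2]
    simp only [Function.comp_apply]
    congr 1
    ring

/-- The two derivatives are taken one after the other. Here the quotient in the smaller radius is
frozen and only the larger radius is differentiated; nonnegativity of the frozen factor preserves
the domination. -/
lemma IsTame.integral_quotient_mul_diskCount {s t h : ℝ} (hst : s < t) (ht : t < 0) (hh : 0 < h) :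
    Integrable (fun ω => (logMeanCircle (gaf L (fun n => a n ω)) s
      - logMeanCircle (gaf L (fun n => a n ω)) (s - h)) / h
      * diskCount (gaf L (fun n => a n ω)) t) μ ∧
    ∫ ω, (logMeanCircle (gaf L (fun n => a n ω)) s
      - logMeanCircle (gaf L (fun n => a n ω)) (s - h)) / h
      * diskCount (gaf L (fun n => a n ω)) t ∂μ
      = (mixedMeanDeriv L s t - mixedMeanDeriv L (s - h) t) / h := by
  have hs : s < 0 := hst.trans ht
  have hsh : s - h < 0 := by linarith
  -- The step never exceeds `(t - s) / 2`, so `t - k n` stays above `s` and the formula for distinct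
  -- radii applies throughout.
  set k : ℕ → ℝ := fun n => (t - s) / 2 * (1 / ((n : ℝ) + 1)) with hk
  have hpos : ∀ n : ℕ, 0 < k n := fun n => by
    have : 0 < t - s := by linarith
    rw [hk]; positivity
  have hlt : ∀ n : ℕ, s < t - k n := fun n => by
    have h1 : 0 < t - s := by linarith
    have h2 : 1 / ((n : ℝ) + 1) ≤ 1 := by
      rw [div_le_one (by positivity)]; linarith [Nat.cast_nonneg (α := ℝ) n]
    have h3 : k n ≤ (t - s) / 2 * 1 := mul_le_mul_of_nonneg_left h2 (by linarith)
    linarith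
  have hseq : Tendsto k atTop (𝓝[>] 0) := by
    refine tendsto_nhdsWithin_iff.2 ⟨?_, Eventually.of_forall fun n => mem_Ioi.2 (hpos n)⟩
    have := (tendsto_one_div_add_atTop_nhds_zero_nat (𝕜 := ℝ)).const_mul ((t - s) / 2)
    rwa [mul_zero] at this
  have hM := fun s t hs ht =>
    ha.integral_logMeanCircle_mul hL ha_indep ha_law (s := s) (t := t) hs ht
  have hA0 := fun ω => logMeanCircle_sub_nonneg (ha.analyticOnNhd_gaf hL ω)
    (ha.gaf_zero_ne hL ω) hs hh
  have hexp : ∀ n, (fun ω => (logMeanCircle (gaf L (fun n => a n ω)) s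
      - logMeanCircle (gaf L (fun n => a n ω)) (s - h)) / h *
      ((logMeanCircle (gaf L (fun n => a n ω)) t
        - logMeanCircle (gaf L (fun n => a n ω)) (t - k n)) / k n))
      = fun ω => ((logMeanCircle (gaf L (fun n => a n ω)) s
          * logMeanCircle (gaf L (fun n => a n ω)) t
        - logMeanCircle (gaf L (fun n => a n ω)) s
          * logMeanCircle (gaf L (fun n => a n ω)) (t - k n))
        - (logMeanCircle (gaf L (fun n => a n ω)) (s - h)
          * logMeanCircle (gaf L (fun n => a n ω)) t
        - logMeanCircle (gaf L (fun n => a n ω)) (s - h)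
          * logMeanCircle (gaf L (fun n => a n ω)) (t - k n))) / (h * k n) := by
    intro n
    funext ω
    have := (hpos n).ne'
    field_simp
  have htk : ∀ n, t - k n < 0 := fun n => by linarith [hpos n]
  have i1 : ∀ n, Integrable (fun ω => logMeanCircle (gaf L (fun n => a n ω)) s
          * logMeanCircle (gaf L (fun n => a n ω)) t
        - logMeanCircle (gaf L (fun n => a n ω)) s
          * logMeanCircle (gaf L (fun n => a n ω)) (t - k n)) μ :=
    fun n => (hM s t hs ht).1.sub (hM s (t - k n) hs (htk n)).1
  have i2 : ∀ n, Integrable (fun ω => logMeanCircle (gaf L (fun n => a n ω)) (s - h)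
          * logMeanCircle (gaf L (fun n => a n ω)) t
        - logMeanCircle (gaf L (fun n => a n ω)) (s - h)
          * logMeanCircle (gaf L (fun n => a n ω)) (t - k n)) μ :=
    fun n => (hM (s - h) t hsh ht).1.sub (hM (s - h) (t - k n) hsh (htk n)).1
  refine integrable_and_integral_eq_of_tendsto
    (X := fun n ω => (logMeanCircle (gaf L (fun n => a n ω)) s
      - logMeanCircle (gaf L (fun n => a n ω)) (s - h)) / h *
      ((logMeanCircle (gaf L (fun n => a n ω)) t
        - logMeanCircle (gaf L (fun n => a n ω)) (t - k n)) / k n))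
    (fun n => ?_) (fun n ω => ?_) (fun n ω => ?_) (fun ω => ?_) ?_
  · rw [hexp]
    exact ((i1 n).sub (i2 n)).div_const _
  · exact mul_nonneg (hA0 ω) (logMeanCircle_sub_nonneg (ha.analyticOnNhd_gaf hL ω)
      (ha.gaf_zero_ne hL ω) ht (hpos n))
  · exact mul_le_mul_of_nonneg_left (logMeanCircle_sub_le (ha.analyticOnNhd_gaf hL ω)
      (ha.gaf_zero_ne hL ω) ht (hpos n)) (hA0 ω)
  · exact ((tendsto_logMeanCircle_sub (ha.analyticOnNhd_gaf hL ω)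
      (ha.gaf_zero_ne hL ω) ht).comp hseq).const_mul _
  · have h1 := (tendsto_backward_quotient (hasDerivAt_mixedMean hL hst ht)).comp hseq
    have h2 := (tendsto_backward_quotient
      (hasDerivAt_mixedMean hL (show s - h < t by linarith) ht)).comp hseq
    refine ((h1.sub h2).div_const h).congr fun n => ?_
    rw [hexp, integral_div, integral_sub (i1 n) (i2 n),
      integral_sub (hM s t hs ht).1 (hM s (t - k n) hs (htk n)).1,
      integral_sub (hM (s - h) t hsh ht).1 (hM (s - h) (t - k n) hsh (htk n)).1,
      (hM s t hs ht).2 hst.ne, (hM s (t - k n) hs (htk n)).2 (hlt n).ne,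
      (hM (s - h) t hsh ht).2 (by linarith), (hM (s - h) (t - k n) hsh (htk n)).2
        (by linarith [hlt n])]
    have := (hpos n).ne'
    simp only [Function.comp_apply]
    field_simp

/-- The mixed second moment of the zero counts of two distinct concentric discs. -/
lemma IsTame.integral_diskCount_mul {s t : ℝ} (hst : s < t) (ht : t < 0) :
    Integrable (fun ω => diskCount (gaf L (fun n => a n ω)) s
      * diskCount (gaf L (fun n => a n ω)) t) μ ∧
    ∫ ω, diskCount (gaf L (fun n => a n ω)) s * diskCount (gaf L (fun n => a n ω)) t ∂μ
      = mixedCount L s t := by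
  have hs : s < 0 := hst.trans ht
  have hseq : Tendsto (fun n : ℕ => 1 / ((n : ℝ) + 1)) atTop (𝓝[>] 0) :=
    tendsto_nhdsWithin_iff.2 ⟨tendsto_one_div_add_atTop_nhds_zero_nat,
      Eventually.of_forall fun n => mem_Ioi.2 (by positivity)⟩
  have hpos : ∀ n : ℕ, 0 < 1 / ((n : ℝ) + 1) := fun n => by positivity
  have hQ := fun h hh =>
    ha.integral_quotient_mul_diskCount hL ha_indep ha_law hst ht (h := h) hh
  refine integrable_and_integral_eq_of_tendsto
    (X := fun n ω => (logMeanCircle (gaf L (fun n => a n ω)) s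
      - logMeanCircle (gaf L (fun n => a n ω)) (s - 1 / ((n : ℝ) + 1))) / (1 / ((n : ℝ) + 1))
      * diskCount (gaf L (fun n => a n ω)) t)
    (fun n => (hQ _ (hpos n)).1) (fun n ω => ?_) (fun n ω => ?_) (fun ω => ?_) ?_
  · exact mul_nonneg (logMeanCircle_sub_nonneg (ha.analyticOnNhd_gaf hL ω)
      (ha.gaf_zero_ne hL ω) hs (hpos n)) (diskCount_nonneg t)
  · exact mul_le_mul_of_nonneg_right (logMeanCircle_sub_le (ha.analyticOnNhd_gaf hL ω)
      (ha.gaf_zero_ne hL ω) hs (hpos n)) (diskCount_nonneg t)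
  · exact ((tendsto_logMeanCircle_sub (ha.analyticOnNhd_gaf hL ω)
      (ha.gaf_zero_ne hL ω) hs).comp hseq).mul_const _
  · refine ((tendsto_backward_quotient (hasDerivAt_mixedMeanDeriv hL hst ht)).comp hseq).congr
      fun n => ?_
    rw [(hQ _ (hpos n)).2]
    rfl

/-- The second moment of the zero count. -/
lemma IsTame.integral_diskCount_sq {t : ℝ} (ht : t < 0) :
    Integrable (fun ω => diskCount (gaf L (fun n => a n ω)) t ^ 2) μ ∧
    ∫ ω, diskCount (gaf L (fun n => a n ω)) t ^ 2 ∂μ = mixedCount L t t := by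
  have hpos : ∀ n : ℕ, 0 < 1 / ((n : ℝ) + 1) := fun n => by positivity
  have hseq : Tendsto (fun n : ℕ => t - 1 / ((n : ℝ) + 1)) atTop (𝓝[<] t) := by
    refine tendsto_nhdsWithin_iff.2 ⟨?_, Eventually.of_forall fun n => mem_Iio.2 ?_⟩
    · simpa using tendsto_one_div_add_atTop_nhds_zero_nat.const_sub t
    · linarith [hpos n]
  have hlt : ∀ n : ℕ, t - 1 / ((n : ℝ) + 1) < t := fun n => by linarith [hpos n]
  have hQ := fun s hs => ha.integral_diskCount_mul hL ha_indep ha_law (s := s) hs ht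
  refine integrable_and_integral_eq_of_tendsto
    (X := fun n ω => diskCount (gaf L (fun n => a n ω)) (t - 1 / ((n : ℝ) + 1))
      * diskCount (gaf L (fun n => a n ω)) t)
    (fun n => (hQ _ (hlt n)).1) (fun n ω => ?_) (fun n ω => ?_) (fun ω => ?_) ?_
  · exact mul_nonneg (diskCount_nonneg _) (diskCount_nonneg _)
  · rw [sq]
    exact mul_le_mul_of_nonneg_right (diskCount_mono (ha.analyticOnNhd_gaf hL ω)
      (ha.gaf_zero_ne hL ω) ht (hlt n).le) (diskCount_nonneg t)
  · rw [sq]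
    exact ((tendsto_diskCount (ha.analyticOnNhd_gaf hL ω)
      (ha.gaf_zero_ne hL ω) ht).comp hseq).mul_const _
  · refine ((tendsto_mixedCount hL ht).comp hseq).congr fun n => ?_
    rw [(hQ _ (hlt n)).2]
    rfl

/-- The variance of the zero count for tame coefficients. -/
theorem IsTame.variance_diskCount {t : ℝ} (ht : t < 0) :
    MemLp (fun ω => diskCount (gaf L (fun n => a n ω)) t) 2 μ ∧
    variance (fun ω => diskCount (gaf L (fun n => a n ω)) t) μ
      = L ^ 2 * Real.exp t ^ 4 / (2 * Real.pi * (1 - Real.exp t ^ 2) ^ 2)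
        * integralI L (Real.exp t) := by
  obtain ⟨h1, h2⟩ := ha.integral_diskCount hL ha_indep ha_law ht
  obtain ⟨h3, h4⟩ := ha.integral_diskCount_sq hL ha_indep ha_law ht
  have hmem : MemLp (fun ω => diskCount (gaf L (fun n => a n ω)) t) 2 μ :=
    (memLp_two_iff_integrable_sq h1.aestronglyMeasurable).2 h3
  refine ⟨hmem, ?_⟩
  rw [variance_eq_sub hmem, h2]
  have h5 : ∫ ω, ((fun ω => diskCount (gaf L (fun n => a n ω)) t) ^ 2) ω ∂μ = mixedCount L t t := h4
  rw [h5, mixedCount, integralI]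
  simp_rw [covKernel_self ht]
  rw [intervalIntegral.integral_const_mul]
  have := one_sub_exp_sq_pos ht
  have hpi := Real.pi_pos
  field_simp
  ring

end Random

end

end HyperbolicGAF

/-! ### Almost sure growth of the coefficients and the tame modification. -/

namespace HyperbolicGAF

open Set Filter Topology ComplexConjugate

noncomputable section

lemma integrable_sq_norm_stdComplexNormal :
    Integrable (fun z : ℂ => ‖z‖ ^ 2) stdComplexNormal := by
  have h : Integrable id expLaw := by
    refine integrable_expLaw_iff.2 ?_
    refine (integrableOn_exp_neg_mul_rpow (s := 1) (by norm_num)).congr_fun (fun x _ => ?_)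
      measurableSet_Ioi
    simp
  rw [← map_sq_norm_stdComplexNormal] at h
  exact h.comp_measurable (by fun_prop)

section Modification

variable {Ω : Type*} [MeasurableSpace Ω] {μ : Measure Ω} {a : ℕ → Ω → ℂ}

/-- Standard complex normal variables almost surely grow at most linearly. -/
lemma ae_exists_norm_le (ha_law : ∀ n, HasLaw (a n) stdComplexNormal μ) :
    ∀ᵐ ω ∂μ, ∃ C : ℝ, ∀ n : ℕ, ‖a n ω‖ ≤ C * (n + 1) := by
  set c : ℝ≥0∞ := ∫⁻ z, ‖z‖ₑ ^ 2 ∂stdComplexNormal with hc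
  have hcfin : c ≠ ∞ := by
    have h := integrable_sq_norm_stdComplexNormal.hasFiniteIntegral
    refine ne_of_lt (lt_of_eq_of_lt ?_ h)
    refine lintegral_congr fun z => ?_
    rw [enorm_pow, enorm_norm]
  have hm : ∀ n, AEMeasurable (fun ω => ‖a n ω‖ₑ ^ 2 * ENNReal.ofReal (1 / ((n : ℝ) + 1) ^ 2)) μ :=
    fun n => ((ha_law n).aemeasurable.enorm.pow_const 2).mul_const _
  have hn : ∀ n, ∫⁻ ω, ‖a n ω‖ₑ ^ 2 * ENNReal.ofReal (1 / ((n : ℝ) + 1) ^ 2) ∂μ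
      = c * ENNReal.ofReal (1 / ((n : ℝ) + 1) ^ 2) := by
    intro n
    rw [lintegral_mul_const'' _ ((ha_law n).aemeasurable.enorm.pow_const 2), hc,
      ← (ha_law n).map_eq, lintegral_map' (by fun_prop) (ha_law n).aemeasurable]
  have hsum : Summable fun n : ℕ => 1 / ((n : ℝ) + 1) ^ 2 := by
    have := (summable_nat_add_iff 1).2 (Real.summable_one_div_nat_pow.2 (one_lt_two))
    simpa using this
  -- The weighted sum of `|a n|² / (n + 1)²` has finite mean, hence is almost surely finite. Each of
  -- its terms is at most the sum `T`, so `√T` serves as the growth constant.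
  have hfin : ∫⁻ ω, ∑' n : ℕ, ‖a n ω‖ₑ ^ 2 * ENNReal.ofReal (1 / ((n : ℝ) + 1) ^ 2) ∂μ ≠ ∞ := by
    rw [lintegral_tsum hm]
    simp_rw [hn]
    rw [ENNReal.tsum_mul_left]
    exact ENNReal.mul_ne_top hcfin hsum.tsum_ofReal_ne_top
  filter_upwards [ae_lt_top' (AEMeasurable.tsum hm) hfin] with ω hω
  set T := ∑' n : ℕ, ‖a n ω‖ₑ ^ 2 * ENNReal.ofReal (1 / ((n : ℝ) + 1) ^ 2)
  refine ⟨Real.sqrt T.toReal, fun n => ?_⟩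
  have h1 : ‖a n ω‖ₑ ^ 2 * ENNReal.ofReal (1 / ((n : ℝ) + 1) ^ 2) ≤ T := ENNReal.le_tsum n
  have h2 := ENNReal.toReal_mono hω.ne h1
  rw [ENNReal.toReal_mul, ENNReal.toReal_pow, toReal_enorm,
    ENNReal.toReal_ofReal (by positivity), mul_one_div, div_le_iff₀ (by positivity)] at h2
  rw [← Real.sqrt_sq (norm_nonneg (a n ω)), ← Real.sqrt_sq (by positivity : (0 : ℝ) ≤ n + 1),
    ← Real.sqrt_mul ENNReal.toReal_nonneg]
  exact Real.sqrt_le_sqrt h2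

/-- Standard complex normal variables agree almost surely with a tame sequence. -/
lemma exists_isTame (ha_law : ∀ n, HasLaw (a n) stdComplexNormal μ) :
    ∃ b : ℕ → Ω → ℂ, IsTame b ∧ ∀ᵐ ω ∂μ, ∀ n, b n ω = a n ω := by
  have h0 : ∀ᵐ ω ∂μ, a 0 ω ≠ 0 := by
    have := ae_ne_zero_stdComplexNormal
    rw [← (ha_law 0).map_eq] at this
    exact ae_of_ae_map (ha_law 0).aemeasurable this
  have hmk : ∀ᵐ ω ∂μ, ∀ n, a n ω = (ha_law n).aemeasurable.mk (a n) ω :=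
    ae_all_iff.2 fun n => (ha_law n).aemeasurable.ae_eq_mk
  obtain ⟨N, hN, hNm, hN0⟩ := exists_measurable_superset_of_null
    (ae_iff.1 ((ae_exists_norm_le ha_law).and (h0.and hmk)))
  have hgood : ∀ ω, ω ∉ N → (∃ C : ℝ, ∀ n : ℕ, ‖a n ω‖ ≤ C * (n + 1)) ∧ a 0 ω ≠ 0 ∧
      ∀ n, a n ω = (ha_law n).aemeasurable.mk (a n) ω := fun ω hω => by
    by_contra h
    exact hω (hN h)
  classical
  -- On the exceptional null set all coefficients are set to `1`, a bounded sequence with nonzero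
  -- first term.
  refine ⟨fun n => N.piecewise (fun _ => 1) ((ha_law n).aemeasurable.mk (a n)),
    ⟨fun n => ?_, fun ω => ?_, fun ω => ?_⟩, ?_⟩
  · exact measurable_const.piecewise hNm (ha_law n).aemeasurable.measurable_mk
  · by_cases hω : ω ∈ N
    · refine ⟨1, fun n => ?_⟩
      simp [hω]
    · obtain ⟨⟨C, hC⟩, -, h⟩ := hgood ω hω
      refine ⟨C, fun n => ?_⟩
      simpa [hω, ← h n] using hC n
  · by_cases hω : ω ∈ N
    · simp [hω]
    · obtain ⟨-, h0, h⟩ := hgood ω hω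
      simpa [hω, ← h 0] using h0
  · filter_upwards [measure_eq_zero_iff_ae_notMem.1 hN0] with ω hω n
    simp [hω, (hgood ω hω).2.2 n]

end Modification

end

end HyperbolicGAF

/-! ### Transfer from tame coefficients to the given ones. -/

theorem lemma2p2 {Ω : Type*} [MeasurableSpace Ω] (μ : Measure Ω) [IsProbabilityMeasure μ]
    (a : ℕ → Ω → ℂ) (ha_indep : iIndepFun a μ)
    (ha_law : ∀ n, HasLaw (a n) HyperbolicGAF.stdComplexNormal μ)
    (L : ℝ) (hL : 0 < L) (r : ℝ) (hr0 : 0 < r) (hr1 : r < 1) :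
    -- the random series converges on the unit disc, and `n_L(r)` is finite, almost surely
    (∀ᵐ ω ∂μ, ∀ z ∈ Metric.ball (0 : ℂ) 1,
      Summable (HyperbolicGAF.gafTerm L (fun n => a n ω) z)) ∧
    (∀ᵐ ω ∂μ, HyperbolicGAF.zeroCount L (fun n => a n ω) r < ∞) ∧
    -- `n_L(r)` is a square-integrable random variable
    MemLp (fun ω => (HyperbolicGAF.zeroCount L (fun n => a n ω) r).toReal) 2 μ ∧
    -- the integrand of `I_L(r)` is positive away from its removable singularity, and integrable
    (∀ θ ∈ Set.Icc (-Real.pi) Real.pi, θ ≠ 0 → 0 < HyperbolicGAF.integrandI L r θ) ∧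
    IntervalIntegrable (HyperbolicGAF.integrandI L r) volume (-Real.pi) Real.pi ∧
    -- the variance formula
    variance (fun ω => (HyperbolicGAF.zeroCount L (fun n => a n ω) r).toReal) μ =
      L ^ 2 * r ^ 4 / (2 * Real.pi * (1 - r ^ 2) ^ 2) * HyperbolicGAF.integralI L r := by
  obtain ⟨t, ht, rfl⟩ : ∃ t < 0, Real.exp t = r :=
    ⟨Real.log r, Real.log_neg hr0 hr1, Real.exp_log hr0⟩
  obtain ⟨b, hb, hba⟩ := HyperbolicGAF.exists_isTame ha_law
  have hae : ∀ n, b n =ᵐ[μ] a n := fun n => hba.mono fun ω h => h n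
  -- Off one null set the entire coefficient sequences agree, so the power series and their zeros
  -- agree there as well.
  have hfun : ∀ᵐ ω ∂μ, (fun n => b n ω) = fun n => a n ω := hba.mono fun ω h => funext h
  have hb_indep : iIndepFun b μ := ha_indep.congr fun n => (hae n).symm
  have hb_law : ∀ n, HasLaw (b n) HyperbolicGAF.stdComplexNormal μ :=
    fun n => (ha_law n).congr (hae n)
  obtain ⟨hmem, hvar⟩ := hb.variance_diskCount hL hb_indep hb_law ht
  have hcount : (fun ω => HyperbolicGAF.diskCount (HyperbolicGAF.gaf L (fun n => b n ω)) t) =ᵐ[μ]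
      fun ω => (HyperbolicGAF.zeroCount L (fun n => a n ω) (Real.exp t)).toReal :=
    hfun.mono fun ω h => by simp only [HyperbolicGAF.diskCount, HyperbolicGAF.zeroCount, h]
  refine ⟨?_, ?_, hmem.ae_eq hcount, fun θ hθ h0 => HyperbolicGAF.integrandI_pos hL ht hθ h0,
    HyperbolicGAF.intervalIntegrable_integrandI hL ht _ _, ?_⟩
  · filter_upwards [hfun] with ω h z hz
    rw [← h]
    exact (hb.hasSum_gaf hL ω (by simpa using hz)).summable
  · filter_upwards [hfun] with ω h
    rw [← h]
    exact HyperbolicGAF.zeroMeasure_lt_top (hb.analyticOnNhd_gaf hL ω) (hb.gaf_zero_ne hL ω) ht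
  · rw [← variance_congr hcount, hvar]
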